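/- Let $\mathbb T=\mathbb R/2\pi\mathbb Z$, $\int_{\mathbb T} f\,dx:=\frac1{2\pi}\int_{-\pi}^{\pi} f(x)\,dx$, $\hat f(k)=\int_{\mathbb T}f(x)e^{-ikx}\,dx$, $\langle k\rangle=\sqrt{1+k^2}$, and let $H^s=H^s(\mathbb T)$ be the Sobolev space with norm $\|f\|_{H^s}=\big(\sum_{k\in\mathbb Z}\langle k\rangle^{2s}|\hat f(k)|^2\big)^{1/2}$. Put $D^\alpha f=\sum_{k\in\mathbb Z}|k|^\alpha\hat f(k)e^{ikx}$, $P_+f=\sum_{k\ge1}\hat f(k)e^{ikx}$ and $P_-f=\sum_{k\ge1}\hat f(-k)e^{-ikx}$. Let $F(\zeta,\omega,\bar\zeta,\bar\omega)$ be a polynomial with complex coefficients, and let $F_\omega=\frac12\big(\frac{\partial F}{\partial a}-i\frac{\partial F}{\partial b}\big)$, $\omega=a+ib$, be its Wirtinger derivative. Consider the Cauchy problem $$\partial_tu+iD^\alpha u=F(u,\partial_xu,\overline u,\overline{\partial_xu}),\qquad u|_{t=0}=\phi. \tag{1}$$ For $T>0$, a function $u\in C([0,T];H^s)$ is called a solution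 of (1) if $$-\int_0^T\!\!\int_{\mathbb T}u\,\partial_t\chi\,dx\,dt-\int_{\mathbb T}\phi\,\chi(0,\cdot)\,dx+i\int_0^T\!\!\int_{\mathbb T}u\,D^\alpha\chi\,dx\,dt=\int_0^T\!\!\int_{\mathbb T}F(u,\partial_xu,\overline u,\overline{\partial_xu})\,\chi\,dx\,dt$$ for all $\chi\in C_c^\infty([0,T)\times\mathbb T)$. A function $u\in C([-T,0];H^s)$ is called a solution of (1) if the same identity, with $\int_0^T$ replaced by $\int_{-T}^0$ and with the sign of the term containing $\phi$ reversed, holds for all $\chi\in C_c^\infty((-T,0]\times\mathbb T)$. **Theorem.** Let $\alpha>2$, $s>\max\left(\frac\alpha2+1,\frac52\right)$, $\phi\in H^s$ and $T>0$. (a) Assume that $u\in C([0,T];H^s)$ is a solution of (1). - (i) If $\int_{\mathbb T}\operatorname{Im}F_\omega(\phi,\partial_x\phi,\overline\phi,\overline{\partial_x\phi})\,dx>0$, then $P_-\phi\in H^{s+\delta}$ for every $\delta\in(0,\min(\alpha-2,1))$. - (ii) If $\int_{\mathbb T}\operatorname{Im}F_\omega(\phi,\partial_x\phi,\overline\phi,\overline{\partial_x\phi})\,dx<0$,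 then $P_+\phi\in H^{s+\delta}$ for every $\delta\in(0,\min(\alpha-2,1))$. (b) If instead $u\in C([-T,0];H^s)$ is a solution of (1), then (i) and (ii) hold with $P_-\phi$ and $P_+\phi$ interchanged. -/

import Mathlib

open MeasureTheory Filter Topology AddCircle Real
open scoped ContDiff ComplexConjugate

namespace DerivFNLS

/-- The torus `𝕋 = ℝ / 2πℤ`. -/
abbrev Torus : Type := AddCircle (2 * π)

instance instFactTwoPiPos : Fact (0 < 2 * π) := ⟨Real.two_pi_pos⟩

/-- The normalized measure `dx / (2π)` on the torus.  With this measure `fourierCoeff f k` is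
`(1/2π) ∫_{-π}^{π} f(x) e^{-ikx} dx`, and `fourier k x = e^{ikx}`. -/
noncomputable abbrev dx : Measure Torus := haarAddCircle

/-- The Japanese bracket `⟨k⟩ = √(1 + |k|²)`. -/
noncomputable def bracket (k : ℤ) : ℝ := √(1 + (k : ℝ) ^ 2)

/-- `f ∈ H^s(𝕋)`, for an exponent `s ≥ 0`: such distributions are (classes of) square integrable
functions, and membership means that `∑ₖ ⟨k⟩^{2s} |f̂(k)|²` converges. -/
def MemSobolev (s : ℝ) (f : Torus → ℂ) : Prop :=
  MemLp f 2 dx ∧ Summable fun k : ℤ => bracket k ^ (2 * s) * ‖fourierCoeff f k‖ ^ 2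

/-- The norm `‖f‖_{H^s} = (∑ₖ ⟨k⟩^{2s} |f̂(k)|²)^{1/2}`, to be used for `f ∈ H^s(𝕋)`. -/
noncomputable def sobolevNorm (s : ℝ) (f : Torus → ℂ) : ℝ :=
  √(∑' k : ℤ, bracket k ^ (2 * s) * ‖fourierCoeff f k‖ ^ 2)

/-- `u ∈ C(I; H^s(𝕋))`. -/
def ContinuousInSobolev (s : ℝ) (I : Set ℝ) (u : ℝ → Torus → ℂ) : Prop :=
  (∀ t ∈ I, MemSobolev s (u t)) ∧
    ∀ t₀ ∈ I, Tendsto (fun t => sobolevNorm s (u t - u t₀)) (𝓝[I] t₀) (𝓝 0)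

/-- The Fourier multiplier `∑ₖ m(k) f̂(k) e^{ikx}`.  It is only used where this series converges
absolutely. -/
noncomputable def fourierMultiplier (m : ℤ → ℂ) (f : Torus → ℂ) (x : Torus) : ℂ :=
  ∑' k : ℤ, m k * fourierCoeff f k * fourier k x

/-- The derivative `∂ₓ f = ∑ₖ i k f̂(k) e^{ikx}`. -/
noncomputable def derivX (f : Torus → ℂ) : Torus → ℂ :=
  fourierMultiplier (fun k => Complex.I * (k : ℂ)) f

/-- The fractional derivative `D^α f = ∑ₖ |k|^α f̂(k) e^{ikx}`. -/
noncomputable def fracDeriv (α : ℝ) (f : Torus → ℂ) : Torus → ℂ :=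
  fourierMultiplier (fun k => ((|(k : ℝ)| ^ α : ℝ) : ℂ)) f

/-- The projection `P₊ f = ∑_{k ≥ 1} f̂(k) e^{ikx}` to the positive frequencies. -/
noncomputable def projPos (f : Torus → ℂ) : Torus → ℂ :=
  fourierMultiplier (fun k => if 0 < k then 1 else 0) f

/-- The projection `P₋ f = ∑_{k ≤ -1} f̂(k) e^{ikx}` to the negative frequencies. -/
noncomputable def projNeg (f : Torus → ℂ) : Torus → ℂ :=
  fourierMultiplier (fun k => if k < 0 then 1 else 0) f

/-- The value `F(ζ, w, ζ̄, w̄)` of a polynomial `F` in four variables. -/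
noncomputable def nonlin (F : MvPolynomial (Fin 4) ℂ) (ζ w : ℂ) : ℂ :=
  MvPolynomial.eval ![ζ, w, conj ζ, conj w] F

/-- The Wirtinger derivative `F_w = ½ (∂F/∂a - i ∂F/∂b)`, `w = a + i b`, with respect to the second
variable (often written `F_ω`), at `(ζ, w, ζ̄, w̄)`. -/
noncomputable def nonlinOmega (F : MvPolynomial (Fin 4) ℂ) (ζ w : ℂ) : ℂ :=
  (1 / 2 : ℂ) * (deriv (fun a : ℝ => nonlin F ζ (w + (a : ℂ))) 0
    - Complex.I * deriv (fun b : ℝ => nonlin F ζ (w + (b : ℂ) * Complex.I)) 0)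

/-- `∫_𝕋 Im F_ω(φ, ∂ₓφ, φ̄, ∂ₓφ̄) dx`. -/
noncomputable def imOmegaMean (F : MvPolynomial (Fin 4) ℂ) (φ : Torus → ℂ) : ℝ :=
  ∫ x, (nonlinOmega F (φ x) (derivX φ x)).im ∂dx

/-- Smooth functions on `ℝ × 𝕋`: the lift to `ℝ × ℝ` is smooth. -/
def SmoothOnCylinder (χ : ℝ → Torus → ℂ) : Prop :=
  ContDiff ℝ ∞ fun p : ℝ × ℝ => χ p.1 (p.2 : Torus)

/-- `χ ∈ C_c^∞([0,T) × 𝕋)` (as the restriction of a smooth function on `ℝ × 𝕋`): `χ` vanishes at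
all times past some `T' < T`. -/
def IsForwardTest (T : ℝ) (χ : ℝ → Torus → ℂ) : Prop :=
  SmoothOnCylinder χ ∧ ∃ T' < T, ∀ t, T' ≤ t → ∀ x, χ t x = 0

/-- `χ ∈ C_c^∞((-T,0] × 𝕋)` (as the restriction of a smooth function on `ℝ × 𝕋`). -/
def IsBackwardTest (T : ℝ) (χ : ℝ → Torus → ℂ) : Prop :=
  SmoothOnCylinder χ ∧ ∃ T' < T, ∀ t, t ≤ -T' → ∀ x, χ t x = 0

/-- `u ∈ C([0,T]; H^s(𝕋))` is a solution of
`∂ₜu + i D^α u = F(u, ∂ₓu, ū, ∂ₓū)`, `u|_{t=0} = φ`, in the sense of distributions.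
(Being continuous on a compact interval, `u` belongs to `L^∞([0,T]; H^s(𝕋))`.) -/
structure IsForwardSolution (F : MvPolynomial (Fin 4) ℂ) (α s T : ℝ) (φ : Torus → ℂ)
    (u : ℝ → Torus → ℂ) : Prop where
  continuous : ContinuousInSobolev s (Set.Icc 0 T) u
  weak : ∀ χ : ℝ → Torus → ℂ, IsForwardTest T χ →
    -(∫ t in (0 : ℝ)..T, ∫ x, u t x * deriv (fun τ => χ τ x) t ∂dx)
      - (∫ x, φ x * χ 0 x ∂dx)
      + Complex.I * (∫ t in (0 : ℝ)..T, ∫ x, u t x * fracDeriv α (χ t) x ∂dx)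
    = ∫ t in (0 : ℝ)..T, ∫ x, nonlin F (u t x) (derivX (u t) x) * χ t x ∂dx

/-- `u ∈ C([-T,0]; H^s(𝕋))` is a solution of the same problem backward in time.  Integration by
parts in time over `[-T,0]` produces the datum with the opposite sign. -/
structure IsBackwardSolution (F : MvPolynomial (Fin 4) ℂ) (α s T : ℝ) (φ : Torus → ℂ)
    (u : ℝ → Torus → ℂ) : Prop where
  continuous : ContinuousInSobolev s (Set.Icc (-T) 0) u
  weak : ∀ χ : ℝ → Torus → ℂ, IsBackwardTest T χ →
    -(∫ t in (-T)..(0 : ℝ), ∫ x, u t x * deriv (fun τ => χ τ x) t ∂dx)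
      + (∫ x, φ x * χ 0 x ∂dx)
      + Complex.I * (∫ t in (-T)..(0 : ℝ), ∫ x, u t x * fracDeriv α (χ t) x ∂dx)
    = ∫ t in (-T)..(0 : ℝ), ∫ x, nonlin F (u t x) (derivX (u t) x) * χ t x ∂dx

end DerivFNLS

/-!
Since `s > 5/2`, the functions `u` and `∂ₓu` have absolutely convergent Fourier series, and the weak
formulation amounts to an ordinary differential equation for each Fourier coefficient
(`hasDerivAt_of_weak`). Backward solutions are reflected in time, which changes a sign `θ = ±1` in
these equations. Differentiated once in `x`, the equation is quasilinear:

`∂ₜ(∂ₓu) + i D^α ∂ₓu = F_ω ∂ₓ²u + F_ω̄ ∂ₓ²ū` + terms without second derivatives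

(`hasSum_deriv_nonlinearity`). On the `k`-th Fourier coefficient, the mean `m(t)` of `F_ω` acts as
multiplication by `i k m(t)`, whose real part is `-k Im m(t)`. If `Im m(0) > 0`, negative frequencies
therefore grow like `exp (q |k| t)` for short times. Read backwards, the value at time `0` is the
value at a time `τ > 0` damped by `exp (-q |k| τ)`, plus a Duhamel integral with kernel
`exp (-q |k| t) ≲ |k|^(-γ) t^(-γ)`. For `γ < 1` this kernel is integrable, so `γ` derivatives are
gained on the forcing (`sqnorm_lintegral_le`, `IsCoeffSolution.sqnorm_lt_top`).

The rest of the second order terms has to be removed, as it would cost a full derivative. Where the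
frequency `j` of the coefficient `F_ω` or `F_ω̄` is comparable to or larger than the output
frequency `k`, derivatives can be moved to the coefficient. For `2 |j| ≤ |k|`, and `j ≠ 0` in the
case of `F_ω`, the resonance functions `|k|^α - |k - j|^α` and `|k|^α + |k - j|^α` are at least of
size `⟨k⟩^(α-1) ⟨j⟩` (`nonresonant_neg_one`, `nonresonant_one`), so that a normal form
transformation applies (`hasDerivAt_corrected`). The derivative falls on the coefficients too, and
`∂ₜF_ω` would contain `D^α` of `u`. For that reason the coefficients are computed from the
truncation of `u` to frequencies at most `|k|`: then `α - 2` of the `α` derivatives are paid for by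
`|k|^(α-2)`, and the other two are absorbed by `s > 5/2` and by the factor `⟨j⟩⁻¹` of the
nonresonance bound (`maj_trunc_rhs_le`, `exists_isMajorant`). The truncation error gains a factor
`|k|⁻¹`. What remains is a forcing with `κ = max (3 - α) 0` derivatives fewer than `∂ₓu`
(`exists_forcing_bound`), and `δ = γ - κ` takes all values in `(0, min (α - 2) 1)`.

Only the moduli of Fourier coefficients matter for the estimates, which are carried out for
sequences with values in `[0, ∞]`, where sums and convolutions need no convergence hypotheses. A
bound for a polynomial in `u, ∂ₓu, ū, ∂ₓū` is a majorant of its Fourier coefficients which is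
controlled in a weighted `ℓ¹` and a weighted `ℓ²` norm and does not depend on the truncation.
-/

namespace DerivFNLS

open scoped ENNReal

/-! ### The Japanese bracket -/

lemma one_le_bracket (k : ℤ) : 1 ≤ bracket k := by
  rw [bracket, Real.one_le_sqrt]
  nlinarith [sq_nonneg (k : ℝ)]

lemma bracket_pos (k : ℤ) : 0 < bracket k := zero_lt_one.trans_le (one_le_bracket k)

lemma bracket_sq (k : ℤ) : bracket k ^ 2 = 1 + (k : ℝ) ^ 2 :=
  Real.sq_sqrt (by positivity)

@[simp] lemma bracket_zero : bracket 0 = 1 := by simp [bracket]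

@[simp] lemma bracket_neg (k : ℤ) : bracket (-k) = bracket k := by simp [bracket]

lemma abs_le_bracket (k : ℤ) : |(k : ℝ)| ≤ bracket k :=
  Real.abs_le_sqrt (by linarith)

lemma bracket_le_two_mul {k : ℤ} (hk : k ≠ 0) : bracket k ≤ 2 * |(k : ℝ)| := by
  have h : (1 : ℝ) ≤ |(k : ℝ)| := by exact_mod_cast Int.one_le_abs hk
  refine Real.sqrt_le_iff.2 ⟨by positivity, ?_⟩
  rw [mul_pow, sq_abs]
  nlinarith [sq_abs (k : ℝ)]

lemma bracket_add_le (j l : ℤ) : bracket (j + l) ≤ bracket j + bracket l := by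
  refine Real.sqrt_le_iff.2 ⟨by linarith [bracket_pos j, bracket_pos l], ?_⟩
  have h1 := bracket_sq j
  have h2 := bracket_sq l
  have h3 : (j : ℝ) * l ≤ bracket j * bracket l := by
    refine (le_abs_self _).trans ?_
    rw [abs_mul]
    exact mul_le_mul (abs_le_bracket j) (abs_le_bracket l) (abs_nonneg _) (bracket_pos j).le
  push_cast
  nlinarith

lemma bracket_add_le_mul (j l : ℤ) : bracket (j + l) ≤ 2 * bracket j * bracket l := by
  nlinarith [bracket_add_le j l, one_le_bracket j, one_le_bracket l]

lemma bracket_le_bracket {j k : ℤ} {c : ℝ} (hc : 1 ≤ c) (h : |(k : ℝ)| ≤ c * |(j : ℝ)|) :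
    bracket k ≤ c * bracket j := by
  refine Real.sqrt_le_iff.2 ⟨by have := bracket_pos j; positivity, ?_⟩
  rw [mul_pow, bracket_sq, ← sq_abs (k : ℝ), ← sq_abs (j : ℝ)]
  nlinarith [abs_nonneg (k : ℝ), abs_nonneg (j : ℝ)]

/-! ### Weighted sequence norms and convolution -/

/-- The weight `⟨k⟩^r` as an extended nonnegative real. -/
noncomputable def wt (r : ℝ) (k : ℤ) : ℝ≥0∞ := ENNReal.ofReal (bracket k ^ r)

/-- The weighted `ℓ¹` norm `∑ₖ ⟨k⟩^r aₖ` of a nonnegative sequence. -/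
noncomputable def wnorm (r : ℝ) (a : ℤ → ℝ≥0∞) : ℝ≥0∞ := ∑' k, wt r k * a k

/-- The squared weighted `ℓ²` norm `∑ₖ (⟨k⟩^r aₖ)²` of a nonnegative sequence. -/
noncomputable def sqnorm (r : ℝ) (a : ℤ → ℝ≥0∞) : ℝ≥0∞ := ∑' k, (wt r k * a k) ^ 2

/-- Convolution of nonnegative sequences on `ℤ`. -/
noncomputable def conv (a b : ℤ → ℝ≥0∞) (k : ℤ) : ℝ≥0∞ := ∑' j, a j * b (k - j)

@[simp] lemma wt_neg_index (r : ℝ) (k : ℤ) : wt r (-k) = wt r k := by simp [wt]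

@[simp] lemma wt_zero (k : ℤ) : wt 0 k = 1 := by simp [wt]

@[simp] lemma wt_ne_top (r : ℝ) (k : ℤ) : wt r k ≠ ⊤ := ENNReal.ofReal_ne_top

lemma wt_add (r r' : ℝ) (k : ℤ) : wt (r + r') k = wt r k * wt r' k := by
  rw [wt, wt, wt, Real.rpow_add (bracket_pos k),
    ENNReal.ofReal_mul (by have := bracket_pos k; positivity)]

lemma wt_mul_neg (r : ℝ) (k : ℤ) : wt r k * wt (-r) k = 1 := by
  rw [← wt_add]; simp

lemma wt_sq (r : ℝ) (k : ℤ) : wt r k ^ 2 = wt (2 * r) k := by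
  rw [two_mul, wt_add, sq]

lemma wt_mono {r r' : ℝ} (h : r ≤ r') (k : ℤ) : wt r k ≤ wt r' k :=
  ENNReal.ofReal_le_ofReal (Real.rpow_le_rpow_of_exponent_le (one_le_bracket k) h)

lemma one_le_wt {r : ℝ} (h : 0 ≤ r) (k : ℤ) : 1 ≤ wt r k := by
  simpa using wt_mono h k

lemma wt_one (k : ℤ) : wt 1 k = ENNReal.ofReal (bracket k) := by simp [wt]

lemma wt_one_zero : wt 1 0 = 1 := by simp [wt]

lemma wt_le_of_abs_le {r : ℝ} (hr : 0 ≤ r) {j k : ℤ} {c : ℝ} (hc : 1 ≤ c)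
    (h : |(k : ℝ)| ≤ c * |(j : ℝ)|) : wt r k ≤ ENNReal.ofReal (c ^ r) * wt r j := by
  rw [wt, wt, ← ENNReal.ofReal_mul (by positivity),
    ← Real.mul_rpow (by positivity) (bracket_pos j).le]
  exact ENNReal.ofReal_le_ofReal
    (Real.rpow_le_rpow (bracket_pos k).le (bracket_le_bracket hc h) hr)

lemma wt_one_add_le (j l : ℤ) : wt 1 (j + l) ≤ 2 * wt 1 j * wt 1 l := by
  simp only [wt_one]
  rw [← ENNReal.ofReal_ofNat 2, ← ENNReal.ofReal_mul (by positivity),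
    ← ENNReal.ofReal_mul (by have := bracket_pos j; positivity)]
  exact ENNReal.ofReal_le_ofReal (bracket_add_le_mul j l)

lemma wt_neg_one_add_le (j l : ℤ) : wt (-1) (j + l) ≤ 2 * wt (-1) j * wt 1 l := by
  simp only [wt, Real.rpow_neg_one, Real.rpow_one]
  rw [← ENNReal.ofReal_ofNat 2, ← ENNReal.ofReal_mul (by positivity),
    ← ENNReal.ofReal_mul (by have := bracket_pos j; positivity)]
  refine ENNReal.ofReal_le_ofReal ?_
  have h := bracket_add_le_mul (j + l) (-l)
  rw [add_neg_cancel_right, bracket_neg] at h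
  have h1 := bracket_pos j
  have h2 := bracket_pos (j + l)
  rw [inv_le_iff_one_le_mul₀ h2]
  have : 2 * (bracket j)⁻¹ * bracket l * bracket (j + l)
      = (2 * bracket (j + l) * bracket l) / bracket j := by ring
  rw [this, one_le_div h1]
  exact h

lemma wt_add_le_add {r : ℝ} (hr : 0 ≤ r) (j l : ℤ) :
    wt r (j + l) ≤ ENNReal.ofReal (2 ^ r) * (wt r j + wt r l) := by
  have hj := bracket_pos j
  have hl := bracket_pos l
  rw [wt, wt, wt, ← ENNReal.ofReal_add (by positivity) (by positivity),
    ← ENNReal.ofReal_mul (by positivity)]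
  refine ENNReal.ofReal_le_ofReal ?_
  have hm : bracket (j + l) ≤ 2 * max (bracket j) (bracket l) := by
    linarith [bracket_add_le j l, le_max_left (bracket j) (bracket l),
      le_max_right (bracket j) (bracket l)]
  calc bracket (j + l) ^ r ≤ (2 * max (bracket j) (bracket l)) ^ r :=
        Real.rpow_le_rpow (bracket_pos _).le hm hr
    _ = 2 ^ r * (max (bracket j) (bracket l)) ^ r :=
        Real.mul_rpow (by norm_num) (le_max_of_le_left hj.le)
    _ ≤ _ := by
        refine mul_le_mul_of_nonneg_left ?_ (by positivity)
        rcases max_choice (bracket j) (bracket l) with h | h <;> rw [h]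
        · linarith [Real.rpow_nonneg hl.le r]
        · linarith [Real.rpow_nonneg hj.le r]

lemma ENNReal_two_mul_le (x y : ℝ≥0∞) : 2 * (x * y) ≤ x ^ 2 + y ^ 2 := by
  wlog h : x ≤ y generalizing x y
  · have := this y x (le_of_not_ge h)
    rwa [mul_comm y x, add_comm] at this
  obtain ⟨d, rfl⟩ := le_iff_exists_add.1 h
  have : x ^ 2 + (x + d) ^ 2 = 2 * (x * (x + d)) + d ^ 2 := by ring
  rw [this]
  exact le_self_add

/-- The Cauchy–Schwarz inequality with respect to the measure of density `φ`. -/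
lemma sq_lintegral_mul_le {X : Type*} [MeasurableSpace X] {μ : Measure X} {φ f : X → ℝ≥0∞}
    (hφ : AEMeasurable φ μ) (hf : AEMeasurable f μ) :
    (∫⁻ x, φ x * f x ∂μ) ^ 2 ≤ (∫⁻ x, φ x ∂μ) * ∫⁻ x, φ x * f x ^ 2 ∂μ := by
  have hφf : AEMeasurable (fun x => φ x * f x) μ := hφ.mul hf
  have hφf2 : AEMeasurable (fun x => φ x * f x ^ 2) μ := hφ.mul (hf.pow_const 2)
  have h1 : 2 * (∫⁻ x, φ x * f x ∂μ) ^ 2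
      = ∫⁻ x, ∫⁻ y, 2 * ((φ x * f x) * (φ y * f y)) ∂μ ∂μ := by
    have : ∀ x, ∫⁻ y, 2 * ((φ x * f x) * (φ y * f y)) ∂μ
        = 2 * (∫⁻ y, φ y * f y ∂μ) * (φ x * f x) := by
      intro x
      rw [lintegral_const_mul'' _ (hφf.const_mul _), lintegral_const_mul'' _ hφf]
      ring
    simp_rw [this]
    rw [lintegral_const_mul'' _ hφf]
    ring
  have h2 : ∫⁻ x, ∫⁻ y, (φ x * f x ^ 2 * φ y + φ x * (φ y * f y ^ 2)) ∂μ ∂μ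
      = 2 * ((∫⁻ x, φ x ∂μ) * ∫⁻ x, φ x * f x ^ 2 ∂μ) := by
    have : ∀ x, ∫⁻ y, (φ x * f x ^ 2 * φ y + φ x * (φ y * f y ^ 2)) ∂μ
        = (∫⁻ y, φ y ∂μ) * (φ x * f x ^ 2) + (∫⁻ y, φ y * f y ^ 2 ∂μ) * φ x := by
      intro x
      rw [lintegral_add_left' (hφ.const_mul _), lintegral_const_mul'' _ hφ,
        lintegral_const_mul'' _ hφf2]
      ring
    simp_rw [this]
    rw [lintegral_add_left' (hφf2.const_mul _), lintegral_const_mul'' _ hφ,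
        lintegral_const_mul'' _ hφf2]
    ring
  have h3 : 2 * (∫⁻ x, φ x * f x ∂μ) ^ 2
      ≤ 2 * ((∫⁻ x, φ x ∂μ) * ∫⁻ x, φ x * f x ^ 2 ∂μ) := by
    rw [h1, ← h2]
    refine lintegral_mono fun x => lintegral_mono fun y => ?_
    calc 2 * ((φ x * f x) * (φ y * f y)) = φ x * φ y * (2 * (f x * f y)) := by ring
      _ ≤ φ x * φ y * (f x ^ 2 + f y ^ 2) := by gcongr; exact ENNReal_two_mul_le _ _
      _ = _ := by ring
  exact (ENNReal.mul_le_mul_iff_right (by norm_num) (by norm_num)).1 h3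

lemma sq_tsum_mul_le (φ f : ℤ → ℝ≥0∞) :
    (∑' j, φ j * f j) ^ 2 ≤ (∑' j, φ j) * ∑' j, φ j * f j ^ 2 := by
  simpa [lintegral_count] using sq_lintegral_mul_le (μ := Measure.count) (φ := φ) (f := f)
    (measurable_of_countable _).aemeasurable (measurable_of_countable _).aemeasurable

lemma tsum_comp_sub (b : ℤ → ℝ≥0∞) (j : ℤ) : ∑' k, b (k - j) = ∑' k, b k :=
  (Equiv.subRight j).tsum_eq b

lemma tsum_comp_sub_left (b : ℤ → ℝ≥0∞) (k : ℤ) : ∑' j, b (k - j) = ∑' j, b j :=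
  (Equiv.subLeft k).tsum_eq b

lemma tsum_comp_neg (b : ℤ → ℝ≥0∞) : ∑' j, b (-j) = ∑' j, b j :=
  (Equiv.neg ℤ).tsum_eq b

lemma conv_comm (a b : ℤ → ℝ≥0∞) (k : ℤ) : conv a b k = conv b a k := by
  rw [conv, ← tsum_comp_sub_left _ k, conv]
  refine tsum_congr fun j => ?_
  rw [sub_sub_cancel, mul_comm]

lemma conv_mono {a a' b b' : ℤ → ℝ≥0∞} (h : ∀ j, a j ≤ a' j) (h' : ∀ j, b j ≤ b' j) (k : ℤ) :
    conv a b k ≤ conv a' b' k :=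
  ENNReal.tsum_le_tsum fun j => mul_le_mul' (h j) (h' _)

lemma conv_const_mul (c : ℝ≥0∞) (a b : ℤ → ℝ≥0∞) (k : ℤ) :
    conv a (fun j => c * b j) k = c * conv a b k := by
  rw [conv, conv, ← ENNReal.tsum_mul_left]
  exact tsum_congr fun j => by ring

/-- Young's inequality `ℓ¹ * ℓ² ⊆ ℓ²`. -/
lemma tsum_conv_sq_le (a b : ℤ → ℝ≥0∞) :
    ∑' k, conv a b k ^ 2 ≤ (∑' j, a j) ^ 2 * ∑' k, b k ^ 2 := by
  calc ∑' k, conv a b k ^ 2 ≤ ∑' k, (∑' j, a j) * ∑' j, a j * b (k - j) ^ 2 :=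
        ENNReal.tsum_le_tsum fun k => sq_tsum_mul_le a fun j => b (k - j)
    _ = (∑' j, a j) * ∑' j, ∑' k, a j * b (k - j) ^ 2 := by
        rw [ENNReal.tsum_mul_left, ENNReal.tsum_comm]
    _ = (∑' j, a j) * ∑' j, a j * ∑' k, b k ^ 2 := by
        congr 1
        refine tsum_congr fun j => ?_
        rw [ENNReal.tsum_mul_left, tsum_comp_sub (fun k => b k ^ 2)]
    _ = _ := by rw [ENNReal.tsum_mul_right]; ring

lemma wnorm_conv_le {r : ℝ} (hr : ∀ j l, wt r (j + l) ≤ 2 * wt r j * wt 1 l)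
    (a b : ℤ → ℝ≥0∞) : wnorm r (conv a b) ≤ 2 * wnorm r a * wnorm 1 b := by
  calc wnorm r (conv a b) = ∑' j, ∑' k, wt r k * (a j * b (k - j)) := by
        rw [wnorm, ENNReal.tsum_comm]
        exact tsum_congr fun k => by rw [conv, ENNReal.tsum_mul_left]
    _ ≤ ∑' j, ∑' k, 2 * (wt r j * a j) * (wt 1 (k - j) * b (k - j)) := by
        refine ENNReal.tsum_le_tsum fun j => ENNReal.tsum_le_tsum fun k => ?_
        have h := hr j (k - j)
        rw [add_sub_cancel] at h
        calc wt r k * (a j * b (k - j)) ≤ (2 * wt r j * wt 1 (k - j)) * (a j * b (k - j)) := by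
              gcongr
          _ = _ := by ring
    _ = _ := by
        simp_rw [ENNReal.tsum_mul_left]
        simp_rw [tsum_comp_sub (fun k => wt 1 k * b k)]
        rw [ENNReal.tsum_mul_right, ENNReal.tsum_mul_left, wnorm, wnorm]

lemma wnorm_mono {r r' : ℝ} (h : r ≤ r') {a b : ℤ → ℝ≥0∞} (hab : ∀ k, a k ≤ b k) :
    wnorm r a ≤ wnorm r' b :=
  ENNReal.tsum_le_tsum fun k => mul_le_mul' (wt_mono h k) (hab k)

lemma sqnorm_mono {r r' : ℝ} (h : r ≤ r') {a b : ℤ → ℝ≥0∞} (hab : ∀ k, a k ≤ b k) :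
    sqnorm r a ≤ sqnorm r' b :=
  ENNReal.tsum_le_tsum fun k => pow_le_pow_left' (mul_le_mul' (wt_mono h k) (hab k)) 2

lemma wnorm_zero (a : ℤ → ℝ≥0∞) : wnorm 0 a = ∑' k, a k := by simp [wnorm]

lemma wnorm_add (r : ℝ) (a b : ℤ → ℝ≥0∞) :
    wnorm r (fun k => a k + b k) = wnorm r a + wnorm r b := by
  simp [wnorm, mul_add, ENNReal.tsum_add]

lemma wnorm_wt_mul (r q : ℝ) (a : ℤ → ℝ≥0∞) :
    wnorm r (fun k => wt q k * a k) = wnorm (r + q) a :=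
  tsum_congr fun k => by rw [wt_add, mul_assoc]

lemma sqnorm_wt_mul (r q : ℝ) (a : ℤ → ℝ≥0∞) :
    sqnorm r (fun k => wt q k * a k) = sqnorm (r + q) a :=
  tsum_congr fun k => by rw [wt_add, mul_assoc]

lemma wnorm_comp_neg (r : ℝ) (a : ℤ → ℝ≥0∞) : wnorm r (fun k => a (-k)) = wnorm r a := by
  rw [wnorm, wnorm, ← tsum_comp_neg fun k => wt r k * a k]
  simp

lemma sqnorm_comp_neg (r : ℝ) (a : ℤ → ℝ≥0∞) : sqnorm r (fun k => a (-k)) = sqnorm r a := by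
  rw [sqnorm, sqnorm, ← tsum_comp_neg fun k => (wt r k * a k) ^ 2]
  simp

lemma ENNReal_add_sq_le (x y : ℝ≥0∞) : (x + y) ^ 2 ≤ 2 * x ^ 2 + 2 * y ^ 2 := by
  calc (x + y) ^ 2 = x ^ 2 + 2 * (x * y) + y ^ 2 := by ring
    _ ≤ x ^ 2 + (x ^ 2 + y ^ 2) + y ^ 2 := by gcongr; exact ENNReal_two_mul_le x y
    _ = _ := by ring

lemma sqnorm_add_le (r : ℝ) (a b : ℤ → ℝ≥0∞) :
    sqnorm r (fun k => a k + b k) ≤ 2 * sqnorm r a + 2 * sqnorm r b := by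
  rw [sqnorm, sqnorm, sqnorm, ← ENNReal.tsum_mul_left, ← ENNReal.tsum_mul_left, ← ENNReal.tsum_add]
  refine ENNReal.tsum_le_tsum fun k => ?_
  rw [mul_add]
  exact ENNReal_add_sq_le _ _

lemma sqnorm_const_mul (r : ℝ) (c : ℝ≥0∞) (a : ℤ → ℝ≥0∞) :
    sqnorm r (fun k => c * a k) = c ^ 2 * sqnorm r a := by
  rw [sqnorm, sqnorm, ← ENNReal.tsum_mul_left]
  exact tsum_congr fun k => by ring

/-- Young's inequality with the weight transferred to the second factor, which is possible on the
part of the convolution where the frequencies of the result and of the second factor are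
comparable. -/
lemma sqnorm_le_of_le_conv {r : ℝ} {C : ℝ≥0∞} {v a b : ℤ → ℝ≥0∞}
    (h : ∀ k, wt r k * v k ≤ C * conv a (fun l => wt r l * b l) k) :
    sqnorm r v ≤ C ^ 2 * ((∑' j, a j) ^ 2 * sqnorm r b) := by
  calc sqnorm r v ≤ ∑' k, (C * conv a (fun l => wt r l * b l) k) ^ 2 :=
        ENNReal.tsum_le_tsum fun k => pow_le_pow_left' (h k) 2
    _ = C ^ 2 * ∑' k, (conv a (fun l => wt r l * b l) k) ^ 2 := by
        rw [← ENNReal.tsum_mul_left]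
        exact tsum_congr fun k => by rw [mul_pow]
    _ ≤ _ := by
        gcongr
        exact tsum_conv_sq_le _ _

/-- Product estimate `‖fg‖_{H^r} ≲ ‖f‖_{H^r} ‖ĝ‖_{ℓ¹} + ‖f̂‖_{ℓ¹} ‖g‖_{H^r}` for majorants. -/
lemma sqnorm_conv_le {r : ℝ} (hr : 0 ≤ r) (a b : ℤ → ℝ≥0∞) :
    sqnorm r (conv a b) ≤ ENNReal.ofReal (2 ^ r) ^ 2 *
      (2 * ((∑' j, b j) ^ 2 * sqnorm r a) + 2 * ((∑' j, a j) ^ 2 * sqnorm r b)) := by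
  set C := ENNReal.ofReal (2 ^ r)
  have key : ∀ k, wt r k * conv a b k
      ≤ C * (conv b (fun l => wt r l * a l) k + conv a (fun l => wt r l * b l) k) := by
    intro k
    rw [conv_comm b, conv, conv, conv, ← ENNReal.tsum_add, ← ENNReal.tsum_mul_left,
      ← ENNReal.tsum_mul_left]
    refine ENNReal.tsum_le_tsum fun j => ?_
    have h := wt_add_le_add hr j (k - j)
    rw [add_sub_cancel] at h
    calc wt r k * (a j * b (k - j))
        ≤ (C * (wt r j + wt r (k - j))) * (a j * b (k - j)) := by gcongr
      _ = _ := by ring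
  calc sqnorm r (conv a b)
      ≤ ∑' k, C ^ 2 * (2 * conv b (fun l => wt r l * a l) k ^ 2
          + 2 * conv a (fun l => wt r l * b l) k ^ 2) := by
        refine ENNReal.tsum_le_tsum fun k => ?_
        refine (pow_le_pow_left' (key k) 2).trans ?_
        rw [mul_pow]
        gcongr
        exact ENNReal_add_sq_le _ _
    _ = C ^ 2 * (2 * ∑' k, conv b (fun l => wt r l * a l) k ^ 2
          + 2 * ∑' k, conv a (fun l => wt r l * b l) k ^ 2) := by
        rw [ENNReal.tsum_mul_left, ENNReal.tsum_add, ENNReal.tsum_mul_left, ENNReal.tsum_mul_left]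
    _ ≤ _ := by
        gcongr
        · exact tsum_conv_sq_le _ _
        · exact tsum_conv_sq_le _ _

lemma summable_bracket_rpow {p : ℝ} (hp : 1 < p) : Summable fun k : ℤ => bracket k ^ (-p) := by
  refine Summable.of_nonneg_of_le (fun k => Real.rpow_nonneg (bracket_pos k).le _)
    (fun k => ?_) (((Real.summable_abs_int_rpow hp)).add
      (summable_of_ne_finset_zero (s := {0}) (f := fun k : ℤ => if k = 0 then (1 : ℝ) else 0)
        fun k hk => if_neg (by simpa using hk)))
  by_cases hk : k = 0
  · subst hk
    simp only [bracket_zero, Real.one_rpow, if_true]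
    have : (0 : ℝ) ≤ |((0 : ℤ) : ℝ)| ^ (-p) := Real.rpow_nonneg (abs_nonneg _) _
    linarith
  · simp only [hk, if_false, add_zero]
    have h : (0 : ℝ) < |(k : ℝ)| := by positivity
    exact Real.rpow_le_rpow_of_nonpos h (abs_le_bracket k) (by linarith)

lemma tsum_wt_lt_top {p : ℝ} (hp : p < -1) : ∑' k, wt p k < ⊤ := by
  have h := summable_bracket_rpow (p := -p) (by linarith)
  rw [neg_neg] at h
  exact h.tsum_ofReal_lt_top

/-- `H^σ` embeds into the weighted Wiener algebra as soon as `σ > r + 1/2`. -/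
lemma wnorm_le_sqnorm (r σ : ℝ) (a : ℤ → ℝ≥0∞) :
    wnorm r a ≤ (∑' k, wt (2 * (r - σ)) k) + sqnorm σ a := by
  rw [wnorm, sqnorm, ← ENNReal.tsum_add]
  refine ENNReal.tsum_le_tsum fun k => ?_
  have h : wt r k * a k = wt (r - σ) k * (wt σ k * a k) := by
    rw [← mul_assoc, ← wt_add, sub_add_cancel]
  rw [h, ← wt_sq]
  refine le_trans ?_ (ENNReal_two_mul_le _ _)
  rw [two_mul]
  exact le_self_add

/-! ### Fourier coefficients of continuous functions -/

/-- The sequence of absolute values of the Fourier coefficients. -/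
noncomputable def absCoeff (f : C(Torus, ℂ)) (k : ℤ) : ℝ≥0∞ := ‖fourierCoeff f k‖ₑ

lemma integrable_dx (f : C(Torus, ℂ)) : Integrable f dx :=
  f.continuous.integrable_of_hasCompactSupport (HasCompactSupport.of_compactSpace _)

/-- The `k`-th Fourier coefficient as a continuous linear functional on `C(𝕋)`. -/
noncomputable def coeffL (k : ℤ) : C(Torus, ℂ) →L[ℂ] ℂ :=
  LinearMap.mkContinuous
    { toFun := fun f => fourierCoeff f k
      map_add' := fun f g => by
        rw [ContinuousMap.coe_add, fourierCoeff.add (integrable_dx f) (integrable_dx g)]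
        rfl
      map_smul' := fun c f => by
        rw [ContinuousMap.coe_smul, fourierCoeff.const_smul]
        rfl } 1 fun f => by
    rw [one_mul]
    refine (norm_integral_le_of_norm_le_const (C := ‖f‖) (ae_of_all _ fun x => ?_)).trans ?_
    · rw [norm_smul]
      have : ‖fourier (-k) x‖ = 1 := by rw [fourier_apply, Circle.norm_coe]
      rw [this, one_mul]
      exact f.norm_coe_le_norm x
    · simp

@[simp] lemma coeffL_apply (k : ℤ) (f : C(Torus, ℂ)) : coeffL k f = fourierCoeff f k := rfl

lemma fourierCoeff_fourier_mul (f : C(Torus, ℂ)) (j k : ℤ) :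
    fourierCoeff (fourier j * f : C(Torus, ℂ)) k = fourierCoeff f (k - j) := by
  refine integral_congr_ae (ae_of_all _ fun x => ?_)
  simp only [ContinuousMap.mul_apply, smul_eq_mul]
  rw [← mul_assoc, ← fourier_add]
  congr 3
  ring

lemma summable_norm_of_tsum_enorm_ne_top {a : ℤ → ℂ} (h : ∑' k, ‖a k‖ₑ ≠ ⊤) :
    Summable fun k => ‖a k‖ := by
  exact NNReal.summable_coe.2 (ENNReal.tsum_coe_ne_top_iff_summable.1 h)

/-- The Fourier coefficients of a product are the convolution of the Fourier coefficients. -/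
lemma hasSum_fourierCoeff_mul {f : C(Torus, ℂ)} (hf : ∑' k, absCoeff f k ≠ ⊤) (g : C(Torus, ℂ))
    (k : ℤ) : HasSum (fun j => fourierCoeff f j * fourierCoeff g (k - j))
      (fourierCoeff (f * g : C(Torus, ℂ)) k) := by
  have h1 := hasSum_fourier_series_of_summable
    (summable_norm_of_tsum_enorm_ne_top (a := fourierCoeff f) hf).of_norm
  have h2 := ((h1.mul_right g).mapL (coeffL k))
  convert h2 using 2 with j
  · rw [smul_mul_assoc, map_smul, coeffL_apply, fourierCoeff_fourier_mul, smul_eq_mul]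
  · rfl

lemma absCoeff_mul_le {f : C(Torus, ℂ)} (hf : ∑' k, absCoeff f k ≠ ⊤) (g : C(Torus, ℂ))
    (k : ℤ) : absCoeff (f * g) k ≤ conv (absCoeff f) (absCoeff g) k := by
  rw [absCoeff, ← (hasSum_fourierCoeff_mul hf g k).tsum_eq]
  refine (enorm_tsum_le_tsum_enorm).trans (ENNReal.tsum_le_tsum fun j => ?_)
  rw [enorm_mul]
  rfl

lemma absCoeff_add_le (f g : C(Torus, ℂ)) (k : ℤ) :
    absCoeff (f + g) k ≤ absCoeff f k + absCoeff g k := by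
  have : fourierCoeff (f + g : C(Torus, ℂ)) k = fourierCoeff f k + fourierCoeff g k :=
    map_add (coeffL k) f g
  rw [absCoeff, this]
  exact enorm_add_le _ _

/-- The continuous function with given absolutely summable Fourier coefficients. -/
noncomputable def ofCoeff (c : ℤ → ℂ) : C(Torus, ℂ) := ∑' k, c k • fourier k

lemma norm_smul_fourier (z : ℂ) (k : ℤ) : ‖z • (fourier k : C(Torus, ℂ))‖ = ‖z‖ := by
  rw [norm_smul, fourier_norm, mul_one]

lemma summable_smul_fourier {c : ℤ → ℂ} (h : Summable fun k => ‖c k‖) :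
    Summable fun k => c k • (fourier k : C(Torus, ℂ)) :=
  Summable.of_norm (by simpa only [norm_smul_fourier] using h)

lemma hasSum_ofCoeff {c : ℤ → ℂ} (h : Summable fun k => ‖c k‖) :
    HasSum (fun k => c k • (fourier k : C(Torus, ℂ))) (ofCoeff c) :=
  (summable_smul_fourier h).hasSum

lemma fourierCoeff_ofCoeff {c : ℤ → ℂ} (h : Summable fun k => ‖c k‖) (k : ℤ) :
    fourierCoeff (ofCoeff c) k = c k := by
  have h1 := (hasSum_ofCoeff h).mapL (coeffL k)
  have h2 : HasSum (fun j => coeffL k (c j • fourier j)) (c k) := by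
    have : ∀ j, coeffL k (c j • fourier j) = if j = k then c k else 0 := by
      intro j
      rw [map_smul, coeffL_apply, fourierCoeff_fourier]
      by_cases hjk : j = k
      · subst hjk; simp
      · simp [hjk, Ne.symm hjk]
    simp_rw [this]
    exact hasSum_ite_eq k (c k)
  exact h1.unique h2

lemma ofCoeff_apply {c : ℤ → ℂ} (h : Summable fun k => ‖c k‖) (x : Torus) :
    ofCoeff c x = ∑' k, c k * fourier k x := by
  have h1 := ContinuousMap.hasSum_apply (hasSum_ofCoeff h) x
  exact h1.tsum_eq.symm

lemma norm_ofCoeff_le {c : ℤ → ℂ} (h : Summable fun k => ‖c k‖) : ‖ofCoeff c‖ ≤ ∑' k, ‖c k‖ := by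
  refine (norm_tsum_le_tsum_norm ?_).trans_eq ?_
  · simpa only [norm_smul_fourier] using h
  · simp only [norm_smul_fourier]

lemma ofCoeff_sub {c d : ℤ → ℂ} (hc : Summable fun k => ‖c k‖) (hd : Summable fun k => ‖d k‖) :
    ofCoeff c - ofCoeff d = ofCoeff fun k => c k - d k := by
  rw [ofCoeff, ofCoeff, ofCoeff, ← (summable_smul_fourier hc).tsum_sub (summable_smul_fourier hd)]
  exact tsum_congr fun k => by rw [sub_smul]

lemma ofCoeff_conj_neg {c : ℤ → ℂ} (h : Summable fun k => ‖c k‖) (x : Torus) :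
    ofCoeff (fun k => conj (c (-k))) x = conj (ofCoeff c x) := by
  have h' : Summable fun k => ‖conj (c (-k))‖ := by
    simpa [Function.comp_def] using (Equiv.neg ℤ).summable_iff.2 h
  rw [ofCoeff_apply h', ofCoeff_apply h, Complex.conj_tsum, ← (Equiv.neg ℤ).tsum_eq]
  refine tsum_congr fun k => ?_
  simp

/-! ### Derivations and polynomials -/

/-- A relation on a commutative algebra that is linear and satisfies the Leibniz rule passes from
the arguments of a polynomial to its values, by the chain rule. -/
lemma rel_aeval {ι A : Type*} [Fintype ι] [DecidableEq ι] [CommRing A] [Algebra ℂ A]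
    (R : A → A → Prop) (hconst : ∀ z : ℂ, R (algebraMap ℂ A z) 0)
    (hadd : ∀ f f' g g', R f f' → R g g' → R (f + g) (f' + g'))
    (hmul : ∀ f f' g g', R f f' → R g g' → R (f * g) (f' * g + f * g'))
    {a a' : ι → A} (ha : ∀ i, R (a i) (a' i)) (p : MvPolynomial ι ℂ) :
    R (MvPolynomial.aeval a p) (∑ i, MvPolynomial.aeval a (MvPolynomial.pderiv i p) * a' i) := by
  induction p using MvPolynomial.induction_on with
  | C z => simpa using hconst z
  | add p q hp hq =>
    have := hadd _ _ _ _ hp hq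
    simpa [add_mul, Finset.sum_add_distrib] using this
  | mul_X p i hp =>
    have := hmul _ _ _ _ hp (ha i)
    convert this using 1
    · simp
    · simp only [MvPolynomial.pderiv_mul, map_add, map_mul, MvPolynomial.aeval_X, add_mul,
        Finset.sum_add_distrib, Finset.sum_mul]
      congr 1
      · exact Finset.sum_congr rfl fun j _ => by ring
      · rw [Finset.sum_eq_single i]
        · simp
        · intro j _ hji
          simp [MvPolynomial.pderiv_X_of_ne hji.symm]
        · simp

/-- The chain rule for a polynomial evaluated along a curve in a commutative normed algebra. -/
lemma hasDerivAt_aeval {ι A : Type*} [Fintype ι] [DecidableEq ι] [NormedCommRing A]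
    [NormedAlgebra ℂ A] {a : ℝ → ι → A} {a' : ι → A} {t : ℝ}
    (ha : ∀ i, HasDerivAt (fun τ => a τ i) (a' i) t) (p : MvPolynomial ι ℂ) :
    HasDerivAt (fun τ => MvPolynomial.aeval (a τ) p)
      (∑ i, MvPolynomial.aeval (a t) (MvPolynomial.pderiv i p) * a' i) t := by
  have h := rel_aeval (A := ℝ → A) (fun f f' => HasDerivAt f (f' t) t)
    (fun z => hasDerivAt_const t (algebraMap ℂ A z)) (fun _ _ _ _ hf hg => hf.add hg)
    (fun _ _ _ _ hf hg => hf.mul hg) (a := fun i τ => a τ i) (a' := fun i _ => a' i) ha p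
  have heval : ∀ (q : MvPolynomial ι ℂ) (τ : ℝ),
      MvPolynomial.aeval (fun i σ => a σ i) q τ = MvPolynomial.aeval (a τ) q := fun q τ =>
    (MvPolynomial.comp_aeval_apply (fun i σ => a σ i) (Pi.evalAlgHom ℂ (fun _ : ℝ => A) τ) q)
  convert h using 1
  · exact funext fun τ => (heval p τ).symm
  · simp only [Finset.sum_apply, Pi.mul_apply, heval]

/-! ### Majorants of polynomial expressions -/

lemma wt_zero_add_le (j l : ℤ) : wt 0 (j + l) ≤ 2 * wt 0 j * wt 1 l := by
  simp only [wt_zero, mul_one]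
  exact (one_le_wt zero_le_one l).trans (le_mul_of_one_le_left' (by norm_num))

lemma tsum_le_wnorm_one (a : ℤ → ℝ≥0∞) : ∑' k, a k ≤ wnorm 1 a := by
  rw [← wnorm_zero]
  exact wnorm_mono zero_le_one fun _ => le_rfl

lemma absCoeff_const (z : ℂ) (k : ℤ) :
    absCoeff (algebraMap ℂ C(Torus, ℂ) z) k = if k = 0 then ‖z‖ₑ else 0 := by
  have h : algebraMap ℂ C(Torus, ℂ) z = z • fourier 0 := by
    ext x
    simp [Algebra.algebraMap_eq_smul_one]
  rw [absCoeff, ← coeffL_apply, h, map_smul, coeffL_apply, fourierCoeff_fourier]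
  by_cases hk : k = 0
  · subst hk; simp
  · simp [hk]

/-- The Fourier coefficients of a polynomial in functions whose coefficients are dominated by `A`
are dominated by a sequence which depends only on `A`, and which inherits its norms. -/
lemma exists_majorant {ι : Type*} {σ : ℝ} (hσ : 0 ≤ σ) {K : ℝ≥0∞} (hK : K ≠ ⊤)
    (p : MvPolynomial ι ℂ) :
    ∃ C : ℝ≥0∞, C ≠ ⊤ ∧ ∀ A : ℤ → ℝ≥0∞, wnorm 1 A ≤ K → sqnorm σ A ≤ K →
      ∃ M : ℤ → ℝ≥0∞, wnorm 1 M ≤ C ∧ sqnorm σ M ≤ C ∧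
        ∀ b : ι → C(Torus, ℂ), (∀ i k, absCoeff (b i) k ≤ A k) →
          ∀ k, absCoeff (MvPolynomial.aeval b p) k ≤ M k := by
  induction p using MvPolynomial.induction_on with
  | C z =>
    refine ⟨‖z‖ₑ + ‖z‖ₑ ^ 2, by finiteness, fun A _ _ =>
      ⟨fun k => if k = 0 then ‖z‖ₑ else 0, ?_, ?_, fun b _ k => ?_⟩⟩
    · rw [wnorm, tsum_eq_single 0 (fun k hk => by simp [hk])]
      simp [wt]
    · rw [sqnorm, tsum_eq_single 0 (fun k hk => by simp [hk])]
      simp [wt]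
    · rw [MvPolynomial.aeval_C, absCoeff_const]
  | add p q hp hq =>
    obtain ⟨C₁, hC₁, h₁⟩ := hp
    obtain ⟨C₂, hC₂, h₂⟩ := hq
    refine ⟨2 * C₁ + 2 * C₂, by finiteness, fun A hA hA' => ?_⟩
    obtain ⟨M₁, h11, h12, h13⟩ := h₁ A hA hA'
    obtain ⟨M₂, h21, h22, h23⟩ := h₂ A hA hA'
    refine ⟨fun k => M₁ k + M₂ k, ?_, ?_, fun b hb k => ?_⟩
    · rw [wnorm_add]
      refine (add_le_add h11 h21).trans (add_le_add ?_ ?_) <;>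
      exact le_mul_of_one_le_left' (by norm_num)
    · refine (sqnorm_add_le _ _ _).trans ?_
      gcongr
    · rw [map_add]
      exact (absCoeff_add_le _ _ _).trans (add_le_add (h13 b hb k) (h23 b hb k))
  | mul_X p i hp =>
    obtain ⟨C₁, hC₁, h₁⟩ := hp
    refine ⟨2 * C₁ * K + ENNReal.ofReal (2 ^ σ) ^ 2 * (2 * (K ^ 2 * C₁) + 2 * (C₁ ^ 2 * K)),
      by finiteness, fun A hA hA' => ?_⟩
    obtain ⟨M, h11, h12, h13⟩ := h₁ A hA hA'
    refine ⟨conv M A, ?_, ?_, fun b hb k => ?_⟩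
    · refine (wnorm_conv_le wt_one_add_le M A).trans (le_trans ?_ le_self_add)
      gcongr
    · refine (sqnorm_conv_le hσ M A).trans (le_trans ?_ le_add_self)
      have h1 := (tsum_le_wnorm_one A).trans hA
      have h2 := (tsum_le_wnorm_one M).trans h11
      gcongr
    · rw [map_mul, MvPolynomial.aeval_X]
      refine (absCoeff_mul_le (ne_top_of_le_ne_top hC₁ ?_) _ k).trans
        (conv_mono (h13 b hb) (hb i) k)
      exact (ENNReal.tsum_le_tsum (h13 b hb)).trans ((tsum_le_wnorm_one M).trans h11)

/-- Lipschitz dependence of a polynomial on its arguments, at the level of majorants. -/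
lemma exists_majorant_sub {ι : Type*} {σ : ℝ} (hσ : 0 ≤ σ) {K : ℝ≥0∞} (hK : K ≠ ⊤)
    (p : MvPolynomial ι ℂ) :
    ∃ C : ℝ≥0∞, C ≠ ⊤ ∧ ∀ A B : ℤ → ℝ≥0∞, wnorm 1 A ≤ K → sqnorm σ A ≤ K → wnorm 0 B ≤ K →
      ∃ Z : ℤ → ℝ≥0∞, wnorm 0 Z ≤ C ∧
        ∀ (b b' : ι → C(Torus, ℂ)) (ε : ℝ≥0∞), (∀ i k, absCoeff (b i) k ≤ A k) →
          (∀ i k, absCoeff (b' i) k ≤ A k) → (∀ i k, absCoeff (b i - b' i) k ≤ ε * B k) →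
          ∀ k, absCoeff (MvPolynomial.aeval b p - MvPolynomial.aeval b' p) k ≤ ε * Z k := by
  induction p using MvPolynomial.induction_on with
  | C z =>
    refine ⟨0, by finiteness, fun A B _ _ _ => ⟨fun _ => 0, ?_, fun b b' ε _ _ _ k => ?_⟩⟩
    · simp [wnorm]
    · rw [MvPolynomial.aeval_C, MvPolynomial.aeval_C, sub_self, ← map_zero (algebraMap ℂ _),
        absCoeff_const]
      simp
  | add p q hp hq =>
    obtain ⟨C₁, hC₁, h₁⟩ := hp
    obtain ⟨C₂, hC₂, h₂⟩ := hq
    refine ⟨C₁ + C₂, by finiteness, fun A B hA hA' hB => ?_⟩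
    obtain ⟨M₁, h11, h12⟩ := h₁ A B hA hA' hB
    obtain ⟨M₂, h21, h22⟩ := h₂ A B hA hA' hB
    refine ⟨fun k => M₁ k + M₂ k, ?_, fun b b' ε hb hb' hd k => ?_⟩
    · rw [wnorm_add]
      exact add_le_add h11 h21
    · rw [map_add, map_add, add_sub_add_comm, mul_add]
      exact (absCoeff_add_le _ _ _).trans
        (add_le_add (h12 b b' ε hb hb' hd k) (h22 b b' ε hb hb' hd k))
  | mul_X p i hp =>
    obtain ⟨C₁, hC₁, h₁⟩ := hp
    obtain ⟨C₂, hC₂, h₂⟩ := exists_majorant hσ hK p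
    refine ⟨2 * C₁ * K + 2 * K * C₂, by finiteness, fun A B hA hA' hB => ?_⟩
    obtain ⟨Z, h11, h12⟩ := h₁ A B hA hA' hB
    obtain ⟨M, h21, h22, h23⟩ := h₂ A hA hA'
    refine ⟨fun k => conv Z A k + conv B M k, ?_, fun b b' ε hb hb' hd k => ?_⟩
    · rw [wnorm_add]
      refine add_le_add ((wnorm_conv_le wt_zero_add_le Z A).trans ?_)
        ((wnorm_conv_le wt_zero_add_le B M).trans ?_) <;> gcongr
    · have hsplit : MvPolynomial.aeval b (p * MvPolynomial.X i)
          - MvPolynomial.aeval b' (p * MvPolynomial.X i)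
          = b i * (MvPolynomial.aeval b p - MvPolynomial.aeval b' p)
            + MvPolynomial.aeval b' p * (b i - b' i) := by
        simp only [map_mul, MvPolynomial.aeval_X]
        ring
      rw [hsplit, mul_add, conv_comm Z A, conv_comm B M, ← conv_const_mul, ← conv_const_mul]
      refine (absCoeff_add_le _ _ _).trans (add_le_add ?_ ?_)
      · refine (absCoeff_mul_le (ne_top_of_le_ne_top hK ?_) _ k).trans
          (conv_mono (hb i) (h12 b b' ε hb hb' hd) k)
        exact (ENNReal.tsum_le_tsum (hb i)).trans ((tsum_le_wnorm_one A).trans hA)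
      · refine (absCoeff_mul_le (ne_top_of_le_ne_top hC₂ ?_) _ k).trans
          (conv_mono (h23 b' hb') (hd i) k)
        exact (ENNReal.tsum_le_tsum (h23 b' hb')).trans ((tsum_le_wnorm_one M).trans h21)

/-! ### The arguments of the nonlinearity in terms of Fourier coefficients -/

/-- The Fourier coefficients of `u`, `∂ₓu`, `ū` and `∂ₓū` in terms of those of `u`. -/
noncomputable def varCoeff (c : ℤ → ℂ) : Fin 4 → ℤ → ℂ :=
  ![c, fun k => Complex.I * k * c k, fun k => conj (c (-k)), fun k => Complex.I * k * conj (c (-k))]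

/-- The tuple `(u, ∂ₓu, ū, ∂ₓū)`, for `u` with Fourier coefficients `c`. -/
noncomputable def vars (c : ℤ → ℂ) (i : Fin 4) : C(Torus, ℂ) := ofCoeff (varCoeff c i)

/-- The tuple of the derivatives in `x` of `vars c`. -/
noncomputable def derivVars (c : ℤ → ℂ) (i : Fin 4) : C(Torus, ℂ) :=
  ofCoeff fun k => Complex.I * k * varCoeff c i k

/-- A common majorant of the Fourier coefficients of `u`, `∂ₓu`, `ū` and `∂ₓū`. -/
noncomputable def maj (c : ℤ → ℂ) (k : ℤ) : ℝ≥0∞ := wt 1 k * (‖c k‖ₑ + ‖c (-k)‖ₑ)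

/-- The frequency truncation of a sequence of Fourier coefficients to `|k| ≤ N`. -/
def trunc (N : ℕ) (c : ℤ → ℂ) (k : ℤ) : ℂ := if k.natAbs ≤ N then c k else 0

lemma enorm_I_mul_le (k : ℤ) : ‖Complex.I * (k : ℂ)‖ₑ ≤ wt 1 k := by
  rw [wt_one, ← ofReal_norm]
  refine ENNReal.ofReal_le_ofReal ?_
  rw [norm_mul, Complex.norm_I, one_mul, Complex.norm_intCast]
  exact abs_le_bracket k

lemma enorm_conj (z : ℂ) : ‖conj z‖ₑ = ‖z‖ₑ := by
  rw [← ofReal_norm, ← ofReal_norm, RCLike.norm_conj]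

lemma enorm_varCoeff_le (c : ℤ → ℂ) (i : Fin 4) (k : ℤ) : ‖varCoeff c i k‖ₑ ≤ maj c k := by
  have h1 : (1 : ℝ≥0∞) ≤ wt 1 k := one_le_wt zero_le_one k
  fin_cases i
  · exact (le_self_add).trans (le_mul_of_one_le_left' h1)
  · simp only [varCoeff, Fin.mk_one, Matrix.cons_val_one, Matrix.cons_val_zero, enorm_mul _ (c k)]
    exact mul_le_mul' (enorm_I_mul_le k) le_self_add
  · change ‖conj (c (-k))‖ₑ ≤ _
    rw [enorm_conj]
    exact (le_add_self).trans (le_mul_of_one_le_left' h1)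
  · change ‖Complex.I * k * conj (c (-k))‖ₑ ≤ _
    rw [enorm_mul, enorm_conj]
    exact mul_le_mul' (enorm_I_mul_le k) le_add_self

lemma enorm_deriv_varCoeff_le (c : ℤ → ℂ) (i : Fin 4) (k : ℤ) :
    ‖Complex.I * k * varCoeff c i k‖ₑ ≤ wt 1 k * maj c k := by
  rw [enorm_mul]
  exact mul_le_mul' (enorm_I_mul_le k) (enorm_varCoeff_le c i k)

lemma maj_mono {c d : ℤ → ℂ} (h : ∀ k, ‖c k‖ₑ ≤ ‖d k‖ₑ) (k : ℤ) : maj c k ≤ maj d k :=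
  mul_le_mul' le_rfl (add_le_add (h k) (h (-k)))

lemma sqnorm_maj_le (σ : ℝ) (c : ℤ → ℂ) :
    sqnorm σ (maj c) ≤ 4 * sqnorm (σ + 1) fun k => ‖c k‖ₑ := by
  have h1 : sqnorm σ (maj c) = sqnorm (σ + 1) fun k => ‖c k‖ₑ + ‖c (-k)‖ₑ :=
    sqnorm_wt_mul σ 1 fun k => ‖c k‖ₑ + ‖c (-k)‖ₑ
  rw [h1]
  refine (sqnorm_add_le _ _ _).trans_eq ?_
  rw [sqnorm_comp_neg (σ + 1) fun k => ‖c k‖ₑ]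
  ring

section

variable {c : ℤ → ℂ}

lemma summable_varCoeff (hc : wnorm 1 (maj c) ≠ ⊤) (i : Fin 4) :
    Summable fun k => ‖varCoeff c i k‖ :=
  summable_norm_of_tsum_enorm_ne_top (ne_top_of_le_ne_top hc
    ((ENNReal.tsum_le_tsum (enorm_varCoeff_le c i)).trans (tsum_le_wnorm_one _)))

lemma summable_deriv_varCoeff (hc : wnorm 1 (maj c) ≠ ⊤) (i : Fin 4) :
    Summable fun k : ℤ => ‖Complex.I * k * varCoeff c i k‖ :=
  summable_norm_of_tsum_enorm_ne_top (ne_top_of_le_ne_top hc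
    (ENNReal.tsum_le_tsum (enorm_deriv_varCoeff_le c i)))

lemma fourierCoeff_vars (hc : wnorm 1 (maj c) ≠ ⊤) (i : Fin 4) (k : ℤ) :
    fourierCoeff (vars c i) k = varCoeff c i k :=
  fourierCoeff_ofCoeff (summable_varCoeff hc i) k

lemma fourierCoeff_derivVars (hc : wnorm 1 (maj c) ≠ ⊤) (i : Fin 4) (k : ℤ) :
    fourierCoeff (derivVars c i) k = Complex.I * k * varCoeff c i k :=
  fourierCoeff_ofCoeff (summable_deriv_varCoeff hc i) k

lemma absCoeff_vars_le (hc : wnorm 1 (maj c) ≠ ⊤) (i : Fin 4) (k : ℤ) :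
    absCoeff (vars c i) k ≤ maj c k := by
  rw [absCoeff, fourierCoeff_vars hc]
  exact enorm_varCoeff_le c i k

lemma vars_one_apply (hc : wnorm 1 (maj c) ≠ ⊤) (x : Torus) :
    vars c 1 x = ∑' k : ℤ, Complex.I * k * c k * fourier k x :=
  ofCoeff_apply (summable_varCoeff hc 1) x

lemma vars_two_apply (hc : wnorm 1 (maj c) ≠ ⊤) (x : Torus) :
    vars c 2 x = conj (vars c 0 x) :=
  ofCoeff_conj_neg (summable_varCoeff hc 0) x

lemma vars_three_apply (hc : wnorm 1 (maj c) ≠ ⊤) (x : Torus) :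
    vars c 3 x = conj (vars c 1 x) := by
  rw [vars, vars, ← ofCoeff_conj_neg (summable_varCoeff hc 1) x]
  congr 2
  funext k
  simp [varCoeff]

lemma enorm_trunc_le (N : ℕ) (c : ℤ → ℂ) (k : ℤ) : ‖trunc N c k‖ₑ ≤ ‖c k‖ₑ := by
  unfold trunc
  split_ifs <;> simp

lemma varCoeff_trunc (N : ℕ) (c : ℤ → ℂ) (i : Fin 4) (k : ℤ) :
    varCoeff (trunc N c) i k = if k.natAbs ≤ N then varCoeff c i k else 0 := by
  fin_cases i <;> by_cases h : k.natAbs ≤ N <;> simp [varCoeff, trunc, h]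

lemma wnorm_maj_trunc (hc : wnorm 1 (maj c) ≠ ⊤) (N : ℕ) : wnorm 1 (maj (trunc N c)) ≠ ⊤ :=
  ne_top_of_le_ne_top hc (wnorm_mono le_rfl (maj_mono (enorm_trunc_le N c)))

lemma absCoeff_vars_trunc_le (hc : wnorm 1 (maj c) ≠ ⊤) (N : ℕ) (i : Fin 4) (k : ℤ) :
    absCoeff (vars (trunc N c) i) k ≤ maj c k :=
  (absCoeff_vars_le (wnorm_maj_trunc hc N) i k).trans (maj_mono (enorm_trunc_le N c) k)

lemma absCoeff_vars_sub_trunc_le (hc : wnorm 1 (maj c) ≠ ⊤) {N : ℕ} (hN : 1 ≤ N) (i : Fin 4)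
    (k : ℤ) :
    absCoeff (vars c i - vars (trunc N c) i) k ≤ (N : ℝ≥0∞)⁻¹ * (wt 1 k * maj c k) := by
  have h : fourierCoeff (vars c i - vars (trunc N c) i : C(Torus, ℂ)) k
      = if k.natAbs ≤ N then 0 else varCoeff c i k := by
    rw [← coeffL_apply, map_sub, coeffL_apply, coeffL_apply, fourierCoeff_vars hc,
      fourierCoeff_vars (wnorm_maj_trunc hc N), varCoeff_trunc]
    split_ifs <;> simp
  rw [absCoeff, h]
  split_ifs with hk
  · simp
  · refine (enorm_varCoeff_le c i k).trans ?_
    rw [← mul_assoc]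
    refine le_mul_of_one_le_left' ?_
    have h1 : (N : ℝ≥0∞) ≤ wt 1 k := by
      rw [wt_one, ← ENNReal.ofReal_natCast]
      refine ENNReal.ofReal_le_ofReal (le_trans ?_ (abs_le_bracket k))
      have h2 : N ≤ k.natAbs := by omega
      calc (N : ℝ) ≤ (k.natAbs : ℝ) := by exact_mod_cast h2
        _ = |(k : ℝ)| := by rw [Nat.cast_natAbs, Int.cast_abs]
    rw [← ENNReal.inv_mul_cancel (a := (N : ℝ≥0∞)) (by positivity) (by simp)]
    gcongr

end

lemma vars_trunc_eq_sum (N : ℕ) (c : ℤ → ℂ) (i : Fin 4) :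
    vars (trunc N c) i = ∑ k ∈ Finset.Icc (-(N : ℤ)) N, varCoeff c i k • fourier k := by
  rw [vars, ofCoeff, tsum_eq_sum (s := Finset.Icc (-(N : ℤ)) N)]
  · refine Finset.sum_congr rfl fun k hk => ?_
    rw [Finset.mem_Icc] at hk
    rw [varCoeff_trunc, if_pos (by omega)]
  · intro k hk
    rw [Finset.mem_Icc] at hk
    rw [varCoeff_trunc, if_neg (by omega), zero_smul]

lemma hasDerivAt_varCoeff {c : ℝ → ℤ → ℂ} {c' : ℤ → ℂ} {t : ℝ}
    (h : ∀ k, HasDerivAt (fun τ => c τ k) (c' k) t) (i : Fin 4) (k : ℤ) :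
    HasDerivAt (fun τ => varCoeff (c τ) i k) (varCoeff c' i k) t := by
  fin_cases i
  · exact h k
  · exact (h k).const_mul _
  · exact (h (-k)).star
  · exact ((h (-k)).star).const_mul _

lemma hasDerivAt_vars_trunc {c : ℝ → ℤ → ℂ} {c' : ℤ → ℂ} {t : ℝ}
    (h : ∀ k, HasDerivAt (fun τ => c τ k) (c' k) t) (N : ℕ) (i : Fin 4) :
    HasDerivAt (fun τ => vars (trunc N (c τ)) i) (vars (trunc N c') i) t := by
  simp only [vars_trunc_eq_sum]
  exact HasDerivAt.fun_sum fun k _ => (hasDerivAt_varCoeff h i k).smul_const _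

lemma continuous_varCoeff {c : ℝ → ℤ → ℂ} (h : ∀ k, Continuous fun τ => c τ k) (i : Fin 4)
    (k : ℤ) : Continuous fun τ => varCoeff (c τ) i k := by
  fin_cases i
  · exact h k
  · exact (h k).const_mul _
  · exact (h (-k)).star
  · exact ((h (-k)).star).const_mul _

lemma continuous_vars_trunc {c : ℝ → ℤ → ℂ} (h : ∀ k, Continuous fun τ => c τ k) (N : ℕ)
    (i : Fin 4) : Continuous fun τ => vars (trunc N (c τ)) i := by
  simp only [vars_trunc_eq_sum]
  exact continuous_finsetSum _ fun k _ => (continuous_varCoeff h i k).smul continuous_const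

lemma continuous_aeval {ι A : Type*} [NormedCommRing A] [NormedAlgebra ℂ A] {a : ℝ → ι → A}
    (h : ∀ i, Continuous fun τ => a τ i) (p : MvPolynomial ι ℂ) :
    Continuous fun τ => MvPolynomial.aeval (a τ) p := by
  induction p using MvPolynomial.induction_on with
  | C z => simpa using continuous_const
  | add p q hp hq =>
    simp only [map_add]
    exact hp.add hq
  | mul_X p i hp =>
    simp only [map_mul, MvPolynomial.aeval_X]
    exact hp.mul (h i)

/-! ### Differentiating the nonlinearity in `x` -/

lemma tsum_conv (a b : ℤ → ℝ≥0∞) : ∑' k, conv a b k = (∑' k, a k) * ∑' k, b k := by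
  simp_rw [conv]
  rw [ENNReal.tsum_comm]
  simp_rw [ENNReal.tsum_mul_left, tsum_comp_sub b]
  rw [ENNReal.tsum_mul_right]

/-- `f'` is the derivative of `f`, both having absolutely convergent Fourier series, in terms of
Fourier coefficients. -/
def IsFourierDeriv (f f' : C(Torus, ℂ)) : Prop :=
  ∑' k, absCoeff f k ≠ ⊤ ∧ ∑' k, absCoeff f' k ≠ ⊤ ∧
    ∀ k : ℤ, fourierCoeff f' k = Complex.I * k * fourierCoeff f k

lemma tsum_absCoeff_mul_ne_top {f g : C(Torus, ℂ)} (hf : ∑' k, absCoeff f k ≠ ⊤)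
    (hg : ∑' k, absCoeff g k ≠ ⊤) : ∑' k, absCoeff (f * g) k ≠ ⊤ := by
  refine ne_top_of_le_ne_top ?_ (ENNReal.tsum_le_tsum (absCoeff_mul_le hf g))
  rw [tsum_conv]
  exact ENNReal.mul_ne_top hf hg

lemma tsum_absCoeff_add_ne_top {f g : C(Torus, ℂ)} (hf : ∑' k, absCoeff f k ≠ ⊤)
    (hg : ∑' k, absCoeff g k ≠ ⊤) : ∑' k, absCoeff (f + g) k ≠ ⊤ := by
  refine ne_top_of_le_ne_top ?_ (ENNReal.tsum_le_tsum (absCoeff_add_le f g))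
  rw [ENNReal.tsum_add]
  exact ENNReal.add_ne_top.2 ⟨hf, hg⟩

lemma IsFourierDeriv.add {f f' g g' : C(Torus, ℂ)} (hf : IsFourierDeriv f f')
    (hg : IsFourierDeriv g g') : IsFourierDeriv (f + g) (f' + g') := by
  refine ⟨tsum_absCoeff_add_ne_top hf.1 hg.1, tsum_absCoeff_add_ne_top hf.2.1 hg.2.1,
    fun k => ?_⟩
  simp only [← coeffL_apply, map_add]
  simp only [coeffL_apply, hf.2.2 k, hg.2.2 k]
  ring

lemma IsFourierDeriv.mul {f f' g g' : C(Torus, ℂ)} (hf : IsFourierDeriv f f')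
    (hg : IsFourierDeriv g g') : IsFourierDeriv (f * g) (f' * g + f * g') := by
  refine ⟨tsum_absCoeff_mul_ne_top hf.1 hg.1, tsum_absCoeff_add_ne_top
    (tsum_absCoeff_mul_ne_top hf.2.1 hg.1) (tsum_absCoeff_mul_ne_top hf.1 hg.2.1), fun k => ?_⟩
  have h1 := (hasSum_fourierCoeff_mul hf.1 g k).mul_left (Complex.I * k)
  have h2 := (hasSum_fourierCoeff_mul hf.2.1 g k).add (hasSum_fourierCoeff_mul hf.1 g' k)
  rw [← coeffL_apply, map_add, coeffL_apply, coeffL_apply]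
  have e : (fun j => fourierCoeff f' j * fourierCoeff g (k - j)
      + fourierCoeff f j * fourierCoeff g' (k - j))
      = fun j => Complex.I * k * (fourierCoeff f j * fourierCoeff g (k - j)) := by
    funext j
    rw [hf.2.2, hg.2.2]
    push_cast
    ring
  rw [← e] at h1
  exact h2.unique h1

lemma isFourierDeriv_const (z : ℂ) : IsFourierDeriv (algebraMap ℂ C(Torus, ℂ) z) 0 := by
  refine ⟨?_, ?_, fun k => ?_⟩
  · simp_rw [absCoeff_const]
    rw [tsum_eq_single 0 (fun k hk => by simp [hk])]
    simp
  · rw [← map_zero (algebraMap ℂ _)]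
    simp_rw [absCoeff_const]
    simp
  · have h := absCoeff_const z k
    rw [← coeffL_apply, map_zero]
    by_cases hk : k = 0
    · simp [hk]
    · rw [if_neg hk, absCoeff, enorm_eq_zero] at h
      rw [h, mul_zero]

lemma isFourierDeriv_vars {c : ℤ → ℂ} (hc : wnorm 1 (maj c) ≠ ⊤) (i : Fin 4) :
    IsFourierDeriv (vars c i) (derivVars c i) := by
  refine ⟨?_, ?_, fun k => ?_⟩
  · exact ne_top_of_le_ne_top hc
      ((ENNReal.tsum_le_tsum (absCoeff_vars_le hc i)).trans (tsum_le_wnorm_one _))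
  · refine ne_top_of_le_ne_top hc (ENNReal.tsum_le_tsum fun k => ?_)
    rw [absCoeff, fourierCoeff_derivVars hc]
    exact enorm_deriv_varCoeff_le c i k
  · rw [fourierCoeff_derivVars hc, fourierCoeff_vars hc]

/-- The quasilinear structure of `∂ₓ(F(u, ∂ₓu, ū, ∂ₓū))` on the Fourier side: up to a term without
second derivatives, it is `F_ω ∂ₓ²u + F_ω̄ ∂ₓ²ū`. -/
lemma hasSum_deriv_nonlinearity {c : ℤ → ℂ} (hc : wnorm 1 (maj c) ≠ ⊤)
    (F : MvPolynomial (Fin 4) ℂ) (k : ℤ) :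
    HasSum (fun j : ℤ =>
        fourierCoeff (MvPolynomial.aeval (vars c) (MvPolynomial.pderiv 1 F)) j
          * (Complex.I * ↑(k - j) * varCoeff c 1 (k - j))
        + fourierCoeff (MvPolynomial.aeval (vars c) (MvPolynomial.pderiv 3 F)) j
          * (Complex.I * ↑(k - j) * varCoeff c 3 (k - j)))
      (Complex.I * k * fourierCoeff (MvPolynomial.aeval (vars c) F) k
        - fourierCoeff (MvPolynomial.aeval (vars c) (MvPolynomial.pderiv 0 F * MvPolynomial.X 1
          + MvPolynomial.pderiv 2 F * MvPolynomial.X 3)) k) := by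
  have hrel := fun p => rel_aeval IsFourierDeriv isFourierDeriv_const
    (fun _ _ _ _ hf hg => hf.add hg) (fun _ _ _ _ hf hg => hf.mul hg) (isFourierDeriv_vars hc) p
  have h1 := (hrel F).2.2 k
  have hG := hasSum_fourierCoeff_mul (hrel (MvPolynomial.pderiv 1 F)).1 (derivVars c 1) k
  have hH := hasSum_fourierCoeff_mul (hrel (MvPolynomial.pderiv 3 F)).1 (derivVars c 3) k
  simp only [fourierCoeff_derivVars hc] at hG hH
  have h0 : derivVars c 0 = vars c 1 := rfl
  have h2 : derivVars c 2 = vars c 3 := rfl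
  convert hG.add hH using 1
  rw [← h1, Fin.sum_univ_four, h0, h2]
  simp only [← coeffL_apply, map_add, map_mul, MvPolynomial.aeval_X]
  ring

/-! ### Majorants along the flow, with frequency truncation -/

/-- The Fourier coefficients of `p(u, ∂ₓu, ū, ∂ₓū)`, for `u` with Fourier coefficients `c`. -/
noncomputable def nlCoeff (p : MvPolynomial (Fin 4) ℂ) (c : ℤ → ℂ) (k : ℤ) : ℂ :=
  fourierCoeff (MvPolynomial.aeval (vars c) p) k

/-- The right-hand side of the evolution of the Fourier coefficients.  The sign `θ` is `1` for the
equation itself and `-1` for its time reversal. -/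
noncomputable def rhs (F : MvPolynomial (Fin 4) ℂ) (α θ : ℝ) (c : ℤ → ℂ) (k : ℤ) : ℂ :=
  θ * (-(Complex.I * ((|(k : ℝ)| ^ α : ℝ) : ℂ)) * c k + nlCoeff F c k)

/-- The time derivative of `p(u_N, ∂ₓu_N, ū_N, ∂ₓū_N)`, where `u_N` is the truncation of `u` to
frequencies `|k| ≤ N` and `∂ₜu` has Fourier coefficients `c'`. -/
noncomputable def truncDeriv (p : MvPolynomial (Fin 4) ℂ) (N : ℕ) (c c' : ℤ → ℂ) : C(Torus, ℂ) :=
  ∑ i, MvPolynomial.aeval (vars (trunc N c)) (MvPolynomial.pderiv i p) * vars (trunc N c') i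

/-- Majorants of the Fourier coefficients of `p(u, ∂ₓu, ū, ∂ₓū)` and of its truncations (`M`), of
the truncation error (`Z`) and of the time derivative of the truncations (`Y`). The point is that
they do not depend on the truncation parameter. -/
structure IsMajorant (F p : MvPolynomial (Fin 4) ℂ) (α θ : ℝ) (c : ℤ → ℂ)
    (M Z Y : ℤ → ℝ≥0∞) : Prop where
  full : ∀ k, ‖nlCoeff p c k‖ₑ ≤ M k
  trunc : ∀ N k, ‖nlCoeff p (trunc N c) k‖ₑ ≤ M k
  sub : ∀ N : ℕ, 1 ≤ N → ∀ k, ‖nlCoeff p c k - nlCoeff p (DerivFNLS.trunc N c) k‖ₑ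
    ≤ (N : ℝ≥0∞)⁻¹ * Z k
  deriv : ∀ N : ℕ, 1 ≤ N → ∀ k, ‖fourierCoeff (truncDeriv p N c (rhs F α θ c)) k‖ₑ
    ≤ ENNReal.ofReal ((N : ℝ) ^ (α - 2)) * Y k

lemma IsMajorant.mono {F p : MvPolynomial (Fin 4) ℂ} {α θ : ℝ} {c : ℤ → ℂ}
    {M Z Y M' Z' Y' : ℤ → ℝ≥0∞} (h : IsMajorant F p α θ c M Z Y) (hM : ∀ k, M k ≤ M' k)
    (hZ : ∀ k, Z k ≤ Z' k) (hY : ∀ k, Y k ≤ Y' k) : IsMajorant F p α θ c M' Z' Y' where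
  full k := (h.full k).trans (hM k)
  trunc N k := (h.trunc N k).trans (hM k)
  sub N hN k := (h.sub N hN k).trans (mul_le_mul' le_rfl (hZ k))
  deriv N hN k := (h.deriv N hN k).trans (mul_le_mul' le_rfl (hY k))

lemma absCoeff_sum_le {ι : Type*} (s : Finset ι) (f : ι → C(Torus, ℂ)) (k : ℤ) :
    absCoeff (∑ i ∈ s, f i) k ≤ ∑ i ∈ s, absCoeff (f i) k := by
  have h : fourierCoeff (∑ i ∈ s, f i : C(Torus, ℂ)) k = ∑ i ∈ s, fourierCoeff (f i) k :=
    map_sum (coeffL k) f s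
  rw [absCoeff, h]
  exact enorm_sum_le _ _

/-- The time derivative of the truncated variables loses only two powers of the frequency, at the
price of the factor `N^(α-2)`. -/
lemma maj_trunc_rhs_le {F : MvPolynomial (Fin 4) ℂ} {α θ : ℝ} (hα : 2 ≤ α) (hθ : |θ| = 1)
    {c : ℤ → ℂ} {N : ℕ} (hN : 1 ≤ N) (k : ℤ) :
    maj (trunc N (rhs F α θ c)) k
      ≤ ENNReal.ofReal ((N : ℝ) ^ (α - 2)) * (wt 2 k * maj c k + maj (nlCoeff F c) k) := by
  by_cases hk : k.natAbs ≤ N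
  · have hN' : (1 : ℝ) ≤ N := by exact_mod_cast hN
    have hkN : |(k : ℝ)| ≤ N := by
      rw [← Int.cast_abs, Int.abs_eq_natAbs]
      exact_mod_cast hk
    have h1 : ENNReal.ofReal (|(k : ℝ)| ^ α) ≤ ENNReal.ofReal ((N : ℝ) ^ (α - 2)) * wt 2 k := by
      rw [wt, ← ENNReal.ofReal_mul (by positivity)]
      refine ENNReal.ofReal_le_ofReal ?_
      calc |(k : ℝ)| ^ α = |(k : ℝ)| ^ ((α - 2) + 2) := by ring_nf
        _ = |(k : ℝ)| ^ (α - 2) * |(k : ℝ)| ^ (2 : ℝ) :=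
            Real.rpow_add_of_nonneg (abs_nonneg _) (by linarith) (by norm_num)
        _ ≤ _ := by
            gcongr
            exact abs_le_bracket k
    have h2 : (1 : ℝ≥0∞) ≤ ENNReal.ofReal ((N : ℝ) ^ (α - 2)) := by
      rw [ENNReal.one_le_ofReal]
      exact Real.one_le_rpow hN' (by linarith)
    have hrhs : ∀ m : ℤ, ‖rhs F α θ c m‖ₑ
        ≤ ENNReal.ofReal (|(m : ℝ)| ^ α) * ‖c m‖ₑ + ‖nlCoeff F c m‖ₑ := by
      intro m
      have hθ' : ‖(θ : ℂ)‖ₑ = 1 := by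
        rw [← ofReal_norm, Complex.norm_real, Real.norm_eq_abs, hθ, ENNReal.ofReal_one]
      rw [rhs, enorm_mul, hθ', one_mul]
      refine (enorm_add_le _ _).trans (add_le_add (le_of_eq ?_) le_rfl)
      rw [enorm_mul]
      congr 1
      rw [← ofReal_norm, norm_neg, norm_mul, Complex.norm_I, one_mul, Complex.norm_real,
        Real.norm_of_nonneg (by positivity)]
    have h3 : maj (trunc N (rhs F α θ c)) k
        ≤ ENNReal.ofReal (|(k : ℝ)| ^ α) * maj c k + maj (nlCoeff F c) k := by
      calc maj (trunc N (rhs F α θ c)) k ≤ wt 1 k *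
            ((ENNReal.ofReal (|(k : ℝ)| ^ α) * ‖c k‖ₑ + ‖nlCoeff F c k‖ₑ)
              + (ENNReal.ofReal (|(k : ℝ)| ^ α) * ‖c (-k)‖ₑ + ‖nlCoeff F c (-k)‖ₑ)) := by
            refine mul_le_mul' le_rfl (add_le_add ((enorm_trunc_le _ _ _).trans (hrhs k))
              ((enorm_trunc_le _ _ _).trans ?_))
            simpa using hrhs (-k)
        _ = _ := by rw [maj, maj]; ring
    refine h3.trans ?_
    rw [mul_add, ← mul_assoc]
    refine add_le_add (mul_le_mul' h1 le_rfl) (le_mul_of_one_le_left' h2)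
  · have : maj (trunc N (rhs F α θ c)) k = 0 := by
      simp [maj, trunc, hk]
    rw [this]
    exact zero_le

lemma wnorm_maj_le (c : ℤ → ℂ) {M : ℤ → ℝ≥0∞} (h : ∀ k, ‖c k‖ₑ ≤ M k) :
    wnorm (-1) (maj c) ≤ 2 * wnorm 0 M := by
  calc wnorm (-1) (maj c) ≤ wnorm (-1) fun k => wt 1 k * (M k + M (-k)) :=
        wnorm_mono le_rfl fun k => mul_le_mul' le_rfl (add_le_add (h k) (h (-k)))
    _ = wnorm 0 fun k => M k + M (-k) := by rw [wnorm_wt_mul]; norm_num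
    _ = 2 * wnorm 0 M := by rw [wnorm_add, wnorm_comp_neg 0 M, two_mul]

/-- Majorants with bounds that are uniform for `u` bounded in `H^(σ+1)` and in the Wiener algebra with
two derivatives. -/
lemma exists_isMajorant {α θ σ : ℝ} (hα : 2 ≤ α) (hθ : |θ| = 1) (hσ : 0 ≤ σ) {K : ℝ≥0∞}
    (hK : K ≠ ⊤) (F p : MvPolynomial (Fin 4) ℂ) :
    ∃ C : ℝ≥0∞, C ≠ ⊤ ∧ ∀ c : ℤ → ℂ, wnorm 1 (maj c) ≤ K → sqnorm σ (maj c) ≤ K →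
      ∃ M Z Y : ℤ → ℝ≥0∞, wnorm 1 M ≤ C ∧ sqnorm σ M ≤ C ∧ wnorm 0 Z ≤ C ∧ wnorm (-1) Y ≤ C ∧
        IsMajorant F p α θ c M Z Y := by
  obtain ⟨C₁, hC₁, h₁⟩ := exists_majorant hσ hK p
  obtain ⟨C₂, hC₂, h₂⟩ := exists_majorant_sub hσ hK p
  obtain ⟨C₃, hC₃, h₃⟩ := exists_majorant hσ hK F
  choose Cd hCd hd using fun i => exists_majorant hσ hK (MvPolynomial.pderiv i p)
  refine ⟨C₁ + C₂ + ∑ i, 2 * (K + 2 * C₃) * Cd i, ?_, fun c hc hc' => ?_⟩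
  · exact ENNReal.add_ne_top.2 ⟨by finiteness,
      ENNReal.sum_ne_top.2 fun i _ => by have := hCd i; finiteness⟩
  have hcK : wnorm 1 (maj c) ≠ ⊤ := ne_top_of_le_ne_top hK hc
  obtain ⟨M, hM1, hM2, hM⟩ := h₁ (maj c) hc hc'
  obtain ⟨Z, hZ1, hZ⟩ := h₂ (maj c) (fun k => wt 1 k * maj c k) hc hc'
    (by rw [wnorm_wt_mul]; simpa using hc)
  obtain ⟨MF, hMF1, -, hMF⟩ := h₃ (maj c) hc hc'
  choose Md hMd1 hMd2 hMd using fun i => hd i (maj c) hc hc'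
  set Y₀ : ℤ → ℝ≥0∞ := fun k => wt 2 k * maj c k + maj (nlCoeff F c) k with hY₀
  have hY₀n : wnorm (-1) Y₀ ≤ K + 2 * C₃ := by
    rw [hY₀, wnorm_add, wnorm_wt_mul]
    refine add_le_add (by norm_num; exact hc) ?_
    refine (wnorm_maj_le _ (hMF _ (absCoeff_vars_le hcK))).trans ?_
    gcongr
    exact (wnorm_mono zero_le_one fun _ => le_rfl).trans hMF1
  refine ⟨M, Z, fun k => ∑ i, conv Y₀ (Md i) k, ?_, ?_, ?_, ?_, ?_⟩
  · exact hM1.trans (le_add_right le_self_add)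
  · exact hM2.trans (le_add_right le_self_add)
  · exact hZ1.trans (le_add_right le_add_self)
  · refine le_trans ?_ le_add_self
    have : wnorm (-1) (fun k => ∑ i, conv Y₀ (Md i) k) = ∑ i, wnorm (-1) (conv Y₀ (Md i)) := by
      simp only [Fin.sum_univ_four, wnorm_add]
    rw [this]
    refine Finset.sum_le_sum fun i _ => (wnorm_conv_le wt_neg_one_add_le _ _).trans ?_
    have := hMd1 i
    gcongr
  · refine ⟨hM _ (absCoeff_vars_le hcK), fun N => hM _ (absCoeff_vars_trunc_le hcK N),
      fun N hN k => ?_, fun N hN k => ?_⟩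
    · have h := hZ (vars c) (vars (trunc N c)) _ (absCoeff_vars_le hcK)
        (absCoeff_vars_trunc_le hcK N) (absCoeff_vars_sub_trunc_le hcK hN) k
      rwa [absCoeff, ← coeffL_apply, map_sub] at h
    · refine (absCoeff_sum_le _ _ k).trans ?_
      rw [Finset.mul_sum]
      refine Finset.sum_le_sum fun i _ => ?_
      rw [conv_comm, ← conv_const_mul]
      refine (absCoeff_mul_le (ne_top_of_le_ne_top (hCd i) ?_) _ k).trans
        (conv_mono (hMd i _ (absCoeff_vars_trunc_le hcK N)) (fun m => ?_) k)
      · exact (ENNReal.tsum_le_tsum (hMd i _ (absCoeff_vars_trunc_le hcK N))).trans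
          ((tsum_le_wnorm_one _).trans (hMd1 i))
      · rw [absCoeff]
        refine le_trans ?_ (maj_trunc_rhs_le hα hθ hN m)
        have hfin : ∑' k, ‖varCoeff (trunc N (rhs F α θ c)) i k‖ₑ ≠ ⊤ := by
          rw [tsum_eq_sum (s := Finset.Icc (-(N : ℤ)) N)]
          · exact ENNReal.sum_ne_top.2 fun _ _ => enorm_ne_top
          · intro k hk
            rw [Finset.mem_Icc] at hk
            rw [varCoeff_trunc, if_neg (by omega), enorm_zero]
        rw [vars, fourierCoeff_ofCoeff (summable_norm_of_tsum_enorm_ne_top hfin)]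
        exact enorm_varCoeff_le _ i m

/-! ### The normal form correction -/

/-- The frequencies `j` of the coefficient which are low compared to the output frequency `k`. -/
noncomputable def lowFreq (k : ℤ) : Finset ℤ :=
  (Finset.Icc (-|k|) |k|).filter fun j => 2 * |j| ≤ |k|

lemma mem_lowFreq {k j : ℤ} : j ∈ lowFreq k ↔ 2 * |j| ≤ |k| := by
  rw [lowFreq, Finset.mem_filter, Finset.mem_Icc, ← abs_le]
  exact ⟨fun h => h.2, fun h => ⟨by linarith [abs_nonneg j], h⟩⟩

/-- The resonance function: `ε = -1` for the interaction of `F_ω` with `∂ₓ²u`, and `ε = 1` for the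
interaction of `F_ω̄` with `∂ₓ²ū`. -/
noncomputable def phase (α ε : ℝ) (k j : ℤ) : ℝ := |(k : ℝ)| ^ α + ε * |((k - j : ℤ) : ℝ)| ^ α

lemma mul_rpow_le_abs_sub {α x y : ℝ} (hα : 1 ≤ α) (hx : 0 < x) (hy : 0 < y) :
    |x - y| * x ^ (α - 1) ≤ |x ^ α - y ^ α| := by
  have hxα : x ^ α = x * x ^ (α - 1) := by
    rw [← Real.rpow_one_add' hx.le (by linarith)]; ring_nf
  have hyα : y ^ α = y * y ^ (α - 1) := by
    rw [← Real.rpow_one_add' hy.le (by linarith)]; ring_nf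
  rcases le_total x y with h | h
  · have h1 : x ^ (α - 1) ≤ y ^ (α - 1) := Real.rpow_le_rpow hx.le h (by linarith)
    rw [abs_sub_comm, abs_sub_comm (x ^ α), abs_of_nonneg (sub_nonneg.2 h)]
    refine le_trans ?_ (le_abs_self _)
    rw [hxα, hyα]
    nlinarith
  · have h1 : y ^ (α - 1) ≤ x ^ (α - 1) := Real.rpow_le_rpow hy.le h (by linarith)
    rw [abs_of_nonneg (sub_nonneg.2 h)]
    refine le_trans ?_ (le_abs_self _)
    rw [hxα, hyα]
    nlinarith

/-- A quantitative nonresonance condition. -/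
def Nonresonant (α ε : ℝ) (k j : ℤ) : Prop :=
  2 ^ (-α) * bracket k ^ (α - 1) * bracket j ≤ |phase α ε k j|

lemma bracket_rpow_le {α : ℝ} (hα : 1 ≤ α) {k : ℤ} (hk : k ≠ 0) :
    2 ^ (-α) * bracket k ^ (α - 1) * 2 ≤ |(k : ℝ)| ^ (α - 1) := by
  have h1 : bracket k ^ (α - 1) ≤ (2 * |(k : ℝ)|) ^ (α - 1) :=
    Real.rpow_le_rpow (bracket_pos k).le (bracket_le_two_mul hk) (by linarith)
  rw [Real.mul_rpow (by norm_num) (abs_nonneg _)] at h1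
  have h2 : (2 : ℝ) ^ (-α) * 2 ^ (α - 1) * 2 = 1 := by
    rw [← Real.rpow_add (by norm_num)]
    nth_rewrite 2 [← Real.rpow_one 2]
    rw [← Real.rpow_add (by norm_num), show -α + (α - 1) + 1 = (0 : ℝ) by ring, Real.rpow_zero]
  calc 2 ^ (-α) * bracket k ^ (α - 1) * 2
      ≤ 2 ^ (-α) * (2 ^ (α - 1) * |(k : ℝ)| ^ (α - 1)) * 2 := by gcongr
    _ = (2 ^ (-α) * 2 ^ (α - 1) * 2) * |(k : ℝ)| ^ (α - 1) := by ring
    _ = _ := by rw [h2, one_mul]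

lemma nonresonant_neg_one {α : ℝ} (hα : 1 ≤ α) {k j : ℤ} (hk : k ≠ 0) (hj : j ≠ 0)
    (hkj : 2 * |j| ≤ |k|) : Nonresonant α (-1) k j := by
  have hkj' : 2 * |(j : ℝ)| ≤ |(k : ℝ)| := by exact_mod_cast hkj
  have hk' : 0 < |(k : ℝ)| := by positivity
  have hl : 0 < |((k - j : ℤ) : ℝ)| := by
    push_cast
    linarith [abs_sub_abs_le_abs_sub (k : ℝ) j, abs_nonneg (j : ℝ)]
  have hdiff : |(j : ℝ)| ≤ |(|(k : ℝ)| - |((k - j : ℤ) : ℝ)|)| := by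
    push_cast
    rcases abs_cases (k : ℝ) with ⟨h1, _⟩ | ⟨h1, _⟩ <;>
    rcases abs_cases (j : ℝ) with ⟨h2, _⟩ | ⟨h2, _⟩ <;>
    rcases abs_cases ((k : ℝ) - j) with ⟨h3, _⟩ | ⟨h3, _⟩ <;>
    rw [h1, h2] at hkj' <;> rw [h1, h2, h3] <;>
    first
    | exact le_abs.2 (Or.inl (by linarith))
    | exact le_abs.2 (Or.inr (by linarith))
  have h := mul_rpow_le_abs_sub hα hk' hl
  rw [Nonresonant, phase, neg_one_mul, ← sub_eq_add_neg]
  refine le_trans ?_ h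
  calc 2 ^ (-α) * bracket k ^ (α - 1) * bracket j
      ≤ 2 ^ (-α) * bracket k ^ (α - 1) * (2 * |(j : ℝ)|) := by
        have := (bracket_pos k).le
        gcongr
        exact bracket_le_two_mul hj
    _ = |(j : ℝ)| * (2 ^ (-α) * bracket k ^ (α - 1) * 2) := by ring
    _ ≤ _ := mul_le_mul hdiff (bracket_rpow_le hα hk)
        (by have := (bracket_pos k).le; positivity) (abs_nonneg _)

lemma nonresonant_one {α : ℝ} (hα : 1 ≤ α) {k j : ℤ} (hk : k ≠ 0)
    (hkj : 2 * |j| ≤ |k|) : Nonresonant α 1 k j := by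
  have hkj' : 2 * |(j : ℝ)| ≤ |(k : ℝ)| := by exact_mod_cast hkj
  have hk1 : (1 : ℝ) ≤ |(k : ℝ)| := by exact_mod_cast Int.one_le_abs hk
  have hj : bracket j ≤ 2 * |(k : ℝ)| := by
    have : bracket j ≤ 1 + |(j : ℝ)| :=
      Real.sqrt_le_iff.2 ⟨by positivity, by nlinarith [sq_abs (j : ℝ), abs_nonneg (j : ℝ)]⟩
    linarith [abs_nonneg (j : ℝ)]
  have hpos : (0 : ℝ) ≤ |((k - j : ℤ) : ℝ)| ^ α := by positivity
  rw [Nonresonant, phase, one_mul, abs_of_nonneg (by positivity)]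
  have hkα : |(k : ℝ)| ^ α = |(k : ℝ)| ^ (α - 1) * |(k : ℝ)| := by
    rw [← Real.rpow_add_one' (abs_nonneg _) (by linarith)]; ring_nf
  calc 2 ^ (-α) * bracket k ^ (α - 1) * bracket j
      ≤ 2 ^ (-α) * bracket k ^ (α - 1) * (2 * |(k : ℝ)|) := by
        have := (bracket_pos k).le
        gcongr
    _ = (2 ^ (-α) * bracket k ^ (α - 1) * 2) * |(k : ℝ)| := by ring
    _ ≤ |(k : ℝ)| ^ (α - 1) * |(k : ℝ)| := by gcongr; exact bracket_rpow_le hα hk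
    _ ≤ _ := by rw [hkα]; linarith

/-- The multiplier `(k - j) / (θ Ω)` of the normal form correction, `Ω` the resonance function. -/
noncomputable def nfMult (α θ ε : ℝ) (k j : ℤ) : ℂ := ((k - j : ℤ) : ℂ) / (θ * phase α ε k j)

/-- The nonresonant interactions of `p(u, …)`, truncated in frequency, with the derivative of the
`i`-th variable. -/
noncomputable def interaction (p : MvPolynomial (Fin 4) ℂ) (i : Fin 4) (J : Finset ℤ)
    (k : ℤ) (c : ℤ → ℂ) : ℂ :=
  ∑ j ∈ J, nlCoeff p (trunc k.natAbs c) j * (Complex.I * ↑(k - j) * varCoeff c i (k - j))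

/-- The normal form correction which removes `interaction`. -/
noncomputable def correction (α θ ε : ℝ) (p : MvPolynomial (Fin 4) ℂ) (i : Fin 4) (J : Finset ℤ)
    (k : ℤ) (c : ℤ → ℂ) : ℂ :=
  ∑ j ∈ J, nfMult α θ ε k j * (nlCoeff p (trunc k.natAbs c) j * varCoeff c i (k - j))

/-- The terms which the normal form correction produces in exchange for `interaction`. They come, in
this order, from the part of the integrating factor due to the mean of `F_ω`, from the time derivative
of the coefficient, and from the nonlinear part of the time derivative of the variable. -/
noncomputable def correctionRest (F : MvPolynomial (Fin 4) ℂ) (α θ ε : ℝ)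
    (p : MvPolynomial (Fin 4) ℂ) (i : Fin 4) (J : Finset ℤ) (k : ℤ) (c : ℤ → ℂ) : ℂ :=
  ∑ j ∈ J, nfMult α θ ε k j *
    (-(θ * Complex.I * k * nlCoeff (MvPolynomial.pderiv 1 F) c 0) *
        (nlCoeff p (trunc k.natAbs c) j * varCoeff c i (k - j))
      + fourierCoeff (truncDeriv p k.natAbs c (rhs F α θ c)) j * varCoeff c i (k - j)
      + θ * (nlCoeff p (trunc k.natAbs c) j * varCoeff (nlCoeff F c) i (k - j)))

/-- Convolution restricted to frequencies of the first factor that are low compared to the output. -/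
noncomputable def lowConv (a b : ℤ → ℝ≥0∞) (k : ℤ) : ℝ≥0∞ :=
  ∑' j, if 2 * |j| ≤ |k| then a j * b (k - j) else 0

/-- Convolution restricted to frequencies of the first factor that are not low compared to the
output. -/
noncomputable def highConv (a b : ℤ → ℝ≥0∞) (k : ℤ) : ℝ≥0∞ :=
  ∑' j, if 2 * |j| ≤ |k| then 0 else a j * b (k - j)

lemma wt_mul_lowConv_le {r : ℝ} (hr : 0 ≤ r) (a b : ℤ → ℝ≥0∞) (k : ℤ) :
    wt r k * lowConv a b k ≤ ENNReal.ofReal (2 ^ r) * conv a (fun l => wt r l * b l) k := by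
  rw [lowConv, conv, ← ENNReal.tsum_mul_left, ← ENNReal.tsum_mul_left]
  refine ENNReal.tsum_le_tsum fun j => ?_
  split_ifs with h
  · have h' : 2 * |(j : ℝ)| ≤ |(k : ℝ)| := by exact_mod_cast h
    have h1 : wt r k ≤ ENNReal.ofReal (2 ^ r) * wt r (k - j) := by
      refine wt_le_of_abs_le hr one_le_two ?_
      push_cast
      linarith [abs_sub_abs_le_abs_sub (k : ℝ) j]
    calc wt r k * (a j * b (k - j))
        ≤ (ENNReal.ofReal (2 ^ r) * wt r (k - j)) * (a j * b (k - j)) := by gcongr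
      _ = _ := by ring
  · simp

lemma wt_mul_highConv_le {r : ℝ} (hr : 0 ≤ r) (a b : ℤ → ℝ≥0∞) (k : ℤ) :
    wt r k * highConv a b k ≤ ENNReal.ofReal (2 ^ r) * conv b (fun l => wt r l * a l) k := by
  rw [conv_comm, highConv, conv, ← ENNReal.tsum_mul_left, ← ENNReal.tsum_mul_left]
  refine ENNReal.tsum_le_tsum fun j => ?_
  split_ifs with h
  · simp
  · have h' : |(k : ℝ)| < 2 * |(j : ℝ)| := by exact_mod_cast not_le.1 h
    have h1 : wt r k ≤ ENNReal.ofReal (2 ^ r) * wt r j :=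
      wt_le_of_abs_le hr one_le_two h'.le
    calc wt r k * (a j * b (k - j))
        ≤ (ENNReal.ofReal (2 ^ r) * wt r j) * (a j * b (k - j)) := by gcongr
      _ = _ := by ring

lemma sum_le_lowConv {k : ℤ} {J : Finset ℤ} (hJ : J ⊆ lowFreq k) (a b : ℤ → ℝ≥0∞) :
    ∑ j ∈ J, a j * b (k - j) ≤ lowConv a b k := by
  refine le_trans (Finset.sum_le_sum fun j hj => ?_) (ENNReal.sum_le_tsum J)
  rw [if_pos (mem_lowFreq.1 (hJ hj))]

lemma enorm_nfMult_le {α θ ε : ℝ} (hθ : |θ| = 1) {k j : ℤ} (hkj : 2 * |j| ≤ |k|)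
    (h : Nonresonant α ε k j) :
    ‖nfMult α θ ε k j‖ₑ ≤ ENNReal.ofReal (2 ^ (α + 1)) * (wt (2 - α) k * wt (-1) j) := by
  have hk := bracket_pos k
  have hj := bracket_pos j
  have hkj' : 2 * |(j : ℝ)| ≤ |(k : ℝ)| := by exact_mod_cast hkj
  rw [wt, wt, ← ENNReal.ofReal_mul (by positivity), ← ENNReal.ofReal_mul (by positivity),
    ← ofReal_norm]
  refine ENNReal.ofReal_le_ofReal ?_
  rw [nfMult, norm_div, norm_mul, Complex.norm_real, Complex.norm_real, Real.norm_eq_abs, hθ,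
    one_mul, Real.norm_eq_abs, Complex.norm_intCast]
  have h1 : |((k - j : ℤ) : ℝ)| ≤ 2 * bracket k := by
    push_cast
    linarith [abs_sub (k : ℝ) j, abs_le_bracket k, abs_nonneg (j : ℝ)]
  have h2 : 0 < 2 ^ (-α) * bracket k ^ (α - 1) * bracket j := by positivity
  calc |((k - j : ℤ) : ℝ)| / |phase α ε k j|
      ≤ 2 * bracket k / (2 ^ (-α) * bracket k ^ (α - 1) * bracket j) :=
        div_le_div₀ (by positivity) h1 h2 h
    _ = 2 ^ (α + 1) * (bracket k ^ (2 - α) * bracket j ^ (-1 : ℝ)) := by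
        have e1 : bracket k ^ (2 - α) = bracket k / bracket k ^ (α - 1) := by
          nth_rewrite 2 [← Real.rpow_one (bracket k)]
          rw [← Real.rpow_sub hk]; ring_nf
        have e2 : (2 : ℝ) ^ (α + 1) = 2 / 2 ^ (-α) := by
          nth_rewrite 2 [← Real.rpow_one 2]
          rw [← Real.rpow_sub two_pos]; ring_nf
        rw [e1, e2, Real.rpow_neg_one]
        field_simp

section Static

variable {F p : MvPolynomial (Fin 4) ℂ} {α θ ε : ℝ} {c : ℤ → ℂ} {M Z Y : ℤ → ℝ≥0∞}

lemma enorm_correction_le (hθ : |θ| = 1) {κ : ℝ} (hκ : 3 - α ≤ κ)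
    (hp : IsMajorant F p α θ c M Z Y) (i : Fin 4) {k : ℤ} {J : Finset ℤ} (hJ : J ⊆ lowFreq k)
    (hres : ∀ j ∈ J, Nonresonant α ε k j) {a b : ℤ → ℝ≥0∞} (ha : ∀ j, M j ≤ a j)
    (hb : ∀ j, maj c j ≤ b j) :
    ‖correction α θ ε p i J k c‖ₑ
      ≤ ENNReal.ofReal (2 ^ (α + 1)) * (wt (κ - 1) k * lowConv a b k) := by
  rw [← mul_assoc]
  refine (enorm_sum_le _ _).trans ?_
  refine le_trans ?_ (mul_le_mul' le_rfl (sum_le_lowConv hJ a b))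
  rw [Finset.mul_sum]
  refine Finset.sum_le_sum fun j hj => ?_
  rw [enorm_mul, enorm_mul]
  have h1 := enorm_nfMult_le hθ (mem_lowFreq.1 (hJ hj)) (hres j hj)
  have h2 : wt (2 - α) k * wt (-1) j ≤ wt (κ - 1) k := by
    calc wt (2 - α) k * wt (-1) j ≤ wt (κ - 1) k * wt 0 j :=
          mul_le_mul' (wt_mono (by linarith) k) (wt_mono (by norm_num) j)
      _ = _ := by simp
  refine mul_le_mul' (h1.trans (mul_le_mul' le_rfl h2)) (mul_le_mul' ?_ ?_)
  · exact (hp.trunc _ j).trans (ha j)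
  · exact (enorm_varCoeff_le c i _).trans (hb _)

lemma natAbs_rpow_le {r : ℝ} (hr : 0 ≤ r) (k : ℤ) :
    ENNReal.ofReal ((k.natAbs : ℝ) ^ r) ≤ wt r k := by
  refine ENNReal.ofReal_le_ofReal (Real.rpow_le_rpow (by positivity) ?_ hr)
  rw [Nat.cast_natAbs, Int.cast_abs]
  exact abs_le_bracket k

lemma wt_one_sub_le {k j : ℤ} (hkj : 2 * |j| ≤ |k|) : wt 1 (k - j) ≤ 2 * wt 1 k := by
  have hkj' : 2 * |(j : ℝ)| ≤ |(k : ℝ)| := by exact_mod_cast hkj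
  have := wt_le_of_abs_le zero_le_one (j := k) (k := k - j) one_le_two (by
    push_cast
    linarith [abs_sub (k : ℝ) j, abs_nonneg (j : ℝ)])
  simpa using this

lemma enorm_correctionRest_le (hα : 2 ≤ α) (hθ : |θ| = 1) {κ : ℝ} (hκ : 3 - α ≤ κ) (hκ0 : 0 ≤ κ)
    (hp : IsMajorant F p α θ c M Z Y) (hF : ∀ j, ‖nlCoeff F c j‖ₑ ≤ M j)
    (hM : ∀ j, M (-j) = M j) {C : ℝ≥0∞}
    (hm : ‖nlCoeff (MvPolynomial.pderiv 1 F) c 0‖ₑ ≤ C)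
    (i : Fin 4) {k : ℤ} (hk : k ≠ 0) {J : Finset ℤ} (hJ : J ⊆ lowFreq k)
    (hres : ∀ j ∈ J, Nonresonant α ε k j) {a b : ℤ → ℝ≥0∞} (ha : ∀ j, M j ≤ a j)
    (ha' : ∀ j, wt (-1) j * Y j ≤ a j) (hb : ∀ j, maj c j ≤ b j) (hb' : ∀ j, M j ≤ b j) :
    ‖correctionRest F α θ ε p i J k c‖ₑ
      ≤ ENNReal.ofReal (2 ^ (α + 1)) * (C + 5) * (wt κ k * lowConv a b k) := by
  rw [← mul_assoc]
  refine (enorm_sum_le _ _).trans ?_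
  refine le_trans ?_ (mul_le_mul' le_rfl (sum_le_lowConv hJ a b))
  rw [Finset.mul_sum]
  refine Finset.sum_le_sum fun j hj => ?_
  have hkj := mem_lowFreq.1 (hJ hj)
  have h1 := enorm_nfMult_le hθ hkj (hres j hj)
  have hθ' : ‖(θ : ℂ)‖ₑ = 1 := by
    rw [← ofReal_norm, Complex.norm_real, Real.norm_eq_abs, hθ, ENNReal.ofReal_one]
  have hj1 : wt (-1) j ≤ 1 := by simpa using wt_mono (show (-1 : ℝ) ≤ 0 by norm_num) j
  have hP := hp.trunc k.natAbs j
  have hP' := (hp.deriv k.natAbs (by omega) j).trans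
    (mul_le_mul' (natAbs_rpow_le (by linarith) k) le_rfl)
  have hq := enorm_varCoeff_le c i (k - j)
  have hg : ‖varCoeff (nlCoeff F c) i (k - j)‖ₑ ≤ 4 * wt 1 k * M (k - j) := by
    refine (enorm_varCoeff_le _ i _).trans ?_
    calc maj (nlCoeff F c) (k - j) ≤ (2 * wt 1 k) * (M (k - j) + M (-(k - j))) :=
          mul_le_mul' (wt_one_sub_le hkj) (add_le_add (hF _) (hF _))
      _ = _ := by rw [hM]; ring
  have hsum : ‖-(θ * Complex.I * k * nlCoeff (MvPolynomial.pderiv 1 F) c 0) *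
        (nlCoeff p (trunc k.natAbs c) j * varCoeff c i (k - j))
      + fourierCoeff (truncDeriv p k.natAbs c (rhs F α θ c)) j * varCoeff c i (k - j)
      + θ * (nlCoeff p (trunc k.natAbs c) j * varCoeff (nlCoeff F c) i (k - j))‖ₑ
      ≤ wt 1 k * C * (M j * maj c (k - j)) + wt (α - 2) k * Y j * maj c (k - j)
        + M j * (4 * wt 1 k * M (k - j)) := by
    refine (enorm_add_le _ _).trans (add_le_add ((enorm_add_le _ _).trans
      (add_le_add ?_ ?_)) ?_)
    · rw [enorm_mul, enorm_mul, enorm_neg, mul_assoc (θ : ℂ), enorm_mul, enorm_mul, hθ', one_mul]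
      exact mul_le_mul' (mul_le_mul' (enorm_I_mul_le k) hm) (mul_le_mul' hP hq)
    · rw [enorm_mul]
      exact mul_le_mul' hP' hq
    · rw [enorm_mul, hθ', one_mul, enorm_mul]
      exact mul_le_mul' hP hg
  rw [enorm_mul]
  refine (mul_le_mul' h1 hsum).trans ?_
  have hw1 : wt (2 - α) k * wt 1 k ≤ wt κ k := by
    rw [← wt_add]; exact wt_mono (by linarith) k
  have hw2 : wt (2 - α) k * wt (α - 2) k ≤ wt κ k := by
    rw [← wt_add]; exact wt_mono (by linarith) k
  calc ENNReal.ofReal (2 ^ (α + 1)) * (wt (2 - α) k * wt (-1) j) *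
        (wt 1 k * C * (M j * maj c (k - j)) + wt (α - 2) k * Y j * maj c (k - j)
          + M j * (4 * wt 1 k * M (k - j)))
      = ENNReal.ofReal (2 ^ (α + 1)) *
        (C * ((wt (2 - α) k * wt 1 k) * ((wt (-1) j * M j) * maj c (k - j)))
          + (wt (2 - α) k * wt (α - 2) k) * ((wt (-1) j * Y j) * maj c (k - j))
          + 4 * ((wt (2 - α) k * wt 1 k) * ((wt (-1) j * M j) * M (k - j)))) := by ring
    _ ≤ ENNReal.ofReal (2 ^ (α + 1)) *
        (C * (wt κ k * ((1 * a j) * b (k - j))) + wt κ k * (a j * b (k - j))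
          + 4 * (wt κ k * ((1 * a j) * b (k - j)))) := by
        have := ha j
        have := ha' j
        have := hb (k - j)
        have := hb' (k - j)
        gcongr
    _ = _ := by ring

end Static

/-! ### Estimates for the corrected evolution at a fixed time -/

/-- The part of `∂ₓ(F(u, ∂ₓu, ū, ∂ₓū))` without second derivatives of `u`. -/
noncomputable def lowerOrder (F : MvPolynomial (Fin 4) ℂ) : MvPolynomial (Fin 4) ℂ :=
  MvPolynomial.pderiv 0 F * MvPolynomial.X 1 + MvPolynomial.pderiv 2 F * MvPolynomial.X 3

/-- The `k`-th coefficient of `∂ₓ(F(u, …))` after removal of the mean of `F_ω` and of the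
nonresonant interactions. -/
noncomputable def remainder (F : MvPolynomial (Fin 4) ℂ) (k : ℤ) (c : ℤ → ℂ) : ℂ :=
  Complex.I * k * nlCoeff F c k
    - Complex.I * k * nlCoeff (MvPolynomial.pderiv 1 F) c 0 * varCoeff c 1 k
    - interaction (MvPolynomial.pderiv 1 F) 1 ((lowFreq k).erase 0) k c
    - interaction (MvPolynomial.pderiv 3 F) 3 (lowFreq k) k c

/-- The total normal form correction of the `k`-th Fourier coefficient of `∂ₓu`. -/
noncomputable def totalCorrection (F : MvPolynomial (Fin 4) ℂ) (α θ : ℝ) (k : ℤ) (c : ℤ → ℂ) : ℂ :=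
  correction α θ (-1) (MvPolynomial.pderiv 1 F) 1 ((lowFreq k).erase 0) k c
    + correction α θ 1 (MvPolynomial.pderiv 3 F) 3 (lowFreq k) k c

/-- The forcing term in the evolution of the corrected `k`-th Fourier coefficient of `∂ₓu`. -/
noncomputable def forcing (F : MvPolynomial (Fin 4) ℂ) (α θ : ℝ) (k : ℤ) (c : ℤ → ℂ) : ℂ :=
  θ * (remainder F k c
    - correctionRest F α θ (-1) (MvPolynomial.pderiv 1 F) 1 ((lowFreq k).erase 0) k c
    - correctionRest F α θ 1 (MvPolynomial.pderiv 3 F) 3 (lowFreq k) k c)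

lemma hasSum_finset_ite (J : Finset ℤ) (f : ℤ → ℂ) :
    HasSum (fun j => if j ∈ J then f j else 0) (∑ j ∈ J, f j) := by
  have h : HasSum (fun j => if j ∈ J then f j else 0) (∑ j ∈ J, if j ∈ J then f j else 0) :=
    hasSum_sum_of_ne_finset_zero fun j hj => if_neg hj
  rwa [Finset.sum_congr rfl fun j hj => if_pos hj] at h

/-- In the remainder, a low-frequency coefficient occurs only through its truncation error, whose
factor `|k|⁻¹` compensates the second derivative; otherwise a derivative falls on a factor whose
frequency may be small, while the coefficient has frequency at least `|k| / 2`. At `j = 0` the mean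
of `F_ω` is removed exactly, without truncation. -/
lemma enorm_remainder_le {F : MvPolynomial (Fin 4) ℂ} {α θ : ℝ} {c : ℤ → ℂ}
    {M Z Y : ℤ → ℝ≥0∞} (hc : wnorm 1 (maj c) ≠ ⊤)
    (hG : IsMajorant F (MvPolynomial.pderiv 1 F) α θ c M Z Y)
    (hH : IsMajorant F (MvPolynomial.pderiv 3 F) α θ c M Z Y)
    (hr : ∀ k, ‖nlCoeff (lowerOrder F) c k‖ₑ ≤ M k) {k : ℤ} (hk : k ≠ 0) :
    ‖remainder F k c‖ₑ ≤ M k + 8 * lowConv Z (maj c) k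
      + 2 * highConv M (fun l => wt 1 l * maj c l) k := by
  set G := MvPolynomial.pderiv 1 F
  set H := MvPolynomial.pderiv 3 F
  set N := k.natAbs
  have hN : 1 ≤ N := by omega
  have h0 : (0 : ℤ) ∉ (lowFreq k).erase 0 := by simp
  have h1 := hasSum_deriv_nonlinearity hc F k
  have hG0 := hasSum_finset_ite {0}
    fun j => nlCoeff G c j * (Complex.I * ↑(k - j) * varCoeff c 1 (k - j))
  have hGJ := hasSum_finset_ite ((lowFreq k).erase 0)
    fun j => nlCoeff G (trunc N c) j * (Complex.I * ↑(k - j) * varCoeff c 1 (k - j))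
  have hHJ := hasSum_finset_ite (lowFreq k)
    fun j => nlCoeff H (trunc N c) j * (Complex.I * ↑(k - j) * varCoeff c 3 (k - j))
  have hall := ((h1.sub hG0).sub hGJ).sub hHJ
  have hrem : remainder F k c = nlCoeff (lowerOrder F) c k +
      ((Complex.I * k * fourierCoeff (MvPolynomial.aeval (vars c) F) k
        - fourierCoeff (MvPolynomial.aeval (vars c) (MvPolynomial.pderiv 0 F * MvPolynomial.X 1
          + MvPolynomial.pderiv 2 F * MvPolynomial.X 3)) k)
        - (∑ j ∈ ({0} : Finset ℤ), nlCoeff G c j * (Complex.I * ↑(k - j) * varCoeff c 1 (k - j)))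
        - (∑ j ∈ (lowFreq k).erase 0,
            nlCoeff G (trunc N c) j * (Complex.I * ↑(k - j) * varCoeff c 1 (k - j)))
        - ∑ j ∈ lowFreq k,
            nlCoeff H (trunc N c) j * (Complex.I * ↑(k - j) * varCoeff c 3 (k - j))) := by
    simp only [remainder, interaction, Finset.sum_singleton, sub_zero, nlCoeff, lowerOrder]
    ring
  rw [hrem, ← hall.tsum_eq, add_assoc]
  refine (enorm_add_le _ _).trans (add_le_add (hr k) (enorm_tsum_le_tsum_enorm.trans ?_))
  rw [lowConv, highConv, ← ENNReal.tsum_mul_left, ← ENNReal.tsum_mul_left, ← ENNReal.tsum_add]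
  refine ENNReal.tsum_le_tsum fun j => ?_
  have hx : ∀ i, ‖Complex.I * ↑(k - j) * varCoeff c i (k - j)‖ₑ
      ≤ wt 1 (k - j) * maj c (k - j) := fun i => enorm_deriv_varCoeff_le c i (k - j)
  by_cases hj : 2 * |j| ≤ |k|
  · have hmem : j ∈ lowFreq k := mem_lowFreq.2 hj
    rw [if_pos hj, if_pos hj, mul_zero, add_zero, if_pos hmem]
    have hinv : (N : ℝ≥0∞)⁻¹ * wt 1 (k - j) ≤ 4 := by
      have hw : wt 1 k ≤ 2 * (N : ℝ≥0∞) := by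
        rw [wt_one, ← ENNReal.ofReal_natCast, ← ENNReal.ofReal_ofNat 2,
          ← ENNReal.ofReal_mul two_pos.le]
        refine ENNReal.ofReal_le_ofReal ((bracket_le_two_mul hk).trans_eq ?_)
        rw [Nat.cast_natAbs, Int.cast_abs]
      calc (N : ℝ≥0∞)⁻¹ * wt 1 (k - j) ≤ (N : ℝ≥0∞)⁻¹ * (2 * (2 * N)) := by
            gcongr
            exact (wt_one_sub_le hj).trans (by gcongr)
        _ = 4 * ((N : ℝ≥0∞)⁻¹ * N) := by ring
        _ = 4 := by
            rw [ENNReal.inv_mul_cancel (by positivity) (by simp), mul_one]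
    have hd : ∀ q, IsMajorant F q α θ c M Z Y → ∀ i,
        ‖(nlCoeff q c j - nlCoeff q (trunc N c) j)
          * (Complex.I * ↑(k - j) * varCoeff c i (k - j))‖ₑ ≤ 4 * (Z j * maj c (k - j)) := by
      intro q hq i
      rw [enorm_mul]
      calc _ ≤ ((N : ℝ≥0∞)⁻¹ * Z j) * (wt 1 (k - j) * maj c (k - j)) :=
            mul_le_mul' (hq.sub N hN j) (hx i)
        _ = ((N : ℝ≥0∞)⁻¹ * wt 1 (k - j)) * (Z j * maj c (k - j)) := by ring
        _ ≤ _ := by gcongr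
    have hsplit : (8 : ℝ≥0∞) * (Z j * maj c (k - j))
        = 4 * (Z j * maj c (k - j)) + 4 * (Z j * maj c (k - j)) := by ring
    rw [hsplit]
    by_cases hj0 : j = 0
    · subst hj0
      rw [if_pos (Finset.mem_singleton_self _), if_neg h0]
      refine le_trans (le_of_eq ?_) ((hd H hH 3).trans le_add_self)
      congr 1
      simp only [nlCoeff, G, H]
      ring
    · rw [if_neg (by simpa using hj0), if_pos (Finset.mem_erase.2 ⟨hj0, hmem⟩)]
      refine le_trans (le_of_eq ?_)
        ((enorm_add_le _ _).trans (add_le_add (hd G hG 1) (hd H hH 3)))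
      congr 1
      simp only [nlCoeff, G, H]
      ring
  · have hmem : j ∉ lowFreq k := fun h => hj (mem_lowFreq.1 h)
    have hj0 : j ≠ 0 := by
      rintro rfl
      exact hj (by simp)
    rw [if_neg hj, if_neg hj, mul_zero, zero_add, if_neg hmem, if_neg (by simpa using hj0),
      if_neg (fun h => hmem (Finset.mem_of_mem_erase h)), sub_zero, sub_zero, sub_zero,
      two_mul (M j * _)]
    refine (enorm_add_le _ _).trans (add_le_add ?_ ?_) <;> rw [enorm_mul]
    · exact mul_le_mul' (hG.full j) (hx 1)
    · exact mul_le_mul' (hH.full j) (hx 3)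

lemma sqnorm_add_add_le (r : ℝ) (a b d : ℤ → ℝ≥0∞) :
    sqnorm r (fun k => a k + b k + d k) ≤ 4 * sqnorm r a + 4 * sqnorm r b + 2 * sqnorm r d := by
  refine (sqnorm_add_le r (fun k => a k + b k) d).trans ?_
  calc 2 * sqnorm r (fun k => a k + b k) + 2 * sqnorm r d
      ≤ 2 * (2 * sqnorm r a + 2 * sqnorm r b) + 2 * sqnorm r d := by
        gcongr
        exact sqnorm_add_le r a b
    _ = _ := by ring

/-- The polynomials occurring in the linearized equation have common majorants. -/
lemma exists_common_majorant {α θ σ : ℝ} (hα : 2 ≤ α) (hθ : |θ| = 1) (hσ : 0 ≤ σ) {K : ℝ≥0∞}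
    (hK : K ≠ ⊤) (F : MvPolynomial (Fin 4) ℂ) (P : Fin 4 → MvPolynomial (Fin 4) ℂ) :
    ∃ C : ℝ≥0∞, C ≠ ⊤ ∧ ∀ c : ℤ → ℂ, wnorm 1 (maj c) ≤ K → sqnorm σ (maj c) ≤ K →
      ∃ M Z Y : ℤ → ℝ≥0∞, wnorm 1 M ≤ C ∧ sqnorm σ M ≤ C ∧ wnorm 0 Z ≤ C ∧ wnorm (-1) Y ≤ C ∧
        (∀ k, M (-k) = M k) ∧ ∀ i, IsMajorant F (P i) α θ c M Z Y := by
  choose C hC h using fun i => exists_isMajorant hα hθ hσ hK F (P i)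
  refine ⟨16 * (C 0 + C 1 + (C 2 + C 3)), ?_, fun c hc hc' => ?_⟩
  · have h0 := hC 0
    have h1 := hC 1
    have h2 := hC 2
    have h3 := hC 3
    finiteness
  choose M Z Y hM hM' hZ hY hmaj using fun i => h i c hc hc'
  set S : ℤ → ℝ≥0∞ := fun k => M 0 k + M 1 k + (M 2 k + M 3 k) with hS
  have hle : ∀ (a : Fin 4 → ℤ → ℝ≥0∞) (i : Fin 4) (k : ℤ),
      a i k ≤ a 0 k + a 1 k + (a 2 k + a 3 k) := by
    intro a i k
    have := Finset.single_le_sum (f := fun i => a i k) (fun _ _ => zero_le) (Finset.mem_univ i)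
    rwa [Fin.sum_univ_four, add_assoc] at this
  have hS1 : wnorm 1 S ≤ C 0 + C 1 + (C 2 + C 3) := by
    rw [hS]
    simp only [wnorm_add]
    exact add_le_add (add_le_add (hM 0) (hM 1)) (add_le_add (hM 2) (hM 3))
  have hS2 : sqnorm σ S ≤ 4 * (C 0 + C 1 + (C 2 + C 3)) := by
    refine (sqnorm_add_le σ (fun k => M 0 k + M 1 k) (fun k => M 2 k + M 3 k)).trans ?_
    calc 2 * sqnorm σ (fun k => M 0 k + M 1 k) + 2 * sqnorm σ (fun k => M 2 k + M 3 k)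
        ≤ 2 * (2 * C 0 + 2 * C 1) + 2 * (2 * C 2 + 2 * C 3) := by
          gcongr
          · exact (sqnorm_add_le σ _ _).trans
              (add_le_add (mul_le_mul' le_rfl (hM' 0)) (mul_le_mul' le_rfl (hM' 1)))
          · exact (sqnorm_add_le σ _ _).trans
              (add_le_add (mul_le_mul' le_rfl (hM' 2)) (mul_le_mul' le_rfl (hM' 3)))
      _ = _ := by ring
  have h16 : C 0 + C 1 + (C 2 + C 3) ≤ 16 * (C 0 + C 1 + (C 2 + C 3)) :=
    le_mul_of_one_le_left' (by norm_num)
  refine ⟨fun k => S k + S (-k), fun k => Z 0 k + Z 1 k + (Z 2 k + Z 3 k),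
    fun k => Y 0 k + Y 1 k + (Y 2 k + Y 3 k), ?_, ?_, ?_, ?_, fun k => ?_, fun i => ?_⟩
  · rw [wnorm_add, wnorm_comp_neg 1 S, ← two_mul]
    exact mul_le_mul' (by norm_num) hS1
  · refine (sqnorm_add_le _ _ _).trans ?_
    rw [sqnorm_comp_neg σ S, ← two_mul]
    calc 2 * (2 * sqnorm σ S) ≤ 2 * (2 * (4 * (C 0 + C 1 + (C 2 + C 3)))) := by gcongr
      _ = _ := by ring
  · simp only [wnorm_add]
    exact (add_le_add (add_le_add (hZ 0) (hZ 1)) (add_le_add (hZ 2) (hZ 3))).trans h16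
  · simp only [wnorm_add]
    exact (add_le_add (add_le_add (hY 0) (hY 1)) (add_le_add (hY 2) (hY 3))).trans h16
  · simp only [neg_neg]
    exact add_comm _ _
  · exact (hmaj i).mono (fun k => (hle M i k).trans le_self_add) (hle Z i) (hle Y i)

/-- At each time, the forcing of the corrected evolution lies in `H^(σ-κ)`, and the normal form
correction in `H^(σ+1-κ)`, for any `κ ≥ max (3 - α) 0`, uniformly for bounded data. -/
lemma exists_forcing_bound {α θ σ κ : ℝ} (hα : 2 ≤ α) (hθ : |θ| = 1) (hσ : 0 ≤ σ)
    (hκ : 3 - α ≤ κ) (hκ0 : 0 ≤ κ) {K : ℝ≥0∞} (hK : K ≠ ⊤) (F : MvPolynomial (Fin 4) ℂ) :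
    ∃ C : ℝ≥0∞, C ≠ ⊤ ∧ ∀ c : ℤ → ℂ, wnorm 1 (maj c) ≤ K → sqnorm σ (maj c) ≤ K →
      ∃ V : ℤ → ℝ≥0∞, sqnorm σ V ≤ C ∧ ∀ k ≠ 0, ‖totalCorrection F α θ k c‖ₑ ≤ wt (κ - 1) k * V k ∧
        ‖forcing F α θ k c‖ₑ ≤ wt κ k * V k := by
  obtain ⟨C, hC, h⟩ := exists_common_majorant hα hθ hσ hK F
    ![MvPolynomial.pderiv 1 F, MvPolynomial.pderiv 3 F, F, lowerOrder F]
  set B : ℝ≥0∞ := 2 * (ENNReal.ofReal (2 ^ (α + 1)) * (C + 5)) + 8 with hB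
  set D : ℝ≥0∞ := ENNReal.ofReal (2 ^ σ) with hD
  have hBtop : B ≠ ⊤ := by rw [hB]; finiteness
  have hDtop : D ≠ ⊤ := by rw [hD]; finiteness
  refine ⟨B ^ 2 * (4 * C + 4 * (D ^ 2 * ((3 * C) ^ 2 * (2 * K + 2 * C)))
    + 2 * (D ^ 2 * (K ^ 2 * C))), by finiteness, fun c hc hc' => ?_⟩
  obtain ⟨M, Z, Y, hM1, hM2, hZ, hY, hsymm, hmaj⟩ := h c hc hc'
  have hG : IsMajorant F (MvPolynomial.pderiv 1 F) α θ c M Z Y := hmaj 0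
  have hH : IsMajorant F (MvPolynomial.pderiv 3 F) α θ c M Z Y := hmaj 1
  have hF : IsMajorant F F α θ c M Z Y := hmaj 2
  have hr : IsMajorant F (lowerOrder F) α θ c M Z Y := hmaj 3
  set a : ℤ → ℝ≥0∞ := fun j => M j + wt (-1) j * Y j + Z j with ha
  set b : ℤ → ℝ≥0∞ := fun j => maj c j + M j with hb
  have ha1 : ∀ j, M j ≤ a j := fun j => le_add_right le_self_add
  have ha2 : ∀ j, wt (-1) j * Y j ≤ a j := fun j => le_add_right le_add_self
  have ha3 : ∀ j, Z j ≤ a j := fun j => le_add_self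
  have hb1 : ∀ j, maj c j ≤ b j := fun j => le_self_add
  have hb2 : ∀ j, M j ≤ b j := fun j => le_add_self
  set W : ℤ → ℝ≥0∞ := fun k => M k + lowConv a b k + highConv M (fun l => wt 1 l * maj c l) k
    with hW
  have hasum : ∑' j, a j ≤ 3 * C := by
    rw [← wnorm_zero, ha]
    simp only [wnorm_add, wnorm_wt_mul]
    calc wnorm 0 M + wnorm (0 + -1) Y + wnorm 0 Z ≤ C + C + C := by
          refine add_le_add (add_le_add ?_ ?_) hZ
          · exact (wnorm_mono zero_le_one fun _ => le_rfl).trans hM1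
          · rwa [zero_add]
      _ = 3 * C := by ring
  have hbsq : sqnorm σ b ≤ 2 * K + 2 * C := by
    refine (sqnorm_add_le _ _ _).trans ?_
    gcongr
  have hWsq : sqnorm σ W ≤ 4 * C + 4 * (D ^ 2 * ((3 * C) ^ 2 * (2 * K + 2 * C)))
      + 2 * (D ^ 2 * (K ^ 2 * C)) := by
    refine (sqnorm_add_add_le _ _ _ _).trans (add_le_add (add_le_add ?_ ?_) ?_)
    · gcongr
    · gcongr
      refine (sqnorm_le_of_le_conv (wt_mul_lowConv_le hσ a b)).trans ?_
      gcongr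
    · gcongr
      refine (sqnorm_le_of_le_conv (wt_mul_highConv_le hσ M _)).trans ?_
      gcongr
      exact hc
  have hm : ‖nlCoeff (MvPolynomial.pderiv 1 F) c 0‖ₑ ≤ C := by
    refine (hG.full 0).trans (le_trans ?_ hM1)
    calc M 0 = wt 1 0 * M 0 := by rw [wt_one_zero, one_mul]
      _ ≤ _ := ENNReal.le_tsum (0 : ℤ)
  have hcK : wnorm 1 (maj c) ≠ ⊤ := ne_top_of_le_ne_top hK hc
  refine ⟨fun k => B * W k, ?_, fun k hk => ⟨?_, ?_⟩⟩
  · rw [sqnorm_const_mul]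
    gcongr
  · have hJ1 : (lowFreq k).erase 0 ⊆ lowFreq k := Finset.erase_subset _ _
    have hres1 : ∀ j ∈ (lowFreq k).erase 0, Nonresonant α (-1) k j := fun j hj =>
      nonresonant_neg_one (by linarith) hk (Finset.ne_of_mem_erase hj) (mem_lowFreq.1 (hJ1 hj))
    have hres2 : ∀ j ∈ lowFreq k, Nonresonant α 1 k j := fun j hj =>
      nonresonant_one (by linarith) hk (mem_lowFreq.1 hj)
    refine (enorm_add_le _ _).trans ((add_le_add
      (enorm_correction_le hθ hκ hG 1 hJ1 hres1 ha1 hb1)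
      (enorm_correction_le hθ hκ hH 3 subset_rfl hres2 ha1 hb1)).trans ?_)
    have h1 : (1 : ℝ≥0∞) ≤ C + 5 := le_add_left (by norm_num)
    calc ENNReal.ofReal (2 ^ (α + 1)) * (wt (κ - 1) k * lowConv a b k)
          + ENNReal.ofReal (2 ^ (α + 1)) * (wt (κ - 1) k * lowConv a b k)
        = wt (κ - 1) k * (2 * (ENNReal.ofReal (2 ^ (α + 1)) * 1) * lowConv a b k) := by ring
      _ ≤ wt (κ - 1) k * (B * W k) := by
          gcongr
          · rw [hB]
            refine le_add_right ?_
            gcongr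
          · exact le_add_right le_add_self
  · have hJ1 : (lowFreq k).erase 0 ⊆ lowFreq k := Finset.erase_subset _ _
    have hres1 : ∀ j ∈ (lowFreq k).erase 0, Nonresonant α (-1) k j := fun j hj =>
      nonresonant_neg_one (by linarith) hk (Finset.ne_of_mem_erase hj) (mem_lowFreq.1 (hJ1 hj))
    have hres2 : ∀ j ∈ lowFreq k, Nonresonant α 1 k j := fun j hj =>
      nonresonant_one (by linarith) hk (mem_lowFreq.1 hj)
    have hθ' : ‖(θ : ℂ)‖ₑ = 1 := by
      rw [← ofReal_norm, Complex.norm_real, Real.norm_eq_abs, hθ, ENNReal.ofReal_one]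
    rw [forcing, enorm_mul, hθ', one_mul]
    refine (enorm_sub_le).trans ((add_le_add ((enorm_sub_le).trans (add_le_add
      (enorm_remainder_le hcK hG hH hr.full hk)
      (enorm_correctionRest_le hα hθ hκ hκ0 hG hF.full hsymm hm 1 hk hJ1 hres1 ha1 ha2 hb1 hb2)))
      (enorm_correctionRest_le hα hθ hκ hκ0 hH hF.full hsymm hm 3 hk subset_rfl hres2
        ha1 ha2 hb1 hb2)).trans ?_)
    have hlow : lowConv Z (maj c) k ≤ lowConv a b k := by
      refine ENNReal.tsum_le_tsum fun j => ?_
      split_ifs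
      · exact mul_le_mul' (ha3 j) (hb1 _)
      · exact le_rfl
    have hw : 1 ≤ wt κ k := one_le_wt hκ0 k
    set R := ENNReal.ofReal (2 ^ (α + 1)) * (C + 5)
    set Hc := highConv M (fun l => wt 1 l * maj c l) k
    calc M k + 8 * lowConv Z (maj c) k + 2 * Hc + R * (wt κ k * lowConv a b k)
          + R * (wt κ k * lowConv a b k)
        ≤ 8 * M k + 8 * lowConv a b k + 8 * Hc + R * (wt κ k * lowConv a b k)
          + R * (wt κ k * lowConv a b k) := by
          gcongr
          · exact le_mul_of_one_le_left' (by norm_num)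
          · norm_num
      _ ≤ 8 * (wt κ k * M k) + 8 * (wt κ k * lowConv a b k) + 8 * (wt κ k * Hc)
          + R * (wt κ k * lowConv a b k) + R * (wt κ k * lowConv a b k)
          + 2 * R * (wt κ k * M k) + 2 * R * (wt κ k * Hc) := by
          refine le_add_right (le_add_right ?_)
          gcongr <;> exact le_mul_of_one_le_left' hw
      _ = wt κ k * (B * W k) := by rw [hB, hW]; ring

/-! ### The evolution of the corrected Fourier coefficients -/

/-- The family `c` consists of the Fourier coefficients of functions which are bounded in
`H^(σ+1)` and in the Wiener algebra with two derivatives, which depend continuously on time, and which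
solve the equation (`θ = 1`) or its time reversal (`θ = -1`) on `(0, T)`. -/
structure IsCoeffSolution (F : MvPolynomial (Fin 4) ℂ) (α θ σ T : ℝ) (K : ℝ≥0∞)
    (c : ℝ → ℤ → ℂ) : Prop where
  wnorm_le : ∀ t, wnorm 1 (maj (c t)) ≤ K
  sqnorm_le : ∀ t, sqnorm σ (maj (c t)) ≤ K
  continuous_vars : ∀ i, Continuous fun t => vars (c t) i
  hasDerivAt : ∀ t ∈ Set.Ioo 0 T, ∀ k, HasDerivAt (fun τ => c τ k) (rhs F α θ (c t) k) t

section Continuity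

variable {F : MvPolynomial (Fin 4) ℂ} {α θ σ T : ℝ} {K : ℝ≥0∞} {c : ℝ → ℤ → ℂ}

lemma continuous_fourierCoeff {f : ℝ → C(Torus, ℂ)} (hf : Continuous f) (k : ℤ) :
    Continuous fun t => fourierCoeff (f t) k :=
  (coeffL k).continuous.comp hf

lemma IsCoeffSolution.continuous_coeff (h : IsCoeffSolution F α θ σ T K c) (hK : K ≠ ⊤) (k : ℤ) :
    Continuous fun t => c t k := by
  have h1 := continuous_fourierCoeff (h.continuous_vars 0) k
  have h2 : ∀ t, fourierCoeff (vars (c t) 0) k = c t k := fun t =>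
    fourierCoeff_vars (ne_top_of_le_ne_top hK (h.wnorm_le t)) 0 k
  simpa only [h2] using h1

lemma IsCoeffSolution.continuous_nlCoeff (h : IsCoeffSolution F α θ σ T K c)
    (p : MvPolynomial (Fin 4) ℂ) (k : ℤ) : Continuous fun t => nlCoeff p (c t) k :=
  continuous_fourierCoeff (continuous_aeval h.continuous_vars p) k

lemma continuous_nlCoeff_trunc (hc : ∀ k, Continuous fun t => c t k)
    (p : MvPolynomial (Fin 4) ℂ) (N : ℕ) (k : ℤ) :
    Continuous fun t => nlCoeff p (trunc N (c t)) k :=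
  continuous_fourierCoeff (continuous_aeval (continuous_vars_trunc hc N) p) k

lemma IsCoeffSolution.continuous_rhs (h : IsCoeffSolution F α θ σ T K c) (hK : K ≠ ⊤) (k : ℤ) :
    Continuous fun t => rhs F α θ (c t) k := by
  have h1 := h.continuous_coeff hK k
  have h2 := h.continuous_nlCoeff F k
  unfold rhs
  fun_prop

lemma IsCoeffSolution.continuous_truncDeriv (h : IsCoeffSolution F α θ σ T K c) (hK : K ≠ ⊤)
    (p : MvPolynomial (Fin 4) ℂ) (N : ℕ) (k : ℤ) :
    Continuous fun t => fourierCoeff (truncDeriv p N (c t) (rhs F α θ (c t))) k := by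
  refine continuous_fourierCoeff (continuous_finsetSum _ fun i _ => ?_) k
  exact (continuous_aeval (continuous_vars_trunc (h.continuous_coeff hK) N) _).mul
    (continuous_vars_trunc (h.continuous_rhs hK) N i)

lemma IsCoeffSolution.continuous_correction (h : IsCoeffSolution F α θ σ T K c) (hK : K ≠ ⊤)
    (ε : ℝ) (p : MvPolynomial (Fin 4) ℂ) (i : Fin 4) (J : Finset ℤ) (k : ℤ) :
    Continuous fun t => correction α θ ε p i J k (c t) :=
  continuous_finsetSum _ fun j _ => continuous_const.mul
    ((continuous_nlCoeff_trunc (h.continuous_coeff hK) p _ j).mul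
      (continuous_varCoeff (h.continuous_coeff hK) i _))

lemma IsCoeffSolution.continuous_totalCorrection (h : IsCoeffSolution F α θ σ T K c) (hK : K ≠ ⊤)
    (k : ℤ) : Continuous fun t => totalCorrection F α θ k (c t) :=
  (h.continuous_correction hK _ _ _ _ _).add (h.continuous_correction hK _ _ _ _ _)

lemma IsCoeffSolution.continuous_correctionRest (h : IsCoeffSolution F α θ σ T K c) (hK : K ≠ ⊤)
    (ε : ℝ) (p : MvPolynomial (Fin 4) ℂ) (i : Fin 4) (J : Finset ℤ) (k : ℤ) :
    Continuous fun t => correctionRest F α θ ε p i J k (c t) := by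
  refine continuous_finsetSum _ fun j _ => continuous_const.mul ?_
  have h1 := continuous_nlCoeff_trunc (h.continuous_coeff hK) p k.natAbs j
  have h2 := continuous_varCoeff (h.continuous_coeff hK) i (k - j)
  have h3 := h.continuous_truncDeriv hK p k.natAbs j
  have h4 := continuous_varCoeff (c := fun t => nlCoeff F (c t)) (h.continuous_nlCoeff F) i (k - j)
  have h5 := h.continuous_nlCoeff (MvPolynomial.pderiv 1 F) 0
  exact (((continuous_const.mul h5).neg.mul (h1.mul h2)).add (h3.mul h2)).add
    (continuous_const.mul (h1.mul h4))

lemma IsCoeffSolution.continuous_interaction (h : IsCoeffSolution F α θ σ T K c) (hK : K ≠ ⊤)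
    (p : MvPolynomial (Fin 4) ℂ) (i : Fin 4) (J : Finset ℤ) (k : ℤ) :
    Continuous fun t => interaction p i J k (c t) :=
  continuous_finsetSum _ fun j _ => (continuous_nlCoeff_trunc (h.continuous_coeff hK) p _ j).mul
    (continuous_const.mul (continuous_varCoeff (h.continuous_coeff hK) i _))

lemma IsCoeffSolution.continuous_forcing (h : IsCoeffSolution F α θ σ T K c) (hK : K ≠ ⊤)
    (k : ℤ) : Continuous fun t => forcing F α θ k (c t) := by
  refine continuous_const.mul (((((Continuous.sub ?_ ?_).sub ?_).sub ?_).sub ?_).sub ?_)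
  · exact continuous_const.mul (h.continuous_nlCoeff F k)
  · exact (continuous_const.mul (h.continuous_nlCoeff _ 0)).mul
      (continuous_varCoeff (h.continuous_coeff hK) 1 k)
  · exact h.continuous_interaction hK _ _ _ _
  · exact h.continuous_interaction hK _ _ _ _
  · exact h.continuous_correctionRest hK _ _ _ _ _
  · exact h.continuous_correctionRest hK _ _ _ _ _

end Continuity

/-- The integrating factor `exp (θ (i |k|^α t - i k ∫₀ᵗ m))`, which takes care of the dispersion
and of the mean `m` of the coefficient `F_ω`. -/
noncomputable def intFactor (α θ : ℝ) (m : ℝ → ℂ) (k : ℤ) (t : ℝ) : ℂ :=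
  Complex.exp (θ * (Complex.I * ((|(k : ℝ)| ^ α : ℝ) : ℂ) * t
    - Complex.I * k * ∫ r in (0 : ℝ)..t, m r))

lemma hasDerivAt_intFactor (α θ : ℝ) {m : ℝ → ℂ} (hm : Continuous m) (k : ℤ) (t : ℝ) :
    HasDerivAt (intFactor α θ m k) (intFactor α θ m k t *
      (θ * (Complex.I * ((|(k : ℝ)| ^ α : ℝ) : ℂ) - Complex.I * k * m t))) t := by
  have h1 : HasDerivAt (fun t : ℝ => ∫ r in (0 : ℝ)..t, m r) (m t) t :=
    intervalIntegral.integral_hasDerivAt_right (hm.intervalIntegrable _ _)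
      (hm.stronglyMeasurableAtFilter _ _) hm.continuousAt
  have h2 : HasDerivAt (fun t : ℝ => (t : ℂ)) 1 t := Complex.ofRealCLM.hasDerivAt
  have h3 := ((h2.const_mul (Complex.I * ((|(k : ℝ)| ^ α : ℝ) : ℂ))).sub
    (h1.const_mul (Complex.I * k))).const_mul (θ : ℂ)
  rw [mul_one] at h3
  exact h3.cexp

lemma norm_intFactor_le (α θ : ℝ) {m : ℝ → ℂ} (hm : Continuous m) (k : ℤ) {t q : ℝ} (ht : 0 ≤ t)
    (h : ∀ r ∈ Set.Icc 0 t, θ * k * (m r).im ≤ q) :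
    ‖intFactor α θ m k t‖ ≤ Real.exp (q * t) := by
  rw [intFactor, Complex.norm_exp, Real.exp_le_exp]
  have him : (∫ r in (0 : ℝ)..t, m r).im = ∫ r in (0 : ℝ)..t, (m r).im :=
    (Complex.imCLM.intervalIntegral_comp_comm (hm.intervalIntegrable 0 t)).symm
  have hre : (θ * (Complex.I * ((|(k : ℝ)| ^ α : ℝ) : ℂ) * t
      - Complex.I * k * ∫ r in (0 : ℝ)..t, m r)).re = θ * k * ∫ r in (0 : ℝ)..t, (m r).im := by
    rw [← him]
    simp only [Complex.mul_re, Complex.mul_im, Complex.sub_re, Complex.sub_im, Complex.I_re,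
      Complex.I_im, Complex.ofReal_re, Complex.ofReal_im, Complex.intCast_re, Complex.intCast_im]
    ring
  rw [hre, ← intervalIntegral.integral_const_mul]
  have hmim : Continuous fun r => θ * k * (m r).im :=
    continuous_const.mul (Complex.continuous_im.comp hm)
  calc ∫ r in (0 : ℝ)..t, θ * k * (m r).im ≤ ∫ _ in (0 : ℝ)..t, q :=
        intervalIntegral.integral_mono_on ht (hmim.intervalIntegrable _ _)
          intervalIntegrable_const h
    _ = q * t := by simp [mul_comm]

section Derivative

variable {F : MvPolynomial (Fin 4) ℂ} {α θ : ℝ} {c : ℝ → ℤ → ℂ} {t : ℝ}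

lemma hasDerivAt_nlCoeff_trunc
    (h : ∀ k, HasDerivAt (fun τ => c τ k) (rhs F α θ (c t) k) t)
    (p : MvPolynomial (Fin 4) ℂ) (N : ℕ) (j : ℤ) :
    HasDerivAt (fun τ => nlCoeff p (trunc N (c τ)) j)
      (fourierCoeff (truncDeriv p N (c t) (rhs F α θ (c t))) j) t :=
  ((coeffL j).restrictScalars ℝ).hasFDerivAt.comp_hasDerivAt t
    (hasDerivAt_aeval (hasDerivAt_vars_trunc h N) p)

/-- The normal form identity: in the weighted evolution, the correction replaces the interaction by
smoother terms. -/
lemma hasDerivAt_intFactor_mul_correction (hθ : |θ| = 1)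
    (h : ∀ k, HasDerivAt (fun τ => c τ k) (rhs F α θ (c t) k) t) {e : ℝ → ℂ} {k : ℤ}
    (he : HasDerivAt e (e t * (θ * (Complex.I * ((|(k : ℝ)| ^ α : ℝ) : ℂ)
      - Complex.I * k * nlCoeff (MvPolynomial.pderiv 1 F) (c t) 0))) t)
    {ε : ℝ} {i : Fin 4} (hi : ∀ l : ℤ, varCoeff (rhs F α θ (c t)) i l
      = θ * (Complex.I * ε * ((|(l : ℝ)| ^ α : ℝ) : ℂ) * varCoeff (c t) i l
        + varCoeff (nlCoeff F (c t)) i l))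
    (p : MvPolynomial (Fin 4) ℂ) {J : Finset ℤ} (hres : ∀ j ∈ J, Nonresonant α ε k j) :
    HasDerivAt (fun τ => e τ * correction α θ ε p i J k (c τ))
      (e t * (interaction p i J k (c t) + correctionRest F α θ ε p i J k (c t))) t := by
  have hterm : ∀ j ∈ J, HasDerivAt
      (fun τ => nfMult α θ ε k j * (nlCoeff p (trunc k.natAbs (c τ)) j * varCoeff (c τ) i (k - j)))
      (nfMult α θ ε k j * (fourierCoeff (truncDeriv p k.natAbs (c t) (rhs F α θ (c t))) j
          * varCoeff (c t) i (k - j)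
        + nlCoeff p (trunc k.natAbs (c t)) j * varCoeff (rhs F α θ (c t)) i (k - j))) t :=
    fun j _ => ((hasDerivAt_nlCoeff_trunc h p _ j).mul (hasDerivAt_varCoeff h i _)).const_mul _
  have hsum := he.mul (HasDerivAt.fun_sum hterm)
  refine hsum.congr_deriv ?_
  rw [interaction, correctionRest, ← Finset.sum_add_distrib, Finset.mul_sum, Finset.mul_sum,
    Finset.mul_sum, ← Finset.sum_add_distrib]
  refine Finset.sum_congr rfl fun j hj => ?_
  have hθ0 : (θ : ℂ) ≠ 0 := by
    intro h0
    rw [Complex.ofReal_eq_zero] at h0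
    rw [h0, abs_zero] at hθ
    exact zero_ne_one hθ
  have hΩ : (phase α ε k j : ℂ) ≠ 0 := by
    rw [Complex.ofReal_ne_zero, ← abs_pos]
    have h1 := bracket_pos k
    have h2 := bracket_pos j
    exact lt_of_lt_of_le (by positivity) (hres j hj)
  have hmult : nfMult α θ ε k j * (θ * phase α ε k j) = ((k - j : ℤ) : ℂ) :=
    div_mul_cancel₀ _ (mul_ne_zero hθ0 hΩ)
  have hphase : (phase α ε k j : ℂ) = ((|(k : ℝ)| ^ α : ℝ) : ℂ)
      + ε * ((|((k - j : ℤ) : ℝ)| ^ α : ℝ) : ℂ) := by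
    rw [phase]; push_cast; ring
  rw [hi, ← hmult, hphase]
  ring

lemma varCoeff_rhs_one (F : MvPolynomial (Fin 4) ℂ) (α θ : ℝ) (c : ℤ → ℂ) (l : ℤ) :
    varCoeff (rhs F α θ c) 1 l
      = θ * (Complex.I * ((-1 : ℝ) : ℂ) * ((|(l : ℝ)| ^ α : ℝ) : ℂ) * varCoeff c 1 l
        + varCoeff (nlCoeff F c) 1 l) := by
  change Complex.I * l * rhs F α θ c l = θ * (Complex.I * ((-1 : ℝ) : ℂ)
    * ((|(l : ℝ)| ^ α : ℝ) : ℂ) * (Complex.I * l * c l) + Complex.I * l * nlCoeff F c l)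
  rw [rhs]
  push_cast
  ring

lemma varCoeff_rhs_three (F : MvPolynomial (Fin 4) ℂ) (α θ : ℝ) (c : ℤ → ℂ) (l : ℤ) :
    varCoeff (rhs F α θ c) 3 l
      = θ * (Complex.I * ((1 : ℝ) : ℂ) * ((|(l : ℝ)| ^ α : ℝ) : ℂ) * varCoeff c 3 l
        + varCoeff (nlCoeff F c) 3 l) := by
  change Complex.I * l * conj (rhs F α θ c (-l)) = θ * (Complex.I * ((1 : ℝ) : ℂ)
    * ((|(l : ℝ)| ^ α : ℝ) : ℂ) * (Complex.I * l * conj (c (-l)))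
      + Complex.I * l * conj (nlCoeff F c (-l)))
  rw [rhs]
  simp only [map_mul, map_add, map_neg, Complex.conj_I, Complex.conj_ofReal, Int.cast_neg, abs_neg]
  push_cast
  ring

/-- The evolution of the `k`-th Fourier coefficient of `∂ₓu` after the normal form correction, in the
presence of the integrating factor `e`. -/
lemma hasDerivAt_corrected (hα : 2 ≤ α) (hθ : |θ| = 1)
    (h : ∀ k, HasDerivAt (fun τ => c τ k) (rhs F α θ (c t) k) t) {e : ℝ → ℂ} {k : ℤ} (hk : k ≠ 0)
    (he : HasDerivAt e (e t * (θ * (Complex.I * ((|(k : ℝ)| ^ α : ℝ) : ℂ)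
      - Complex.I * k * nlCoeff (MvPolynomial.pderiv 1 F) (c t) 0))) t) :
    HasDerivAt (fun τ => e τ * (varCoeff (c τ) 1 k - θ * totalCorrection F α θ k (c τ)))
      (e t * forcing F α θ k (c t)) t := by
  have hJ1 : (lowFreq k).erase 0 ⊆ lowFreq k := Finset.erase_subset _ _
  have hres1 : ∀ j ∈ (lowFreq k).erase 0, Nonresonant α (-1) k j := fun j hj =>
    nonresonant_neg_one (by linarith) hk (Finset.ne_of_mem_erase hj) (mem_lowFreq.1 (hJ1 hj))
  have hres2 : ∀ j ∈ lowFreq k, Nonresonant α 1 k j := fun j hj =>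
    nonresonant_one (by linarith) hk (mem_lowFreq.1 hj)
  have h1 := hasDerivAt_intFactor_mul_correction hθ h he (varCoeff_rhs_one F α θ (c t))
    (MvPolynomial.pderiv 1 F) hres1
  have h2 := hasDerivAt_intFactor_mul_correction hθ h he (varCoeff_rhs_three F α θ (c t))
    (MvPolynomial.pderiv 3 F) hres2
  have h3 := he.mul (hasDerivAt_varCoeff h 1 k)
  have h4 := h3.sub ((h1.add h2).const_mul (θ : ℂ))
  have hfun : (fun τ => e τ * (varCoeff (c τ) 1 k - θ * totalCorrection F α θ k (c τ)))
      = (e * fun τ => varCoeff (c τ) 1 k) - fun τ => (θ : ℂ) *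
        (((fun τ => e τ * correction α θ (-1) (MvPolynomial.pderiv 1 F) 1
            ((lowFreq k).erase 0) k (c τ))
          + fun τ => e τ * correction α θ 1 (MvPolynomial.pderiv 3 F) 3 (lowFreq k) k (c τ)) τ) := by
    funext τ
    simp only [totalCorrection, Pi.sub_apply, Pi.mul_apply, Pi.add_apply]
    ring
  rw [hfun]
  refine h4.congr_deriv ?_
  rw [varCoeff_rhs_one, forcing, remainder]
  have hv : varCoeff (nlCoeff F (c t)) 1 k = Complex.I * k * nlCoeff F (c t) k := rfl
  rw [hv]
  push_cast
  ring

end Derivative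

/-! ### Parabolic smoothing in Duhamel's formula -/

lemma exp_neg_le_rpow_neg {γ x : ℝ} (hγ : 0 ≤ γ) (hγ1 : γ ≤ 1) (hx : 0 < x) :
    Real.exp (-x) ≤ x ^ (-γ) := by
  rw [Real.exp_neg, Real.rpow_neg hx.le]
  refine inv_anti₀ (by positivity) ?_
  have h1 : x + 1 ≤ Real.exp x := Real.add_one_le_exp x
  rcases le_total x 1 with h | h
  · linarith [Real.rpow_le_one hx.le h hγ]
  · calc x ^ γ ≤ x ^ (1 : ℝ) := Real.rpow_le_rpow_of_exponent_le h hγ1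
      _ ≤ _ := by rw [Real.rpow_one]; linarith

lemma exp_decay_le {γ q t : ℝ} (hγ : 0 ≤ γ) (hγ1 : γ ≤ 1) (hq : 0 < q) (ht : 0 < t) {k : ℤ}
    (hk : k ≠ 0) : ENNReal.ofReal (Real.exp (-(q * |(k : ℝ)|) * t))
      ≤ ENNReal.ofReal ((q / 2) ^ (-γ)) * wt (-γ) k * ENNReal.ofReal (t ^ (-γ)) := by
  have hk' := bracket_pos k
  rw [wt, ← ENNReal.ofReal_mul (by positivity), ← ENNReal.ofReal_mul (by positivity)]
  refine ENNReal.ofReal_le_ofReal ?_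
  rw [← Real.mul_rpow (by positivity) hk'.le, ← Real.mul_rpow (by positivity) ht.le]
  have h1 : 0 < q / 2 * bracket k * t := by positivity
  refine le_trans ?_ (exp_neg_le_rpow_neg hγ hγ1 h1)
  rw [Real.exp_le_exp]
  have h2 : q / 2 * bracket k ≤ q * |(k : ℝ)| := by
    nlinarith [bracket_le_two_mul hk]
  nlinarith

lemma lintegral_rpow_neg_lt_top {γ : ℝ} (hγ1 : γ < 1) (τ : ℝ) :
    ∫⁻ t in Set.Ioc 0 τ, ENNReal.ofReal (t ^ (-γ)) < ⊤ := by
  rcases le_total τ 0 with h | h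
  · simp [Set.Ioc_eq_empty_of_le h]
  have h1 : IntervalIntegrable (fun t : ℝ => t ^ (-γ)) volume 0 τ :=
    intervalIntegral.intervalIntegrable_rpow' (by linarith)
  rw [intervalIntegrable_iff_integrableOn_Ioc_of_le h] at h1
  refine lt_of_le_of_lt (lintegral_mono fun t => ?_) h1.2
  rw [← ofReal_norm]
  exact ENNReal.ofReal_le_ofReal (Real.le_norm_self _)

/-- The time integral in Duhamel's formula, with a kernel bounded by `t^(-γ)`, is bounded in a
weighted `ℓ²` space by the supremum in time. -/
lemma sqnorm_lintegral_le {γ r τ : ℝ} {C : ℝ≥0∞} {g : ℤ → ℝ → ℝ≥0∞} (hg : ∀ k, Measurable (g k))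
    (h : ∀ t ∈ Set.Ioc 0 τ, sqnorm r (fun k => g k t) ≤ C) :
    sqnorm r (fun k => ∫⁻ t in Set.Ioc 0 τ, ENNReal.ofReal (t ^ (-γ)) * g k t)
      ≤ (∫⁻ t in Set.Ioc 0 τ, ENNReal.ofReal (t ^ (-γ))) ^ 2 * C := by
  have hφ : Measurable fun t : ℝ => ENNReal.ofReal (t ^ (-γ)) := by fun_prop
  set φ : ℝ → ℝ≥0∞ := fun t => ENNReal.ofReal (t ^ (-γ))
  set I : ℝ≥0∞ := ∫⁻ t in Set.Ioc 0 τ, φ t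
  calc sqnorm r (fun k => ∫⁻ t in Set.Ioc 0 τ, φ t * g k t)
      ≤ ∑' k, I * ∫⁻ t in Set.Ioc 0 τ, φ t * (wt r k * g k t) ^ 2 := by
        refine ENNReal.tsum_le_tsum fun k => ?_
        rw [mul_pow]
        refine (mul_le_mul' le_rfl
          (sq_lintegral_mul_le hφ.aemeasurable (hg k).aemeasurable)).trans_eq ?_
        rw [← mul_assoc, mul_comm _ I, mul_assoc, ← lintegral_const_mul' _ _
          (ENNReal.pow_ne_top (wt_ne_top r k))]
        congr 1
        refine lintegral_congr fun t => ?_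
        ring
    _ = I * ∫⁻ t in Set.Ioc 0 τ, φ t * sqnorm r (fun k => g k t) := by
        have hmeas : ∀ k, Measurable fun t => φ t * (wt r k * g k t) ^ 2 := fun k =>
          hφ.mul (((hg k).const_mul _).pow_const 2)
        rw [ENNReal.tsum_mul_left, ← lintegral_tsum fun k => (hmeas k).aemeasurable]
        congr 1
        refine lintegral_congr fun t => ?_
        rw [sqnorm, ENNReal.tsum_mul_left]
    _ ≤ I * ∫⁻ t in Set.Ioc 0 τ, φ t * C := by
        refine mul_le_mul' le_rfl (setLIntegral_mono' measurableSet_Ioc fun t ht => ?_)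
        exact mul_le_mul' le_rfl (h t ht)
    _ = I ^ 2 * C := by
        rw [lintegral_mul_const _ hφ]
        ring

section Duhamel

variable {F : MvPolynomial (Fin 4) ℂ} {α θ σ T : ℝ} {K : ℝ≥0∞} {c : ℝ → ℤ → ℂ}

/-- Duhamel's formula for the corrected coefficients, solved for the value at time `0`. -/
lemma IsCoeffSolution.enorm_corrected_zero_le (h : IsCoeffSolution F α θ σ T K c) (hK : K ≠ ⊤)
    (hα : 2 ≤ α) (hθ : |θ| = 1) {q τ : ℝ} (hτ : 0 < τ) (hτT : τ ≤ T) {k : ℤ} (hk : k ≠ 0)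
    (hm : ∀ t ∈ Set.Icc 0 τ,
      θ * k * (nlCoeff (MvPolynomial.pderiv 1 F) (c t) 0).im ≤ -(q * |(k : ℝ)|)) :
    ‖varCoeff (c 0) 1 k - θ * totalCorrection F α θ k (c 0)‖ₑ
      ≤ ENNReal.ofReal (Real.exp (-(q * |(k : ℝ)|) * τ))
          * ‖varCoeff (c τ) 1 k - θ * totalCorrection F α θ k (c τ)‖ₑ
        + ∫⁻ t in Set.Ioc 0 τ, ENNReal.ofReal (Real.exp (-(q * |(k : ℝ)|) * t))
          * ‖forcing F α θ k (c t)‖ₑ := by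
  set m : ℝ → ℂ := fun t => nlCoeff (MvPolynomial.pderiv 1 F) (c t) 0
  have hmc : Continuous m := h.continuous_nlCoeff _ 0
  set e : ℝ → ℂ := intFactor α θ m k
  have hec : Continuous e := continuous_iff_continuousAt.2 fun t =>
    (hasDerivAt_intFactor α θ hmc k t).continuousAt
  have hen : ∀ t ∈ Set.Icc 0 τ, ‖e t‖ₑ ≤ ENNReal.ofReal (Real.exp (-(q * |(k : ℝ)|) * t)) := by
    intro t ht
    rw [← ofReal_norm]
    exact ENNReal.ofReal_le_ofReal (norm_intFactor_le α θ hmc k ht.1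
      fun r hr => hm r ⟨hr.1, hr.2.trans ht.2⟩)
  set y : ℝ → ℂ := fun t => varCoeff (c t) 1 k - θ * totalCorrection F α θ k (c t)
  have hyc : Continuous y := (continuous_varCoeff (h.continuous_coeff hK) 1 k).sub
    (continuous_const.mul (h.continuous_totalCorrection hK k))
  have hfc : Continuous fun t => e t * forcing F α θ k (c t) :=
    hec.mul (h.continuous_forcing hK k)
  have hftc := intervalIntegral.integral_eq_sub_of_hasDerivAt_of_le hτ.le
    (hec.mul hyc).continuousOn (fun t ht => hasDerivAt_corrected hα hθ
      (h.hasDerivAt t ⟨ht.1, ht.2.trans_le hτT⟩) hk (hasDerivAt_intFactor α θ hmc k t))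
    (hfc.intervalIntegrable 0 τ)
  have he0 : e 0 = 1 := by simp [e, intFactor]
  have hy0 : y 0 = e τ * y τ - ∫ t in (0 : ℝ)..τ, e t * forcing F α θ k (c t) := by
    rw [hftc]
    simp only [Pi.mul_apply, he0]
    ring
  change ‖y 0‖ₑ ≤ _
  rw [hy0, intervalIntegral.integral_of_le hτ.le]
  refine enorm_sub_le.trans (add_le_add ?_ ?_)
  · rw [enorm_mul]
    exact mul_le_mul' (hen τ ⟨hτ.le, le_rfl⟩) le_rfl
  · refine (enorm_integral_le_lintegral_enorm _).trans
      (setLIntegral_mono' measurableSet_Ioc fun t ht => ?_)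
    rw [enorm_mul]
    exact mul_le_mul' (hen t ⟨ht.1.le, ht.2⟩) le_rfl

/-- Smoothing of the initial value at the frequencies `k` of one sign: those at which the mean of
`F_ω` makes the corrected coefficients grow exponentially in time, so that solving back from a later
time to `0` damps them. -/
theorem IsCoeffSolution.sqnorm_lt_top (h : IsCoeffSolution F α θ σ T K c) (hK : K ≠ ⊤)
    (hα : 2 < α) (hθ : |θ| = 1) (hσ : 0 ≤ σ) (hT : 0 < T) {δ : ℝ} (hδ : 0 < δ)
    (hδα : δ < min (α - 2) 1) :
    sqnorm (σ + 1 + δ) (fun k => if θ * k * (nlCoeff (MvPolynomial.pderiv 1 F) (c 0) 0).im < 0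
      then ‖c 0 k‖ₑ else 0) < ⊤ := by
  set m : ℝ → ℂ := fun t => nlCoeff (MvPolynomial.pderiv 1 F) (c t) 0 with hmdef
  set μ : ℝ := (m 0).im with hμ
  have hmc : Continuous m := h.continuous_nlCoeff _ 0
  by_cases hμ0 : μ = 0
  · have : (fun k : ℤ => if θ * k * μ < 0 then ‖c 0 k‖ₑ else 0) = fun _ => 0 := by
      funext k
      rw [hμ0, mul_zero, if_neg (lt_irrefl 0)]
    rw [this]
    simp [sqnorm]
  have hμpos : 0 < |μ| := abs_pos.2 hμ0
  -- On a short interval `[0, τ]` the mean `Im F_ω` keeps its sign and half of its size.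
  obtain ⟨r, hr, hmr⟩ := Metric.continuousAt_iff.1
    ((Complex.continuous_im.comp hmc).continuousAt (x := (0 : ℝ))) (|μ| / 2) (by positivity)
  set τ : ℝ := min T (r / 2) with hτdef
  have hτ : 0 < τ := lt_min hT (by positivity)
  have hτT : τ ≤ T := min_le_left _ _
  set q : ℝ := |μ| / 2 with hq
  have hqpos : 0 < q := by positivity
  have hm : ∀ k : ℤ, θ * k * μ < 0 → ∀ t ∈ Set.Icc 0 τ, θ * k * (m t).im ≤ -(q * |(k : ℝ)|) := by
    intro k hk t ht
    have h1 : |(m t).im - μ| ≤ q := by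
      refine (hmr (x := t) ?_).le
      rw [Real.dist_eq, sub_zero, abs_of_nonneg ht.1]
      linarith [ht.2, min_le_right T (r / 2)]
    have h2 : θ * k * μ = -(|(k : ℝ)| * |μ|) := by
      have := abs_of_neg hk
      rw [abs_mul, abs_mul, hθ, one_mul] at this
      linarith
    have h3 : θ * k * ((m t).im - μ) ≤ |(k : ℝ)| * q := by
      refine (le_abs_self _).trans ?_
      rw [abs_mul, abs_mul, hθ, one_mul]
      gcongr
    have h4 : θ * k * (m t).im = θ * k * μ + θ * k * ((m t).im - μ) := by ring
    rw [h4, h2]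
    have : |μ| = 2 * q := by rw [hq]; ring
    rw [this]
    linarith
  -- The forcing loses `κ` derivatives, and damping at the rate `q |k|` gains `γ < 1` of them, the
  -- singularity `t^(-γ)` being integrable; hence `δ = γ - κ` is possible up to `min (α - 2) 1`.
  set κ : ℝ := max (3 - α) 0 with hκ
  have hκα : 3 - α ≤ κ := le_max_left _ _
  have hκ0 : 0 ≤ κ := le_max_right _ _
  have hκ1 : κ ≤ 1 := max_le (by linarith) zero_le_one
  set γ : ℝ := δ + κ with hγ
  have hγ0 : 0 ≤ γ := by positivity
  have hγ1 : γ < 1 := by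
    have h1 := hδα.trans_le (min_le_left _ _)
    have h2 := hδα.trans_le (min_le_right _ _)
    rcases max_cases (3 - α) 0 with h3 | h3 <;> rw [hγ, hκ, h3.1] <;> linarith
  obtain ⟨C, hC, hV⟩ := exists_forcing_bound hα.le hθ hσ hκα hκ0 hK F
  choose V hVsq hVb using fun t => hV (c t) (h.wnorm_le t) (h.sqnorm_le t)
  -- At frequency zero there is no normal form, so the forcing is switched off there.
  set g : ℤ → ℝ → ℝ≥0∞ := fun k t => if k = 0 then 0 else ‖forcing F α θ k (c t)‖ₑ with hgdef
  have hgm : ∀ k, Measurable (g k) := by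
    intro k
    by_cases hk : k = 0
    · simp only [hgdef, hk, if_true]
      exact measurable_const
    · simp only [hgdef, hk, if_false]
      exact (h.continuous_forcing hK k).enorm.measurable
  have hgsq : ∀ t ∈ Set.Ioc 0 τ, sqnorm (σ - κ) (fun k => g k t) ≤ C := by
    intro t _
    refine le_trans ?_ (hVsq t)
    calc sqnorm (σ - κ) (fun k => g k t) ≤ sqnorm (σ - κ) (fun k => wt κ k * V t k) := by
          refine sqnorm_mono le_rfl fun k => ?_
          by_cases hk : k = 0
          · simp [hgdef, hk]
          · simp only [hgdef, hk, if_false]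
            exact (hVb t k hk).2
      _ = sqnorm σ (V t) := by rw [sqnorm_wt_mul, sub_add_cancel]
  set I : ℤ → ℝ≥0∞ := fun k => ∫⁻ t in Set.Ioc 0 τ, ENNReal.ofReal (t ^ (-γ)) * g k t with hI
  have hIsq : sqnorm (σ - κ) I < ⊤ := by
    refine (sqnorm_lintegral_le hgm hgsq).trans_lt ?_
    have := (lintegral_rpow_neg_lt_top hγ1 τ).ne
    exact lt_top_iff_ne_top.2 (by finiteness)
  set Q : ℝ≥0∞ := ENNReal.ofReal ((q / 2) ^ (-γ)) with hQ
  set R : ℝ≥0∞ := ENNReal.ofReal (τ ^ (-γ)) with hR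
  have hQtop : Q ≠ ⊤ := ENNReal.ofReal_ne_top
  have hRtop : R ≠ ⊤ := ENNReal.ofReal_ne_top
  have hθ' : ‖(θ : ℂ)‖ₑ = 1 := by
    rw [← ofReal_norm, Complex.norm_real, Real.norm_eq_abs, hθ, ENNReal.ofReal_one]
  set a₁ : ℤ → ℝ≥0∞ := fun k =>
    (2 * (Q * R)) * (wt (-γ) k * (maj (c τ) k + V τ k)) with ha₁
  set a₂ : ℤ → ℝ≥0∞ := fun k => (2 * Q) * (wt (-γ) k * I k) with ha₂
  set a₃ : ℤ → ℝ≥0∞ := fun k => 2 * (wt (κ - 1) k * V 0 k) with ha₃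
  have hpoint : ∀ k : ℤ, (if θ * k * μ < 0 then ‖c 0 k‖ₑ else 0)
      ≤ wt (-1) k * (a₁ k + a₂ k + a₃ k) := by
    intro k
    split_ifs with hkμ
    swap
    · exact zero_le
    have hk : k ≠ 0 := by
      rintro rfl
      simp at hkμ
    have hD := h.enorm_corrected_zero_le hK hα.le hθ hτ hτT hk (hm k hkμ)
    have h1 : ‖varCoeff (c τ) 1 k - θ * totalCorrection F α θ k (c τ)‖ₑ
        ≤ maj (c τ) k + V τ k := by
      refine enorm_sub_le.trans (add_le_add (enorm_varCoeff_le _ _ _) ?_)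
      rw [enorm_mul, hθ', one_mul]
      refine (hVb τ k hk).1.trans ?_
      calc wt (κ - 1) k * V τ k ≤ wt 0 k * V τ k :=
            mul_le_mul' (wt_mono (by linarith) k) le_rfl
        _ = V τ k := by rw [wt_zero, one_mul]
    have h2 : ∫⁻ t in Set.Ioc 0 τ, ENNReal.ofReal (Real.exp (-(q * |(k : ℝ)|) * t))
          * ‖forcing F α θ k (c t)‖ₑ ≤ (Q * wt (-γ) k) * I k := by
      rw [hI]
      rw [← lintegral_const_mul _ (by have := hgm k; fun_prop)]
      refine setLIntegral_mono' measurableSet_Ioc fun t ht => ?_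
      rw [← mul_assoc]
      refine mul_le_mul' (exp_decay_le hγ0 hγ1.le hqpos ht.1 hk) ?_
      simp only [hgdef, hk, if_false, le_refl]
    have h3 : ‖varCoeff (c 0) 1 k‖ₑ
        ≤ (Q * wt (-γ) k * R) * (maj (c τ) k + V τ k) + (Q * wt (-γ) k) * I k
          + wt (κ - 1) k * V 0 k := by
      have hsplit : varCoeff (c 0) 1 k = (varCoeff (c 0) 1 k - θ * totalCorrection F α θ k (c 0))
          + θ * totalCorrection F α θ k (c 0) := by ring
      rw [hsplit]
      refine (enorm_add_le _ _).trans (add_le_add (hD.trans (add_le_add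
        (mul_le_mul' (exp_decay_le hγ0 hγ1.le hqpos hτ hk) h1) h2)) ?_)
      rw [enorm_mul, hθ', one_mul]
      exact (hVb 0 k hk).1
    have h4 : ‖c 0 k‖ₑ ≤ 2 * wt (-1) k * ‖varCoeff (c 0) 1 k‖ₑ := by
      have h5 : wt 1 k ≤ 2 * ‖(Complex.I * k : ℂ)‖ₑ := by
        rw [wt_one, ← ofReal_norm, ← ENNReal.ofReal_ofNat 2, ← ENNReal.ofReal_mul two_pos.le,
          norm_mul, Complex.norm_I, one_mul, Complex.norm_intCast]
        exact ENNReal.ofReal_le_ofReal (bracket_le_two_mul hk)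
      calc ‖c 0 k‖ₑ = (wt 1 k * wt (-1) k) * ‖c 0 k‖ₑ := by rw [wt_mul_neg, one_mul]
        _ ≤ (2 * ‖(Complex.I * k : ℂ)‖ₑ * wt (-1) k) * ‖c 0 k‖ₑ := by gcongr
        _ = 2 * wt (-1) k * (‖(Complex.I * k : ℂ)‖ₑ * ‖c 0 k‖ₑ) := by ring
        _ = _ := by rw [← enorm_mul]; rfl
    refine h4.trans ?_
    calc 2 * wt (-1) k * ‖varCoeff (c 0) 1 k‖ₑ
        ≤ 2 * wt (-1) k * ((Q * wt (-γ) k * R) * (maj (c τ) k + V τ k) + (Q * wt (-γ) k) * I k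
          + wt (κ - 1) k * V 0 k) := by gcongr
      _ = _ := by rw [ha₁, ha₂, ha₃]; ring
  refine (sqnorm_mono le_rfl hpoint).trans_lt ?_
  rw [sqnorm_wt_mul]
  refine (sqnorm_add_add_le _ _ _ _).trans_lt ?_
  have e₁ : sqnorm (σ + 1 + δ + -1) a₁ ≤ (2 * (Q * R)) ^ 2 * (2 * K + 2 * C) := by
    rw [ha₁, sqnorm_const_mul, sqnorm_wt_mul]
    refine mul_le_mul' le_rfl ?_
    calc sqnorm (σ + 1 + δ + -1 + -γ) (fun k => maj (c τ) k + V τ k)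
        ≤ sqnorm σ (fun k => maj (c τ) k + V τ k) :=
          sqnorm_mono (by rw [hγ]; linarith) fun _ => le_rfl
      _ ≤ 2 * sqnorm σ (maj (c τ)) + 2 * sqnorm σ (V τ) := sqnorm_add_le _ _ _
      _ ≤ _ := by
          have := h.sqnorm_le τ
          have := hVsq τ
          gcongr
  have e₂ : sqnorm (σ + 1 + δ + -1) a₂ = (2 * Q) ^ 2 * sqnorm (σ - κ) I := by
    rw [ha₂, sqnorm_const_mul, sqnorm_wt_mul, hγ]
    congr 2
    ring
  have e₃ : sqnorm (σ + 1 + δ + -1) a₃ ≤ 2 ^ 2 * C := by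
    rw [ha₃, sqnorm_const_mul, sqnorm_wt_mul]
    refine mul_le_mul' le_rfl (le_trans ?_ (hVsq 0))
    exact sqnorm_mono (by linarith) fun _ => le_rfl
  have n₁ : sqnorm (σ + 1 + δ + -1) a₁ ≠ ⊤ := ne_top_of_le_ne_top (by finiteness) e₁
  have n₂ : sqnorm (σ + 1 + δ + -1) a₂ ≠ ⊤ := by
    rw [e₂]
    have := hIsq.ne
    finiteness
  have n₃ : sqnorm (σ + 1 + δ + -1) a₃ ≠ ⊤ := ne_top_of_le_ne_top (by finiteness) e₃
  exact lt_top_iff_ne_top.2 (by finiteness)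

end Duhamel

/-! ### Sobolev functions and their Fourier coefficients -/

lemma ofReal_bracket_mul_sq (s : ℝ) (z : ℂ) (k : ℤ) :
    ENNReal.ofReal (bracket k ^ (2 * s) * ‖z‖ ^ 2) = (wt s k * ‖z‖ₑ) ^ 2 := by
  have hk := bracket_pos k
  rw [mul_pow, wt_sq, wt, ENNReal.ofReal_mul (by positivity), ENNReal.ofReal_pow (norm_nonneg _),
    ofReal_norm]

lemma sqnorm_lt_top_of_summable {s : ℝ} {c : ℤ → ℂ}
    (h : Summable fun k : ℤ => bracket k ^ (2 * s) * ‖c k‖ ^ 2) :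
    sqnorm s (fun k => ‖c k‖ₑ) < ⊤ := by
  have := h.tsum_ofReal_lt_top
  simp only [ofReal_bracket_mul_sq] at this
  exact this

lemma bracket_mul_sq_nonneg (s : ℝ) (z : ℂ) (k : ℤ) : 0 ≤ bracket k ^ (2 * s) * ‖z‖ ^ 2 := by
  have hk := bracket_pos k
  positivity

lemma summable_of_sqnorm_lt_top {s : ℝ} {c : ℤ → ℂ} (h : sqnorm s (fun k => ‖c k‖ₑ) < ⊤) :
    Summable fun k : ℤ => bracket k ^ (2 * s) * ‖c k‖ ^ 2 := by
  have h1 : ∑' k : ℤ, ENNReal.ofReal (bracket k ^ (2 * s) * ‖c k‖ ^ 2) ≠ ⊤ := by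
    simp only [ofReal_bracket_mul_sq]
    exact h.ne
  have h2 := ENNReal.summable_toReal h1
  simpa only [ENNReal.toReal_ofReal (bracket_mul_sq_nonneg _ _ _)] using h2

lemma sqnorm_eq_sobolevNorm {s : ℝ} {f : Torus → ℂ}
    (h : sqnorm s (fun k => ‖fourierCoeff f k‖ₑ) < ⊤) :
    sqnorm s (fun k => ‖fourierCoeff f k‖ₑ) = ENNReal.ofReal (sobolevNorm s f) ^ 2 := by
  have hs := summable_of_sqnorm_lt_top h
  rw [sobolevNorm, ← ENNReal.ofReal_pow (Real.sqrt_nonneg _),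
    Real.sq_sqrt (tsum_nonneg fun k => bracket_mul_sq_nonneg _ _ _),
    ENNReal.ofReal_tsum_of_nonneg (fun k => bracket_mul_sq_nonneg _ _ _) hs]
  simp only [ofReal_bracket_mul_sq]
  rfl

lemma wnorm_maj_le_sqnorm {s : ℝ} (hs : 5 / 2 < s) :
    ∃ C : ℝ≥0∞, C ≠ ⊤ ∧ ∀ c : ℤ → ℂ, wnorm 1 (maj c) ≤ C + 4 * sqnorm s fun k => ‖c k‖ₑ := by
  refine ⟨∑' k, wt (2 * (1 - (s - 1))) k, (tsum_wt_lt_top (by linarith)).ne, fun c => ?_⟩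
  refine (wnorm_le_sqnorm 1 (s - 1) (maj c)).trans (add_le_add le_rfl ?_)
  have := sqnorm_maj_le (s - 1) c
  rwa [sub_add_cancel] at this

lemma MemSobolev.wnorm_maj_ne_top {s : ℝ} (hs : 5 / 2 < s) {f : Torus → ℂ} (hf : MemSobolev s f) :
    wnorm 1 (maj (fourierCoeff f)) ≠ ⊤ := by
  obtain ⟨C, hC, h⟩ := wnorm_maj_le_sqnorm hs
  have := (sqnorm_lt_top_of_summable hf.2).ne
  exact ne_top_of_le_ne_top (by finiteness) (h _)

lemma MemSobolev.integrable {s : ℝ} {f : Torus → ℂ} (hf : MemSobolev s f) : Integrable f dx :=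
  hf.1.integrable (by norm_num)

/-- Square integrable functions with the same Fourier coefficients agree almost everywhere. -/
lemma ae_eq_of_fourierCoeff_eq {f g : Torus → ℂ} (hf : MemLp f 2 dx) (hg : MemLp g 2 dx)
    (h : ∀ k, fourierCoeff f k = fourierCoeff g k) : f =ᵐ[dx] g := by
  have hfg : hf.toLp f = hg.toLp g := by
    refine (fourierBasis (T := 2 * π)).repr.injective ?_
    ext k
    rw [fourierBasis_repr, fourierBasis_repr, fourierCoeff_congr_ae hf.coeFn_toLp,
      fourierCoeff_congr_ae hg.coeFn_toLp, h k]
  exact hf.coeFn_toLp.symm.trans ((Lp.ext_iff.1 hfg).trans hg.coeFn_toLp)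

lemma memLp_continuousMap (f : C(Torus, ℂ)) : MemLp f 2 dx :=
  f.continuous.memLp_of_hasCompactSupport (HasCompactSupport.of_compactSpace _)

lemma MemSobolev.ae_eq_vars {s : ℝ} (hs : 5 / 2 < s) {f : Torus → ℂ} (hf : MemSobolev s f) :
    f =ᵐ[dx] vars (fourierCoeff f) 0 :=
  ae_eq_of_fourierCoeff_eq hf.1 (memLp_continuousMap _) fun k =>
    (fourierCoeff_vars (hf.wnorm_maj_ne_top hs) 0 k).symm

lemma MemSobolev.derivX_eq {s : ℝ} (hs : 5 / 2 < s) {f : Torus → ℂ} (hf : MemSobolev s f) :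
    derivX f = vars (fourierCoeff f) 1 := by
  funext x
  rw [vars_one_apply (hf.wnorm_maj_ne_top hs)]
  rfl

lemma aeval_apply_eq_eval (b : Fin 4 → C(Torus, ℂ)) (p : MvPolynomial (Fin 4) ℂ) (x : Torus) :
    MvPolynomial.aeval b p x = MvPolynomial.eval (fun i => b i x) p := by
  have h := MvPolynomial.comp_aeval_apply b (ContinuousMap.evalAlgHom ℂ ℂ x) p
  rw [← MvPolynomial.coe_aeval_eq_eval]
  exact h

lemma vars_apply_eq {c : ℤ → ℂ} (hc : wnorm 1 (maj c) ≠ ⊤) (x : Torus) :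
    (fun i => vars c i x) = ![vars c 0 x, vars c 1 x, conj (vars c 0 x), conj (vars c 1 x)] := by
  funext i
  fin_cases i
  · rfl
  · rfl
  · exact vars_two_apply hc x
  · exact vars_three_apply hc x

lemma MemSobolev.nonlin_ae_eq {s : ℝ} (hs : 5 / 2 < s) {f : Torus → ℂ} (hf : MemSobolev s f)
    (F : MvPolynomial (Fin 4) ℂ) : (fun x => nonlin F (f x) (derivX f x))
      =ᵐ[dx] MvPolynomial.aeval (vars (fourierCoeff f)) F := by
  filter_upwards [hf.ae_eq_vars hs] with x hx
  rw [hf.derivX_eq hs, hx, aeval_apply_eq_eval, vars_apply_eq (hf.wnorm_maj_ne_top hs)]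
  rfl

lemma hasDerivAt_eval {a : ℝ → Fin 4 → ℂ} {a' : Fin 4 → ℂ} {t : ℝ}
    (ha : ∀ i, HasDerivAt (fun τ => a τ i) (a' i) t) (p : MvPolynomial (Fin 4) ℂ) :
    HasDerivAt (fun τ => MvPolynomial.eval (a τ) p)
      (∑ i, MvPolynomial.eval (a t) (MvPolynomial.pderiv i p) * a' i) t :=
  hasDerivAt_aeval ha p

/-- The Wirtinger derivative of a polynomial is its formal partial derivative. -/
lemma nonlinOmega_eq (F : MvPolynomial (Fin 4) ℂ) (ζ w : ℂ) :
    nonlinOmega F ζ w = nonlin (MvPolynomial.pderiv 1 F) ζ w := by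
  have hcoe : HasDerivAt (fun a : ℝ => (a : ℂ)) 1 0 := Complex.ofRealCLM.hasDerivAt
  have hline : ∀ z : ℂ, HasDerivAt (fun a : ℝ => nonlin F ζ (w + a * z))
      (MvPolynomial.eval ![ζ, w, conj ζ, conj w] (MvPolynomial.pderiv 1 F) * z
        + MvPolynomial.eval ![ζ, w, conj ζ, conj w] (MvPolynomial.pderiv 3 F) * conj z) 0 := by
    intro z
    have h1 : HasDerivAt (fun a : ℝ => w + a * z) z 0 := by
      simpa using (hcoe.mul_const z).const_add w
    have h2 := hasDerivAt_eval (a := fun a : ℝ => ![ζ, w + a * z, conj ζ, conj (w + a * z)])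
      (a' := ![0, z, 0, conj z]) (t := 0) (fun i => by
        fin_cases i
        · exact hasDerivAt_const _ _
        · exact h1
        · exact hasDerivAt_const _ _
        · exact h1.star) F
    simpa [Fin.sum_univ_four, nonlin] using h2
  have hre := (hline 1).deriv
  have him := (hline Complex.I).deriv
  simp only [mul_one] at hre
  rw [nonlinOmega, hre, him, nonlin, map_one, Complex.conj_I]
  linear_combination (-(1 / 2 : ℂ) * MvPolynomial.eval ![ζ, w, conj ζ, conj w]
    (MvPolynomial.pderiv 1 F) + (1 / 2 : ℂ) * MvPolynomial.eval ![ζ, w, conj ζ, conj w]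
    (MvPolynomial.pderiv 3 F)) * Complex.I_mul_I

lemma MemSobolev.imOmegaMean_eq {s : ℝ} (hs : 5 / 2 < s) {f : Torus → ℂ} (hf : MemSobolev s f)
    (F : MvPolynomial (Fin 4) ℂ) :
    imOmegaMean F f = (nlCoeff (MvPolynomial.pderiv 1 F) (fourierCoeff f) 0).im := by
  set g := MvPolynomial.aeval (vars (fourierCoeff f)) (MvPolynomial.pderiv 1 F)
  have h1 : nlCoeff (MvPolynomial.pderiv 1 F) (fourierCoeff f) 0 = ∫ x, g x ∂dx := by
    refine integral_congr_ae (ae_of_all _ fun x => ?_)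
    simp [g]
  rw [h1, imOmegaMean]
  have h2 : (∫ x, g x ∂dx).im = ∫ x, (g x).im ∂dx :=
    (Complex.imCLM.integral_comp_comm (integrable_dx g)).symm
  rw [h2]
  refine integral_congr_ae ?_
  filter_upwards [hf.nonlin_ae_eq hs (MvPolynomial.pderiv 1 F)] with x hx
  rw [nonlinOmega_eq, hx]

lemma memSobolev_ofCoeff {r : ℝ} {c : ℤ → ℂ} (hc : Summable fun k => ‖c k‖)
    (h : sqnorm r (fun k => ‖c k‖ₑ) < ⊤) : MemSobolev r (ofCoeff c) := by
  refine ⟨memLp_continuousMap _, ?_⟩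
  simp only [fourierCoeff_ofCoeff hc]
  exact summable_of_sqnorm_lt_top h

/-- Sobolev regularity of a frequency projection in terms of the Fourier coefficients. -/
lemma MemSobolev.memSobolev_fourierMultiplier {s r : ℝ} (hs : 5 / 2 < s) {f : Torus → ℂ}
    (hf : MemSobolev s f) (P : ℤ → Prop) [DecidablePred P]
    (h : sqnorm r (fun k => if P k then ‖fourierCoeff f k‖ₑ else 0) < ⊤) :
    MemSobolev r (fourierMultiplier (fun k => if P k then 1 else 0) f) := by
  set c : ℤ → ℂ := fun k => (if P k then 1 else 0) * fourierCoeff f k with hc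
  have hcs : Summable fun k => ‖c k‖ := by
    refine Summable.of_nonneg_of_le (fun k => norm_nonneg _) (fun k => ?_)
      (summable_varCoeff (hf.wnorm_maj_ne_top hs) 0)
    simp only [hc, varCoeff, Matrix.cons_val_zero]
    split_ifs <;> simp
  have heq : fourierMultiplier (fun k => if P k then 1 else 0) f = ofCoeff c := by
    funext x
    rw [ofCoeff_apply hcs]
    rfl
  rw [heq]
  refine memSobolev_ofCoeff hcs (lt_of_eq_of_lt ?_ h)
  congr 1
  funext k
  simp only [hc]
  split_ifs <;> simp

lemma fourierCoeff_sub {f g : Torus → ℂ} (hf : Integrable f dx) (hg : Integrable g dx) (k : ℤ) :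
    fourierCoeff (f - g) k = fourierCoeff f k - fourierCoeff g k := by
  have h := congrFun (fourierCoeff.add (hf.sub hg) hg) k
  rw [sub_add_cancel, Pi.add_apply] at h
  rw [h, add_sub_cancel_right]

/-! ### Continuity in time -/

section Time

variable {s T : ℝ} {u : ℝ → Torus → ℂ}

lemma ContinuousInSobolev.sqnorm_sub_eq {I : Set ℝ} (hu : ContinuousInSobolev s I u) {t t₀ : ℝ}
    (ht : t ∈ I) (ht₀ : t₀ ∈ I) :
    sqnorm s (fun k => ‖fourierCoeff (u t) k - fourierCoeff (u t₀) k‖ₑ)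
      = ENNReal.ofReal (sobolevNorm s (u t - u t₀)) ^ 2 := by
  have hsub := fourierCoeff_sub (hu.1 t ht).integrable (hu.1 t₀ ht₀).integrable
  rw [← sqnorm_eq_sobolevNorm]
  · simp only [hsub]
  · simp only [hsub]
    refine lt_of_le_of_lt (sqnorm_mono le_rfl fun k => enorm_sub_le) ?_
    refine (sqnorm_add_le _ _ _).trans_lt ?_
    have h1 := (sqnorm_lt_top_of_summable (hu.1 t ht).2).ne
    have h2 := (sqnorm_lt_top_of_summable (hu.1 t₀ ht₀).2).ne
    exact lt_top_iff_ne_top.2 (by finiteness)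

/-- A continuous curve in `H^s` over a compact time interval is bounded. -/
lemma ContinuousInSobolev.exists_sqnorm_le {a b : ℝ}
    (hu : ContinuousInSobolev s (Set.Icc a b) u) :
    ∃ K : ℝ≥0∞, K ≠ ⊤ ∧ ∀ t ∈ Set.Icc a b, sqnorm s (fun k => ‖fourierCoeff (u t) k‖ₑ) ≤ K := by
  have key := (isCompact_Icc (a := a) (b := b)).induction_on
    (p := fun S => ∃ K : ℝ≥0∞, K ≠ ⊤ ∧
      ∀ t ∈ S ∩ Set.Icc a b, sqnorm s (fun k => ‖fourierCoeff (u t) k‖ₑ) ≤ K)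
    ⟨0, by simp, fun t ht => absurd ht.1 (Set.notMem_empty t)⟩
    (fun S S' hSS' ⟨K, hK, h⟩ => ⟨K, hK, fun t ht => h t ⟨hSS' ht.1, ht.2⟩⟩)
    (fun S S' ⟨K, hK, h⟩ ⟨K', hK', h'⟩ => ⟨K + K', by finiteness, fun t ht => by
      rcases ht.1 with h1 | h1
      · exact (h t ⟨h1, ht.2⟩).trans le_self_add
      · exact (h' t ⟨h1, ht.2⟩).trans le_add_self⟩)
    (fun t₀ ht₀ => by
      have h1 := (hu.2 t₀ ht₀).eventually (gt_mem_nhds zero_lt_one)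
      refine ⟨{t | sobolevNorm s (u t - u t₀) < 1}, h1, 2 + 2 * sqnorm s
        (fun k => ‖fourierCoeff (u t₀) k‖ₑ), ?_, fun t ht => ?_⟩
      · have := (sqnorm_lt_top_of_summable (hu.1 t₀ ht₀).2).ne
        finiteness
      · have h2 := hu.sqnorm_sub_eq ht.2 ht₀
        calc sqnorm s (fun k => ‖fourierCoeff (u t) k‖ₑ)
            ≤ sqnorm s (fun k => ‖fourierCoeff (u t) k - fourierCoeff (u t₀) k‖ₑ
                + ‖fourierCoeff (u t₀) k‖ₑ) := by
              refine sqnorm_mono le_rfl fun k => ?_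
              calc ‖fourierCoeff (u t) k‖ₑ
                  = ‖(fourierCoeff (u t) k - fourierCoeff (u t₀) k) + fourierCoeff (u t₀) k‖ₑ := by
                    rw [sub_add_cancel]
                _ ≤ _ := enorm_add_le _ _
          _ ≤ 2 * 1 + 2 * sqnorm s (fun k => ‖fourierCoeff (u t₀) k‖ₑ) := by
              refine (sqnorm_add_le _ _ _).trans (add_le_add (mul_le_mul' le_rfl ?_) le_rfl)
              rw [h2]
              exact pow_le_one₀ zero_le (ENNReal.ofReal_le_one.2 (le_of_lt ht.1))
          _ = _ := by rw [mul_one])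
  obtain ⟨K, hK, h⟩ := key
  exact ⟨K, hK, fun t ht => h t ⟨ht, ht⟩⟩

/-- `H^s` embeds continuously into the weighted Wiener algebra if `s > 3/2`. -/
lemma wnorm_one_sq_le (s : ℝ) (a : ℤ → ℝ≥0∞) :
    wnorm 1 a ^ 2 ≤ (∑' k, wt (2 * (1 - s)) k) * sqnorm s a := by
  have h := sq_tsum_mul_le (wt (2 * (1 - s))) fun k => wt (-(2 * (1 - s))) k * (wt 1 k * a k)
  have e1 : ∀ k, wt (2 * (1 - s)) k * (wt (-(2 * (1 - s))) k * (wt 1 k * a k)) = wt 1 k * a k := by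
    intro k
    rw [← mul_assoc, wt_mul_neg, one_mul]
  have e2 : ∀ k, wt (2 * (1 - s)) k * (wt (-(2 * (1 - s))) k * (wt 1 k * a k)) ^ 2
      = (wt s k * a k) ^ 2 := by
    intro k
    calc wt (2 * (1 - s)) k * (wt (-(2 * (1 - s))) k * (wt 1 k * a k)) ^ 2
        = (wt (2 * (1 - s)) k * wt (-(2 * (1 - s))) k)
          * (wt (-(2 * (1 - s))) k * (wt 1 k) ^ 2) * a k ^ 2 := by ring
      _ = (wt s k * a k) ^ 2 := by
          rw [wt_mul_neg, one_mul, wt_sq, ← wt_add, mul_pow, wt_sq]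
          congr 2
          ring
  simp only [e1, e2] at h
  exact h

lemma enorm_varCoeff_sub_le (c d : ℤ → ℂ) (i : Fin 4) (k : ℤ) :
    ‖varCoeff c i k - varCoeff d i k‖ₑ ≤ maj (fun k => c k - d k) k := by
  have h : varCoeff c i k - varCoeff d i k = varCoeff (fun k => c k - d k) i k := by
    fin_cases i <;> simp [varCoeff, mul_sub]
  rw [h]
  exact enorm_varCoeff_le _ _ _

lemma edist_vars_le {c d : ℤ → ℂ} (hc : wnorm 1 (maj c) ≠ ⊤) (hd : wnorm 1 (maj d) ≠ ⊤)
    (i : Fin 4) : edist (vars c i) (vars d i) ≤ 2 * wnorm 1 fun k => ‖c k - d k‖ₑ := by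
  have hsum : ∑' k, ‖varCoeff c i k - varCoeff d i k‖ₑ ≤ 2 * wnorm 1 fun k => ‖c k - d k‖ₑ := by
    refine (ENNReal.tsum_le_tsum (enorm_varCoeff_sub_le c d i)).trans_eq ?_
    have h1 := wnorm_add 1 (fun k => ‖c k - d k‖ₑ) fun k => ‖c (-k) - d (-k)‖ₑ
    have h2 := wnorm_comp_neg 1 fun k => ‖c k - d k‖ₑ
    rw [h2, ← two_mul] at h1
    exact h1
  have hs : Summable fun k => ‖varCoeff c i k - varCoeff d i k‖ :=
    Summable.of_nonneg_of_le (fun k => norm_nonneg _) (fun k => norm_sub_le _ _)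
      ((summable_varCoeff hc i).add (summable_varCoeff hd i))
  refine le_trans ?_ hsum
  rw [edist_eq_enorm_sub, vars, vars, ofCoeff_sub (summable_varCoeff hc i) (summable_varCoeff hd i),
    ← ofReal_norm]
  refine (ENNReal.ofReal_le_ofReal (norm_ofCoeff_le hs)).trans_eq ?_
  rw [ENNReal.ofReal_tsum_of_nonneg (fun k => norm_nonneg _) hs]
  simp only [ofReal_norm]

lemma ContinuousInSobolev.continuousOn_vars (hs : 5 / 2 < s) {I : Set ℝ}
    (hu : ContinuousInSobolev s I u) (i : Fin 4) :
    ContinuousOn (fun t => vars (fourierCoeff (u t)) i) I := by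
  intro t₀ ht₀
  set C : ℝ≥0∞ := ∑' k, wt (2 * (1 - s)) k with hC
  have hCtop : C ≠ ⊤ := (tsum_wt_lt_top (by linarith)).ne
  rw [ContinuousWithinAt, tendsto_iff_edist_tendsto_0]
  have hlim : Tendsto (fun t => 2 * ((C + 1) * ENNReal.ofReal (sobolevNorm s (u t - u t₀))))
      (𝓝[I] t₀) (𝓝 0) := by
    have h1 := ENNReal.tendsto_ofReal (hu.2 t₀ ht₀)
    rw [ENNReal.ofReal_zero] at h1
    have h2 := ENNReal.Tendsto.const_mul h1 (a := C + 1) (Or.inr (by finiteness))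
    have h3 := ENNReal.Tendsto.const_mul h2 (a := 2) (Or.inr (by finiteness))
    simpa using h3
  refine tendsto_of_tendsto_of_tendsto_of_le_of_le' tendsto_const_nhds hlim
    (Eventually.of_forall fun _ => zero_le) ?_
  filter_upwards [self_mem_nhdsWithin] with t ht
  refine (edist_vars_le ((hu.1 t ht).wnorm_maj_ne_top hs) ((hu.1 t₀ ht₀).wnorm_maj_ne_top hs)
    i).trans (mul_le_mul' le_rfl ?_)
  have h := wnorm_one_sq_le s fun k => ‖fourierCoeff (u t) k - fourierCoeff (u t₀) k‖ₑ
  rw [hu.sqnorm_sub_eq ht ht₀, ← hC] at h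
  have h' : (wnorm 1 fun k => ‖fourierCoeff (u t) k - fourierCoeff (u t₀) k‖ₑ) ^ 2
      ≤ ((C + 1) * ENNReal.ofReal (sobolevNorm s (u t - u t₀))) ^ 2 := by
    refine h.trans ?_
    rw [mul_pow]
    gcongr
    calc C ≤ C + 1 := le_self_add
      _ ≤ (C + 1) ^ 2 := le_self_pow₀ le_add_self two_ne_zero
  exact (ENNReal.pow_le_pow_left_iff two_ne_zero).1 h'

end Time

/-! ### From the weak formulation to ordinary differential equations -/

/-- Complex valued test functions in time, for the interval `[0, T)`. -/
def IsTimeTest (T : ℝ) (η : ℝ → ℂ) : Prop :=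
  ContDiff ℝ ∞ η ∧ ∃ T' < T, ∀ t, T' ≤ t → η t = 0

/-- Every smooth function with compact support in `(0, T)` is the derivative of a test function. -/
lemma exists_isTimeTest_deriv_eq {T : ℝ} (hT : 0 < T) {ψ : ℝ → ℝ} (hψ : ContDiff ℝ ∞ ψ)
    (hc : HasCompactSupport ψ) (hsupp : tsupport ψ ⊆ Set.Ioo 0 T) :
    ∃ η, IsTimeTest T η ∧ ∀ t, deriv η t = ψ t := by
  have hψ' : ContDiff ℝ ∞ fun t => (ψ t : ℂ) := Complex.ofRealCLM.contDiff.comp hψ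
  have hd : ∀ t, HasDerivAt (fun t => ∫ r in T..t, (ψ r : ℂ)) (ψ t : ℂ) t := fun t =>
    intervalIntegral.integral_hasDerivAt_right (hψ'.continuous.intervalIntegrable _ _)
      (hψ'.continuous.stronglyMeasurableAtFilter _ _) hψ'.continuous.continuousAt
  have hderiv : deriv (fun t => ∫ r in T..t, (ψ r : ℂ)) = fun t => (ψ t : ℂ) :=
    funext fun t => (hd t).deriv
  obtain ⟨T', hT', hle⟩ : ∃ T' < T, ∀ x ∈ tsupport ψ, x ≤ T' := by
    rcases (tsupport ψ).eq_empty_or_nonempty with he | hne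
    · exact ⟨0, hT, by simp [he]⟩
    · obtain ⟨x, hx, hmax⟩ := (show IsCompact (tsupport ψ) from hc).exists_isGreatest hne
      exact ⟨x, (hsupp hx).2, fun y hy => hmax hy⟩
  have hzero : ∀ r, T' < r → ψ r = 0 := fun r hr => by
    by_contra h
    exact absurd (hle r (subset_tsupport ψ h)) (not_le.2 hr)
  refine ⟨fun t => ∫ r in T..t, (ψ r : ℂ), ⟨?_, (T' + T) / 2, by linarith, fun t ht => ?_⟩,
    fun t => (hd t).deriv⟩
  · rw [contDiff_infty_iff_deriv, hderiv]
    exact ⟨fun t => (hd t).differentiableAt, hψ'⟩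
  · have : ∀ r ∈ Set.uIcc T t, (ψ r : ℂ) = 0 := by
      intro r hr
      rw [hzero r, Complex.ofReal_zero]
      have h1 : min T t ≤ r := hr.1
      rcases min_choice T t with h | h <;> rw [h] at h1 <;> linarith
    exact (intervalIntegral.integral_congr this).trans (by simp)

/-- The distributional form of an ordinary differential equation with continuous right-hand side
implies the classical form, including the initial condition. -/
lemma hasDerivAt_of_weak {T : ℝ} (hT : 0 < T) {v h : ℝ → ℂ} (hv : Continuous v)
    (hh : Continuous h) {v₀ : ℂ}
    (hweak : ∀ η, IsTimeTest T η → -(∫ t in (0 : ℝ)..T, v t * deriv η t) - v₀ * η 0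
      = ∫ t in (0 : ℝ)..T, h t * η t) :
    v 0 = v₀ ∧ ∀ t ∈ Set.Ioo 0 T, HasDerivAt v (h t) t := by
  set V : ℝ → ℂ := fun t => v₀ + ∫ r in (0 : ℝ)..t, h r with hV
  have hVd : ∀ t, HasDerivAt V (h t) t := fun t =>
    (intervalIntegral.integral_hasDerivAt_right (hh.intervalIntegrable _ _)
      (hh.stronglyMeasurableAtFilter _ _) hh.continuousAt).const_add v₀
  have hVc : Continuous V := continuous_iff_continuousAt.2 fun t => (hVd t).continuousAt
  have hzero : ∀ η, IsTimeTest T η → ∫ t in (0 : ℝ)..T, (v t - V t) * deriv η t = 0 := by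
    intro η hη
    obtain ⟨T', hT', hη0⟩ := hη.2
    have hηd : ∀ t, HasDerivAt η (deriv η t) t := fun t =>
      ((hη.1.differentiable (by simp)) t).hasDerivAt
    have hηc : Continuous (deriv η) := hη.1.continuous_deriv (by simp)
    have hparts := intervalIntegral.integral_mul_deriv_eq_deriv_mul (u := V) (v := η)
      (a := 0) (b := T) (fun t _ => hVd t) (fun t _ => hηd t) (hh.intervalIntegrable _ _)
      (hηc.intervalIntegrable _ _)
    rw [hη0 T hT'.le, mul_zero, zero_sub] at hparts
    have hV0 : V 0 = v₀ := by simp [hV]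
    rw [hV0] at hparts
    have h1 : ∫ t in (0 : ℝ)..T, (v t - V t) * deriv η t
        = (∫ t in (0 : ℝ)..T, v t * deriv η t) - ∫ t in (0 : ℝ)..T, V t * deriv η t := by
      have hi₁ : IntervalIntegrable (fun t => v t * deriv η t) volume 0 T :=
        (hv.mul hηc).intervalIntegrable _ _
      have hi₂ : IntervalIntegrable (fun t => V t * deriv η t) volume 0 T :=
        (hVc.mul hηc).intervalIntegrable _ _
      rw [← intervalIntegral.integral_sub hi₁ hi₂]
      exact intervalIntegral.integral_congr fun t _ => sub_mul _ _ _
    rw [h1, hparts]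
    linear_combination -(hweak η hη)
  have hae : ∀ᵐ t, t ∈ Set.Ioo 0 T → v t - V t = 0 := by
    refine isOpen_Ioo.ae_eq_zero_of_integral_contDiff_smul_eq_zero
      ((hv.sub hVc).locallyIntegrable.locallyIntegrableOn _) fun ψ hψ hψc hψs => ?_
    obtain ⟨η, hη, hηψ⟩ := exists_isTimeTest_deriv_eq hT hψ hψc hψs
    rw [← hzero η hη, intervalIntegral.integral_of_le hT.le,
      ← setIntegral_eq_integral_of_forall_compl_eq_zero (s := Set.Ioc 0 T)]
    · refine setIntegral_congr_fun measurableSet_Ioc fun t _ => ?_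
      simp only [hηψ, Complex.real_smul]
      ring
    · intro t ht
      have : ψ t = 0 := by
        by_contra h0
        have := hψs (subset_tsupport ψ h0)
        exact ht ⟨this.1, this.2.le⟩
      rw [this, zero_smul]
  have heq : Set.EqOn v V (Set.Ioo 0 T) := by
    refine Measure.eqOn_open_of_ae_eq (μ := volume) ?_ isOpen_Ioo hv.continuousOn hVc.continuousOn
    rw [EventuallyEq, ae_restrict_iff' measurableSet_Ioo]
    filter_upwards [hae] with t ht h1
    exact sub_eq_zero.1 (ht h1)
  refine ⟨?_, fun t ht => (hVd t).congr_of_eventuallyEq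
    (heq.eventuallyEq_of_mem (Ioo_mem_nhds ht.1 ht.2))⟩
  have hcl : Set.EqOn v V (closure (Set.Ioo 0 T)) := heq.closure hv hVc
  rw [closure_Ioo hT.ne] at hcl
  rw [hcl ⟨le_rfl, hT.le⟩]
  simp [hV]

/-! ### Solutions in the sense of distributions on the Fourier side -/

section Weak

variable {F : MvPolynomial (Fin 4) ℂ} {α s T : ℝ} {φ : Torus → ℂ} {u : ℝ → Torus → ℂ}

/-- The space-time test function `η(t) e^{-ikx}`, which extracts the `k`-th Fourier coefficient. -/
noncomputable def fourierTest (η : ℝ → ℂ) (k : ℤ) (t : ℝ) (x : Torus) : ℂ := η t * fourier (-k) x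

lemma smoothOnCylinder_fourierTest {η : ℝ → ℂ} (hη : ContDiff ℝ ∞ η) (k : ℤ) :
    SmoothOnCylinder (fourierTest η k) := by
  unfold SmoothOnCylinder fourierTest
  refine (hη.comp contDiff_fst).mul ?_
  simp only [fourier_coe_apply]
  refine ContDiff.cexp ?_
  have h : ContDiff ℝ ∞ fun p : ℝ × ℝ => (p.2 : ℂ) := Complex.ofRealCLM.contDiff.comp contDiff_snd
  exact (contDiff_const.mul h).div_const _

lemma integral_mul_fourier (f : Torus → ℂ) (z : ℂ) (k : ℤ) :
    ∫ x, f x * (z * fourier (-k) x) ∂dx = fourierCoeff f k * z := by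
  rw [mul_comm (fourierCoeff f k) z, fourierCoeff, ← integral_const_mul]
  refine integral_congr_ae (ae_of_all _ fun x => ?_)
  simp only [smul_eq_mul]
  ring

lemma deriv_fourierTest {η : ℝ → ℂ} (hη : ContDiff ℝ ∞ η) (k : ℤ) (t : ℝ) (x : Torus) :
    deriv (fun τ => fourierTest η k τ x) t = deriv η t * fourier (-k) x :=
  (((hη.differentiable (by simp)) t).hasDerivAt.mul_const _).deriv

lemma fracDeriv_fourierTest (α : ℝ) (η : ℝ → ℂ) (k : ℤ) (t : ℝ) (x : Torus) :
    fracDeriv α (fourierTest η k t) x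
      = (((|(k : ℝ)| ^ α : ℝ) : ℂ) * η t) * fourier (-k) x := by
  have hcoeff : ∀ j, fourierCoeff (fourierTest η k t) j = if j = -k then η t else 0 := by
    intro j
    have h : fourierCoeff (fourierTest η k t) j = η t * fourierCoeff (fourier (-k)) j :=
      fourierCoeff.const_mul _ _ _
    rw [h, fourierCoeff_fourier]
    by_cases hj : j = -k
    · subst hj; simp
    · simp [hj]
  rw [fracDeriv, fourierMultiplier, tsum_eq_single (-k)]
  · rw [hcoeff, if_pos rfl, Int.cast_neg, abs_neg]
  · intro j hj
    rw [hcoeff, if_neg hj, mul_zero, zero_mul]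

lemma ContinuousInSobolev.continuousOn_coeff (hs : 5 / 2 < s) {I : Set ℝ}
    (hu : ContinuousInSobolev s I u) (k : ℤ) :
    ContinuousOn (fun t => fourierCoeff (u t) k) I := by
  refine ((coeffL k).continuous.comp_continuousOn (hu.continuousOn_vars hs 0)).congr fun t ht => ?_
  exact (fourierCoeff_vars ((hu.1 t ht).wnorm_maj_ne_top hs) 0 k).symm

lemma ContinuousInSobolev.continuousOn_nlCoeff (hs : 5 / 2 < s) {I : Set ℝ}
    (hu : ContinuousInSobolev s I u) (p : MvPolynomial (Fin 4) ℂ) (k : ℤ) :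
    ContinuousOn (fun t => nlCoeff p (fourierCoeff (u t)) k) I := by
  refine (coeffL k).continuous.comp_continuousOn ?_
  induction p using MvPolynomial.induction_on with
  | C z => simpa using continuousOn_const
  | add p q hp hq =>
    simp only [map_add]
    exact hp.add hq
  | mul_X p i hp =>
    simp only [map_mul, MvPolynomial.aeval_X]
    exact hp.mul (hu.continuousOn_vars hs i)

lemma ContinuousInSobolev.integral_mul_deriv_test {a b : ℝ} {η : ℝ → ℂ} (hη : ContDiff ℝ ∞ η)
    (k : ℤ) : ∫ t in a..b, ∫ x, u t x * deriv (fun τ => fourierTest η k τ x) t ∂dx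
      = ∫ t in a..b, fourierCoeff (u t) k * deriv η t := by
  refine intervalIntegral.integral_congr fun t _ => ?_
  simp only [deriv_fourierTest hη, integral_mul_fourier]

lemma ContinuousInSobolev.integral_rhs (hs : 5 / 2 < s) {a b : ℝ}
    (hu : ContinuousInSobolev s (Set.uIcc a b) u) (F : MvPolynomial (Fin 4) ℂ) (α : ℝ)
    {η : ℝ → ℂ} (hη : ContDiff ℝ ∞ η) (k : ℤ) :
    (∫ t in a..b, ∫ x, nonlin F (u t x) (derivX (u t) x) * fourierTest η k t x ∂dx)
      - Complex.I * (∫ t in a..b, ∫ x, u t x * fracDeriv α (fourierTest η k t) x ∂dx)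
      = ∫ t in a..b, rhs F α 1 (fourierCoeff (u t)) k * η t := by
  have h1 : ∫ t in a..b, ∫ x, nonlin F (u t x) (derivX (u t) x) * fourierTest η k t x ∂dx
      = ∫ t in a..b, nlCoeff F (fourierCoeff (u t)) k * η t := by
    refine intervalIntegral.integral_congr fun t ht => ?_
    simp only [fourierTest]
    rw [integral_mul_fourier fun x => nonlin F (u t x) (derivX (u t) x),
      fourierCoeff_congr_ae ((hu.1 t ht).nonlin_ae_eq hs F)]
    rfl
  have h2 : ∫ t in a..b, ∫ x, u t x * fracDeriv α (fourierTest η k t) x ∂dx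
      = ∫ t in a..b, fourierCoeff (u t) k * (((|(k : ℝ)| ^ α : ℝ) : ℂ) * η t) := by
    refine intervalIntegral.integral_congr fun t _ => ?_
    simp only [fracDeriv_fourierTest, integral_mul_fourier]
  have hηc : ContinuousOn η (Set.uIcc a b) := hη.continuous.continuousOn
  have i1 : IntervalIntegrable (fun t => nlCoeff F (fourierCoeff (u t)) k * η t) volume a b :=
    ((hu.continuousOn_nlCoeff hs F k).mul hηc).intervalIntegrable
  have i2 : IntervalIntegrable (fun t => Complex.I * (fourierCoeff (u t) k
      * (((|(k : ℝ)| ^ α : ℝ) : ℂ) * η t))) volume a b :=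
    (continuousOn_const.mul ((hu.continuousOn_coeff hs k).mul
      (continuousOn_const.mul hηc))).intervalIntegrable
  rw [h1, h2, ← intervalIntegral.integral_const_mul, ← intervalIntegral.integral_sub i1 i2]
  refine intervalIntegral.integral_congr fun t _ => ?_
  simp only [rhs]
  push_cast
  ring

/-- A weak solution in `C([0, T]; H^s)`, extended to all times by freezing it outside `[0, T]`,
gives a solution of the system for the Fourier coefficients. -/
lemma exists_isCoeffSolution (hs : 5 / 2 < s) (hT : 0 < T) {θ : ℝ}
    (hu : ContinuousInSobolev s (Set.Icc 0 T) u)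
    (hweak : ∀ (k : ℤ) (η : ℝ → ℂ), IsTimeTest T η →
      -(∫ t in (0 : ℝ)..T, fourierCoeff (u t) k * deriv η t) - fourierCoeff φ k * η 0
        = ∫ t in (0 : ℝ)..T, rhs F α θ (fourierCoeff (u t)) k * η t) :
    ∃ (K : ℝ≥0∞) (c : ℝ → ℤ → ℂ), K ≠ ⊤ ∧ IsCoeffSolution F α θ (s - 1) T K c ∧
      c 0 = fourierCoeff φ := by
  obtain ⟨K₀, hK₀, hK₀b⟩ := hu.exists_sqnorm_le
  obtain ⟨C, hC, hCb⟩ := wnorm_maj_le_sqnorm hs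
  set p : ℝ → ℝ := fun t => Set.projIcc 0 T hT.le t with hp
  have hpmem : ∀ t, p t ∈ Set.Icc 0 T := fun t => (Set.projIcc 0 T hT.le t).2
  have hpeq : ∀ t ∈ Set.Icc 0 T, p t = t := fun t ht => by
    rw [hp]
    simp only [Set.projIcc_of_mem hT.le ht]
  have hpc : Continuous p := continuous_subtype_val.comp continuous_projIcc
  have hv : ∀ k, Continuous fun t => fourierCoeff (u (p t)) k := fun k =>
    (hu.continuousOn_coeff hs k).comp_continuous hpc hpmem
  have hnl : ∀ k, Continuous fun t => nlCoeff F (fourierCoeff (u (p t))) k := fun k =>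
    (hu.continuousOn_nlCoeff hs F k).comp_continuous hpc hpmem
  have hh : ∀ k, Continuous fun t => rhs F α θ (fourierCoeff (u (p t))) k := fun k =>
    continuous_const.mul ((continuous_const.mul (hv k)).add (hnl k))
  have hode : ∀ k, fourierCoeff (u (p 0)) k = fourierCoeff φ k ∧
      ∀ t ∈ Set.Ioo 0 T, HasDerivAt (fun t => fourierCoeff (u (p t)) k)
        (rhs F α θ (fourierCoeff (u (p t))) k) t := by
    intro k
    refine hasDerivAt_of_weak hT (hv k) (hh k) fun η hη => ?_
    have hk := hweak k η hη
    have e1 : ∫ t in (0 : ℝ)..T, fourierCoeff (u (p t)) k * deriv η t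
        = ∫ t in (0 : ℝ)..T, fourierCoeff (u t) k * deriv η t := by
      refine intervalIntegral.integral_congr fun t ht => ?_
      rw [Set.uIcc_of_le hT.le] at ht
      simp only [hpeq t ht]
    have e2 : ∫ t in (0 : ℝ)..T, rhs F α θ (fourierCoeff (u (p t))) k * η t
        = ∫ t in (0 : ℝ)..T, rhs F α θ (fourierCoeff (u t)) k * η t := by
      refine intervalIntegral.integral_congr fun t ht => ?_
      rw [Set.uIcc_of_le hT.le] at ht
      simp only [hpeq t ht]
    rw [e1, e2]
    exact hk
  refine ⟨C + 4 * K₀, fun t => fourierCoeff (u (p t)), by finiteness, ⟨fun t => ?_, fun t => ?_,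
    fun i => ?_, fun t ht k => (hode k).2 t ht⟩, funext fun k => (hode k).1⟩
  · refine (hCb _).trans ?_
    have := hK₀b _ (hpmem t)
    gcongr
  · refine le_trans ?_ le_add_self
    refine (sqnorm_maj_le _ _).trans ?_
    rw [sub_add_cancel]
    have := hK₀b _ (hpmem t)
    gcongr
  · exact (hu.continuousOn_vars hs i).comp_continuous hpc hpmem

lemma IsForwardSolution.exists_isCoeffSolution (hs : 5 / 2 < s) (hT : 0 < T)
    (h : IsForwardSolution F α s T φ u) :
    ∃ (K : ℝ≥0∞) (c : ℝ → ℤ → ℂ), K ≠ ⊤ ∧ IsCoeffSolution F α 1 (s - 1) T K c ∧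
      c 0 = fourierCoeff φ := by
  refine DerivFNLS.exists_isCoeffSolution hs hT h.continuous fun k η hη => ?_
  obtain ⟨T', hT', hη0⟩ := hη.2
  have hw := h.weak (fourierTest η k) ⟨smoothOnCylinder_fourierTest hη.1 k, T', hT',
    fun t ht x => by rw [fourierTest, hη0 t ht, zero_mul]⟩
  have hu : ContinuousInSobolev s (Set.uIcc 0 T) u := by
    rw [Set.uIcc_of_le hT.le]
    exact h.continuous
  have hr := hu.integral_rhs hs F α hη.1 k
  rw [ContinuousInSobolev.integral_mul_deriv_test hη.1] at hw
  have hφ : ∫ x, φ x * fourierTest η k 0 x ∂dx = fourierCoeff φ k * η 0 :=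
    integral_mul_fourier φ (η 0) k
  rw [hφ] at hw
  linear_combination hw + hr

lemma IsBackwardSolution.exists_isCoeffSolution (hs : 5 / 2 < s) (hT : 0 < T)
    (h : IsBackwardSolution F α s T φ u) :
    ∃ (K : ℝ≥0∞) (c : ℝ → ℤ → ℂ), K ≠ ⊤ ∧ IsCoeffSolution F α (-1) (s - 1) T K c ∧
      c 0 = fourierCoeff φ := by
  have hneg : ∀ t ∈ Set.Icc 0 T, -t ∈ Set.Icc (-T) 0 := fun t ht =>
    ⟨by linarith [ht.2], by linarith [ht.1]⟩
  have hcont : ContinuousInSobolev s (Set.Icc 0 T) fun t => u (-t) := by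
    refine ⟨fun t ht => h.continuous.1 _ (hneg t ht), fun t₀ ht₀ => ?_⟩
    have hlim : Tendsto (fun t : ℝ => -t) (𝓝[Set.Icc 0 T] t₀) (𝓝[Set.Icc (-T) 0] (-t₀)) :=
      (continuous_neg.continuousWithinAt).tendsto_nhdsWithin hneg
    exact (h.continuous.2 _ (hneg t₀ ht₀)).comp hlim
  refine DerivFNLS.exists_isCoeffSolution hs hT hcont fun k η hη => ?_
  obtain ⟨T', hT', hη0⟩ := hη.2
  set ξ : ℝ → ℂ := fun t => η (-t) with hξ
  have hξs : ContDiff ℝ ∞ ξ := hη.1.comp contDiff_neg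
  have hξd : ∀ t, deriv ξ t = -deriv η (-t) := fun t => deriv_comp_neg η t
  have hw := h.weak (fourierTest ξ k) ⟨smoothOnCylinder_fourierTest hξs k, T', hT',
    fun t ht x => by rw [fourierTest, show ξ t = 0 from hη0 (-t) (by linarith), zero_mul]⟩
  have hu : ContinuousInSobolev s (Set.uIcc (-T) 0) u := by
    rw [Set.uIcc_of_le (by linarith)]
    exact h.continuous
  have hr := hu.integral_rhs hs F α hξs k
  rw [ContinuousInSobolev.integral_mul_deriv_test hξs] at hw
  have hφ : ∫ x, φ x * fourierTest ξ k 0 x ∂dx = fourierCoeff φ k * η 0 := by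
    have hξ0 : ξ 0 = η 0 := by simp [hξ]
    rw [← hξ0]
    exact integral_mul_fourier φ (ξ 0) k
  rw [hφ] at hw
  have e1 : ∫ t in (-T)..(0 : ℝ), fourierCoeff (u t) k * deriv ξ t
      = -∫ t in (0 : ℝ)..T, fourierCoeff (u (-t)) k * deriv η t := by
    have := intervalIntegral.integral_comp_neg (a := 0) (b := T)
      fun t => fourierCoeff (u t) k * deriv ξ t
    rw [neg_zero] at this
    rw [← this, ← intervalIntegral.integral_neg]
    refine intervalIntegral.integral_congr fun t _ => ?_
    simp only [hξd, neg_neg]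
    ring
  have e2 : ∫ t in (-T)..(0 : ℝ), rhs F α 1 (fourierCoeff (u t)) k * ξ t
      = -∫ t in (0 : ℝ)..T, rhs F α (-1) (fourierCoeff (u (-t))) k * η t := by
    have := intervalIntegral.integral_comp_neg (a := 0) (b := T)
      fun t => rhs F α 1 (fourierCoeff (u t)) k * ξ t
    rw [neg_zero] at this
    rw [← this, ← intervalIntegral.integral_neg]
    refine intervalIntegral.integral_congr fun t _ => ?_
    simp only [hξ, neg_neg, rhs]
    push_cast
    ring
  rw [e1] at hw
  rw [e2] at hr
  linear_combination -hw - hr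

end Weak

/-- Smoothing of a half-line of frequencies of the initial datum. -/
lemma IsCoeffSolution.memSobolev_projection {F : MvPolynomial (Fin 4) ℂ} {α θ s T : ℝ}
    {K : ℝ≥0∞} {c : ℝ → ℤ → ℂ} (h : IsCoeffSolution F α θ (s - 1) T K c) (hK : K ≠ ⊤) (hα : 2 < α)
    (hθ : |θ| = 1) (hs : 5 / 2 < s) (hT : 0 < T) {φ : Torus → ℂ} (hφ : MemSobolev s φ)
    (h0 : c 0 = fourierCoeff φ) {δ : ℝ} (hδ : δ ∈ Set.Ioo 0 (min (α - 2) 1)) (P : ℤ → Prop)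
    [DecidablePred P] (hP : ∀ k, P k → θ * k * imOmegaMean F φ < 0) :
    MemSobolev (s + δ) (fourierMultiplier (fun k => if P k then 1 else 0) φ) := by
  refine hφ.memSobolev_fourierMultiplier hs P ?_
  have hmain := h.sqnorm_lt_top hK hα hθ (by linarith) hT hδ.1 hδ.2
  rw [h0, ← hφ.imOmegaMean_eq hs F, sub_add_cancel] at hmain
  refine (sqnorm_mono le_rfl fun k => ?_).trans_lt hmain
  by_cases hk : P k
  · rw [if_pos hk, if_pos (hP k hk)]
  · rw [if_neg hk]
    exact zero_le

end DerivFNLS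

theorem theorem4p1 (F : MvPolynomial (Fin 4) ℂ) (α s T : ℝ) (hα : 2 < α)
    (hs : max (α / 2 + 1) (5 / 2) < s) (hT : 0 < T)
    (φ : DerivFNLS.Torus → ℂ) (hφ : DerivFNLS.MemSobolev s φ)
    (u : ℝ → DerivFNLS.Torus → ℂ) :
    (DerivFNLS.IsForwardSolution F α s T φ u →
      (0 < DerivFNLS.imOmegaMean F φ → ∀ δ ∈ Set.Ioo (0 : ℝ) (min (α - 2) 1),
        DerivFNLS.MemSobolev (s + δ) (DerivFNLS.projNeg φ)) ∧
      (DerivFNLS.imOmegaMean F φ < 0 → ∀ δ ∈ Set.Ioo (0 : ℝ) (min (α - 2) 1),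
        DerivFNLS.MemSobolev (s + δ) (DerivFNLS.projPos φ))) ∧
    (DerivFNLS.IsBackwardSolution F α s T φ u →
      (0 < DerivFNLS.imOmegaMean F φ → ∀ δ ∈ Set.Ioo (0 : ℝ) (min (α - 2) 1),
        DerivFNLS.MemSobolev (s + δ) (DerivFNLS.projPos φ)) ∧
      (DerivFNLS.imOmegaMean F φ < 0 → ∀ δ ∈ Set.Ioo (0 : ℝ) (min (α - 2) 1),
        DerivFNLS.MemSobolev (s + δ) (DerivFNLS.projNeg φ))) := by
  have hs' : 5 / 2 < s := (le_max_right _ _).trans_lt hs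
  have hpos : ∀ k : ℤ, 0 < k → (0 : ℝ) < k := fun k hk => by exact_mod_cast hk
  have hneg : ∀ k : ℤ, k < 0 → (k : ℝ) < 0 := fun k hk => by exact_mod_cast hk
  refine ⟨fun hu => ?_, fun hu => ?_⟩
  · obtain ⟨K, c, hK, hc, h0⟩ := hu.exists_isCoeffSolution hs' hT
    refine ⟨fun hμ δ hδ => ?_, fun hμ δ hδ => ?_⟩
    · refine hc.memSobolev_projection hK hα (by simp) hs' hT hφ h0 hδ (fun k => k < 0)
        fun k hk => ?_
      nlinarith [hneg k hk]
    · refine hc.memSobolev_projection hK hα (by simp) hs' hT hφ h0 hδ (fun k => 0 < k)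
        fun k hk => ?_
      nlinarith [hpos k hk]
  · obtain ⟨K, c, hK, hc, h0⟩ := hu.exists_isCoeffSolution hs' hT
    refine ⟨fun hμ δ hδ => ?_, fun hμ δ hδ => ?_⟩
    · refine hc.memSobolev_projection hK hα (by simp) hs' hT hφ h0 hδ (fun k => 0 < k)
        fun k hk => ?_
      nlinarith [hpos k hk]
    · refine hc.memSobolev_projection hK hα (by simp) hs' hT hφ h0 hδ (fun k => k < 0)
        fun k hk => ?_
      nlinarith [hneg k hk]
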